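/- For a real index $n\ge 0$, a scaled polytrope function of index $n$ is a continuous function $\Theta:[0,\pi]\to\mathbb R$, twice continuously differentiable on $(0,\pi)$, for which there is a scale factor $S>0$ with $$\frac{1}{z^2}\frac{d}{dz}\Big(z^2\frac{d\Theta}{dz}\Big)=-S^{\,n-1}\,\Theta(z)^n\qquad(0<z<\pi),$$ $$\Theta(0)=1,\qquad \Theta'(0)=0,\qquad \Theta(z)>0\ \text{ for } 0\le z<\pi,\qquad \Theta(\pi)=0 .$$ Let $\mu(n)=\int_0^\pi \Theta(z)^n z^2\,dz$ be its second moment. For all sufficiently small $n\ge 0$ and for all $n$ sufficiently close to $1$, such a $\Theta$ exists and $\mu(n)$ does not depend on the choice of $(S,\Theta)$. Moreover: (a) As $n\to 0$, $n\ge 0$, $$\mu(n)=\mu_0^{(0)}+\mu_0^{(1)}n+\mu_0^{(2)}n^2+\mu_0^{(3)}n^3+O(n^4),$$ where $$\mu_0^{(0)}=\frac{\pi^3}{3},\qquad \mu_0^{(1)}=\frac{2\pi^3}{9}\,(-4+3\ln 2),$$ $$\mu_0^{(2)}=\frac{\pi^3}{54}\left(-21\pi^2+200+12\ln 2+36\ln^2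 2\right),$$ $$\mu_0^{(3)}=\frac{\pi^3}{81}\left(-3464+75\pi^2-210\ln 2-63\pi^2\ln 2+180\ln^2 2+36\ln^3 2+2646\,\zeta(3)\right).$$ (b) As $n\to 1$ (from both sides), $$\mu(n)=\mu_1^{(0)}+\mu_1^{(1)}(n-1)+O\big((n-1)^2\big),$$ where $$\mu_1^{(0)}=\pi,\qquad \mu_1^{(1)}=\frac{\pi}{4}\left[-\mathrm{Cin}(2\pi)+6-4\ln(2\pi)\right]-\frac12\,\mathrm{Si}(2\pi),$$ with $\mathrm{Si}(x)=\int_0^x \frac{\sin t}{t}\,dt$ and $\mathrm{Cin}(x)=\int_0^x\frac{1-\cos t}{t}\,dt$. -/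

import Mathlib

open Real Set Filter Topology Asymptotics

/-- The radial Laplacian `(1 / z²) d/dz (z² dΘ/dz)`. -/
noncomputable def radialLaplacian (Θ : ℝ → ℝ) (z : ℝ) : ℝ :=
  1 / z ^ 2 * deriv (fun s => s ^ 2 * deriv Θ s) z

/-- `Θ` on `[0, π]` is a scaled polytrope function of index `n` with scale factor `S`:
it solves the scaled Lane-Emden equation on `(0, π)`, satisfies `Θ(0) = 1`, `Θ'(0) = 0`
(a one-sided derivative), and `π` is its first zero. The values of `Θ` outside `[0, π]`
are irrelevant. -/
structure IsScaledPolytrope (n S : ℝ) (Θ : ℝ → ℝ) : Prop where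
  scale_pos : 0 < S
  continuousOn : ContinuousOn Θ (Icc 0 π)
  contDiffOn : ContDiffOn ℝ 2 Θ (Ioo 0 π)
  map_zero : Θ 0 = 1
  deriv_zero : HasDerivWithinAt Θ 0 (Ici 0) 0
  pos : ∀ z ∈ Ico 0 π, 0 < Θ z
  map_pi : Θ π = 0
  equation : ∀ z ∈ Ioo 0 π, radialLaplacian Θ z = -(S ^ (n - 1) * Θ z ^ n)

/-- `m` is the second moment `∫₀^π Θ(z)ⁿ z² dz` for a scaled polytrope function `Θ` of
index `n`. -/
def IsSecondMoment (n m : ℝ) : Prop :=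
  ∃ (S : ℝ) (Θ : ℝ → ℝ), IsScaledPolytrope n S Θ ∧ m = ∫ z in (0 : ℝ)..π, Θ z ^ n * z ^ 2

/-- The sine integral. -/
noncomputable def sineIntegral (x : ℝ) : ℝ := ∫ t in (0 : ℝ)..x, sin t / t

/-- The entire cosine integral `Cin`. -/
noncomputable def cosineIntegralCin (x : ℝ) : ℝ := ∫ t in (0 : ℝ)..x, (1 - cos t) / t

/-! Integrating the equation once gives z² Θ' = -λ ∫₀^z t² Θⁿ with λ = S^(n-1); the constant of
integration vanishes because Θ'(0) = 0. In this form the initial value problem has one solution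
(`IsLaneEmden.eqOn_Ico`), and a dilation of z changes λ and the first zero together, so a zero at π
determines λ and the moment (`IsSecondMoment.unique`). It remains to construct one solution for each
n and to expand its moment.

Near n = 0 the problem is moved to the unit ball, as Y = (3/2) G(Yⁿ) with G the radial Dirichlet
Green operator. The solution at n = 0 is `seed`, and writing Y = seed * exp ℓ makes the equation a
fixed point problem for ℓ with contraction factor n (`exists_isProfile`). Then μ = π³ m / Y(0)ⁿ with
m = ∫ x² Yⁿ. Because of the exponent n, the value Y(0) is needed only to second order, but m is
needed to third order. The order of m comes from a variational argument. The Pohozaev identity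
expresses m² through ∫ x² Y^(n+1), and Y is a critical point of the energy ∫ x² Z^(n+1) - (n+1)/2 ∫
x² g Z, where Z = (3/2) G g. The trial function Z = seed + n * corr is off by O(n²), so its energy
is off by O(n⁴) (`IsProfile.exists_energy_sub`). Its energy is computed from integrals of
polynomials times logarithms of (1 ± x)/2, which produce π² and ζ(3); log 2 enters through Y(0).

Near n = 1 put ε = n - 1. The function u = zΘ solves u'' + u = -p with u(0) = 0, u'(0) = 1 and a
forcing p of size O(ε). The condition u(π) = 0 means that p is orthogonal to sin, and it fixes the
correction of the eigenvalue λ (a Lyapunov-Schmidt reduction). The relative deviation f of u from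
sin is then the fixed point of a map with Lipschitz constant O(ε) (`exists_fixedPoint_forcing`). The
moment is the boundary term π (1 - ∫ cos * p) / λ, and its first order is given by the integrals of
sin² and sin cos against log (sin t / t), where Si and Cin appear. -/

open MeasureTheory intervalIntegral

/-! ### First-integral form of the equation and uniqueness of the moment -/

/-- `y` solves the radial Lane-Emden equation on `(0, b)` in first-integral form, with `y 0 = 1`
and first zero `b`. -/
structure IsLaneEmden (n lam b : ℝ) (y : ℝ → ℝ) : Prop where
  lam_pos : 0 < lam
  b_pos : 0 < b
  cont : ContinuousOn y (Icc 0 b)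
  map_zero : y 0 = 1
  pos : ∀ z ∈ Ico 0 b, 0 < y z
  map_end : y b = 0
  hasDerivAt : ∀ z ∈ Ioo 0 b,
    HasDerivAt y (-(lam * (∫ t in (0 : ℝ)..z, t ^ 2 * y t ^ n) / z ^ 2)) z

theorem continuousOn_sq_mul_rpow {n b : ℝ} {y : ℝ → ℝ} (hc : ContinuousOn y (Icc 0 b))
    (hp : ∀ z ∈ Ico 0 b, 0 < y z) : ContinuousOn (fun t => t ^ 2 * y t ^ n) (Ico 0 b) := by
  refine (continuousOn_id.pow 2).mul (ContinuousOn.rpow_const (hc.mono Ico_subset_Icc_self) ?_)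
  intro x hx
  exact Or.inl (hp x hx).ne'

theorem intervalIntegrable_of_continuousOn_Ico {f : ℝ → ℝ} {a b c d : ℝ}
    (hf : ContinuousOn f (Ico a b)) (hc : c ∈ Ico a b) (hd : d ∈ Ico a b) :
    IntervalIntegrable f volume c d :=
  (hf.mono ((ordConnected_Ico.uIcc_subset hc hd))).intervalIntegrable

theorem hasDerivAt_integral_of_continuousOn_Ico {f : ℝ → ℝ} {a b z : ℝ}
    (hf : ContinuousOn f (Ico a b)) (hz : z ∈ Ioo a b) :
    HasDerivAt (fun u => ∫ t in a..u, f t) (f z) z := by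
  have hn : Ioo a b ∈ 𝓝 z := isOpen_Ioo.mem_nhds hz
  refine integral_hasDerivAt_right
    (intervalIntegrable_of_continuousOn_Ico hf ⟨le_rfl, hz.1.trans hz.2⟩ ⟨hz.1.le, hz.2⟩) ?_ ?_
  · exact (hf.mono Ioo_subset_Ico_self).stronglyMeasurableAtFilter isOpen_Ioo z hz
  · exact (hf.mono Ioo_subset_Ico_self).continuousAt hn

/-- The quantity z² Θ' + λ ∫₀^z t² Θⁿ has zero derivative on (0, π). Its constant value is 0,
although Θ' is not assumed continuous at 0: the one-sided derivative there bounds difference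
quotients, hence Θ' at points arbitrarily close to 0. -/
theorem IsScaledPolytrope.isLaneEmden {n S : ℝ} {Θ : ℝ → ℝ} (h : IsScaledPolytrope n S Θ) :
    IsLaneEmden n (S ^ (n - 1)) π Θ := by
  have hlam : 0 < S ^ (n - 1) := rpow_pos_of_pos h.scale_pos _
  refine ⟨hlam, pi_pos, h.continuousOn, h.map_zero, h.pos, h.map_pi, ?_⟩
  set lam := S ^ (n - 1) with hl
  set f : ℝ → ℝ := fun t => t ^ 2 * Θ t ^ n with hf
  have hfc : ContinuousOn f (Ico 0 π) := continuousOn_sq_mul_rpow h.continuousOn h.pos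
  set M : ℝ → ℝ := fun z => ∫ t in (0 : ℝ)..z, f t with hM
  have hΘd : ∀ z ∈ Ioo 0 π, HasDerivAt Θ (deriv Θ z) z := fun z hz =>
    ((h.contDiffOn.contDiffAt (isOpen_Ioo.mem_nhds hz)).differentiableAt (by norm_num)).hasDerivAt
  have hg : ∀ z ∈ Ioo 0 π, HasDerivAt (fun s => s ^ 2 * deriv Θ s) (-(lam * f z)) z := by
    intro z hz
    have h1 : DifferentiableAt ℝ (deriv Θ) z := by
      have : ContDiffOn ℝ 1 (deriv Θ) (Ioo 0 π) :=
        ((contDiffOn_succ_iff_deriv_of_isOpen (n := 1) isOpen_Ioo).1 h.contDiffOn).2.2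
      exact (this.contDiffAt (isOpen_Ioo.mem_nhds hz)).differentiableAt (by norm_num)
    have h2 : DifferentiableAt ℝ (fun s => s ^ 2 * deriv Θ s) z :=
      (differentiableAt_id.pow 2).mul h1
    have h3 := h.equation z hz
    unfold radialLaplacian at h3
    have hz0 : z ≠ 0 := hz.1.ne'
    have h4 : deriv (fun s => s ^ 2 * deriv Θ s) z = -(lam * f z) := by
      field_simp at h3
      rw [h3, hf]; ring
    rw [← h4]; exact h2.hasDerivAt
  have hMd : ∀ z ∈ Ioo 0 π, HasDerivAt M (f z) z := fun z hz =>
    hasDerivAt_integral_of_continuousOn_Ico hfc hz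
  obtain ⟨c, hc⟩ : ∃ c, ∀ z ∈ Ioo 0 π, z ^ 2 * deriv Θ z + lam * M z = c := by
    have hd : ∀ z ∈ Ioo 0 π, HasDerivAt (fun s => s ^ 2 * deriv Θ s + lam * M s) 0 z := by
      intro z hz
      exact ((hg z hz).add ((hMd z hz).const_mul lam)).congr_deriv (by ring)
    have := isOpen_Ioo.exists_is_const_of_deriv_eq_zero (𝕜 := ℝ) isPreconnected_Ioo
      (fun z hz => (hd z hz).differentiableAt.differentiableWithinAt)
      (fun z hz => (hd z hz).deriv)
    simpa using this
  have hMlim : Tendsto M (𝓝[>] 0) (𝓝 0) := by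
    have h1 : ContinuousOn M (Icc 0 1) := by
      have : IntegrableOn f (uIcc (0:ℝ) 1) := by
        rw [uIcc_of_le zero_le_one]
        refine (hfc.mono ?_).integrableOn_Icc
        intro x hx
        exact ⟨hx.1, hx.2.trans_lt (by linarith [pi_gt_three])⟩
      simpa [uIcc_of_le (zero_le_one' ℝ)] using continuousOn_primitive_interval this
    have h2 := (h1 0 (by simp)).tendsto
    simp only [hM, integral_same] at h2
    exact h2.mono_left (nhdsWithin_le_of_mem (mem_of_superset
      (Ioo_mem_nhdsGT (zero_lt_one' ℝ)) Ioo_subset_Icc_self))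
  have hc0 : c = 0 := by
    -- With c ≠ 0, a point ξ near 0 from the mean value theorem has ξ² |Θ' ξ| ≤ |c|/4 and |λ M ξ| <
    -- |c|/2, which cannot add up to |c|.
    by_contra hne
    have hη : 0 < |c| / 2 := by positivity
    have e1 : ∀ᶠ z in 𝓝[>] (0 : ℝ), |lam * M z| < |c| / 2 := by
      have := (hMlim.const_mul lam).abs
      simp only [mul_zero, abs_zero] at this
      exact this.eventually_lt_const hη
    obtain ⟨δ, hδ, hδ'⟩ := mem_nhdsGT_iff_exists_Ioo_subset.1 e1
    have e2 : ∀ᶠ z in 𝓝[>] (0 : ℝ), |Θ z - Θ 0| ≤ |c| / 4 * |z - 0| := by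
      have := h.deriv_zero.isLittleO.def (c := |c| / 4) (by positivity)
      simp only [smul_zero, sub_zero, Real.norm_eq_abs] at this ⊢
      exact (nhdsWithin_mono 0 Ioi_subset_Ici_self) this
    have e3 : ∀ᶠ z in 𝓝[>] (0 : ℝ), z ∈ Ioo 0 (min δ 1) :=
      Ioo_mem_nhdsGT (lt_min hδ one_pos)
    obtain ⟨z, hz2, hz3⟩ := (e2.and e3).exists
    have hz1 : z < 1 := hz3.2.trans_le (min_le_right _ _)
    have hzδ : z < δ := hz3.2.trans_le (min_le_left _ _)
    have hzp : z < π := by linarith [pi_gt_three]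
    obtain ⟨ξ, hξ, hξ'⟩ := exists_deriv_eq_slope Θ hz3.1
      (h.continuousOn.mono (Icc_subset_Icc_right hzp.le))
      (fun x hx => (hΘd x ⟨hx.1, hx.2.trans hzp⟩).differentiableAt.differentiableWithinAt)
    have h5 := hc ξ ⟨hξ.1, hξ.2.trans hzp⟩
    have h6 : |lam * M ξ| < |c| / 2 := hδ' ⟨hξ.1, hξ.2.trans hzδ⟩
    have h7 : |deriv Θ ξ| ≤ |c| / 4 := by
      rw [hξ', abs_div, sub_zero, abs_of_pos hz3.1, div_le_iff₀ hz3.1]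
      simpa [abs_of_pos hz3.1] using hz2
    have h8 : |ξ ^ 2 * deriv Θ ξ| ≤ |c| / 4 := by
      rw [abs_mul, abs_of_nonneg (sq_nonneg ξ)]
      have : ξ ^ 2 ≤ 1 := by
        have := hξ.1; have := hξ.2; nlinarith
      nlinarith [abs_nonneg (deriv Θ ξ)]
    have h9 := abs_add_le (ξ ^ 2 * deriv Θ ξ) (lam * M ξ)
    rw [h5] at h9
    have : 0 < |c| := abs_pos.2 hne
    linarith
  intro z hz
  have h1 := hc z hz
  rw [hc0] at h1
  have hz0 : z ≠ 0 := hz.1.ne'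
  have h2 : deriv Θ z = -(lam * M z / z ^ 2) := by
    field_simp
    linarith
  have := hΘd z hz
  rwa [h2] at this

/-- Dilation trades the eigenvalue for the length of the interval. It serves both to compare
different eigenvalues and to move solutions from the unit ball to [0, π]. -/
theorem IsLaneEmden.scale {n lam b c : ℝ} {y : ℝ → ℝ} (h : IsLaneEmden n lam b y) (hc : 0 < c) :
    IsLaneEmden n (lam * c ^ 2) (b / c) (fun z => y (c * z)) := by
  have hm : ∀ z, z ∈ Icc 0 (b / c) → c * z ∈ Icc 0 b := fun z hz =>
    ⟨mul_nonneg hc.le hz.1, by have := (le_div_iff₀ hc).1 hz.2; linarith⟩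
  refine ⟨mul_pos h.lam_pos (pow_pos hc 2), div_pos h.b_pos hc, ?_, by simp [h.map_zero], ?_, ?_, ?_⟩
  · exact h.cont.comp (continuousOn_const.mul continuousOn_id) hm
  · intro z hz
    exact h.pos _ ⟨mul_nonneg hc.le hz.1, by have := (lt_div_iff₀ hc).1 hz.2; linarith⟩
  · have : c * (b / c) = b := by field_simp
    simp only [this, h.map_end]
  · intro z hz
    have hz' : c * z ∈ Ioo 0 b :=
      ⟨mul_pos hc hz.1, by have := (lt_div_iff₀ hc).1 hz.2; linarith⟩
    have h1 := (h.hasDerivAt _ hz').comp z ((hasDerivAt_id z).const_mul c)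
    have h2 : (∫ t in (0 : ℝ)..c * z, t ^ 2 * y t ^ n)
        = c ^ 3 * ∫ t in (0 : ℝ)..z, t ^ 2 * y (c * t) ^ n := by
      have := intervalIntegral.mul_integral_comp_mul_left (f := fun t => t ^ 2 * y t ^ n) (a := 0)
        (b := z) c
      rw [mul_zero] at this
      rw [← this, ← intervalIntegral.integral_const_mul, ← intervalIntegral.integral_const_mul]
      congr 1; ext t; ring
    refine h1.congr_deriv ?_
    rw [h2]
    have hz0 : z ≠ 0 := hz.1.ne'
    field_simp

theorem IsLaneEmden.moment_eq_of_scale {n b c : ℝ} {y : ℝ → ℝ} (hc : 0 < c) :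
    (∫ z in (0 : ℝ)..(b / c), y (c * z) ^ n * z ^ 2)
      = (∫ x in (0 : ℝ)..b, y x ^ n * x ^ 2) / c ^ 3 := by
  have := intervalIntegral.mul_integral_comp_mul_left (f := fun t => y t ^ n * t ^ 2) (a := 0)
        (b := b / c) c
  have hb : c * (b / c) = b := by field_simp
  rw [mul_zero, hb] at this
  rw [eq_div_iff (by positivity), ← this, mul_comm, ← intervalIntegral.integral_const_mul,
    ← intervalIntegral.integral_const_mul]
  congr 1; ext t; ring

/-- A Grönwall argument. The power tⁿ need not be Lipschitz at 0, so the comparison is made on [0,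
β] with β < b₁, where both solutions stay in a compact subset of (0, ∞). The singular factor 1/z² is
absorbed by t² ≤ z² under the integral. -/
theorem IsLaneEmden.eqOn_Ico {n lam b₁ b₂ : ℝ} {y₁ y₂ : ℝ → ℝ} (h₁ : IsLaneEmden n lam b₁ y₁)
    (h₂ : IsLaneEmden n lam b₂ y₂) (hb : b₁ ≤ b₂) : EqOn y₁ y₂ (Ico 0 b₁) := by
  intro x hx
  obtain ⟨β, hxβ, hβ⟩ := exists_between hx.2
  have hβ0 : 0 < β := hx.1.trans_lt hxβ
  have hsub₁ : Icc 0 β ⊆ Ico 0 b₁ := fun z hz => ⟨hz.1, hz.2.trans_lt hβ⟩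
  have hsub₂ : Icc 0 β ⊆ Ico 0 b₂ := fun z hz => ⟨hz.1, (hz.2.trans_lt hβ).trans_le hb⟩
  have c₁ : ContinuousOn y₁ (Icc 0 β) := h₁.cont.mono (hsub₁.trans Ico_subset_Icc_self)
  have c₂ : ContinuousOn y₂ (Icc 0 β) := h₂.cont.mono (hsub₂.trans Ico_subset_Icc_self)
  have hcomp : IsCompact (y₁ '' Icc 0 β ∪ y₂ '' Icc 0 β) :=
    (isCompact_Icc.image_of_continuousOn c₁).union (isCompact_Icc.image_of_continuousOn c₂)
  have hne : (y₁ '' Icc 0 β ∪ y₂ '' Icc 0 β).Nonempty :=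
    ⟨y₁ 0, Or.inl ⟨0, ⟨le_rfl, hβ0.le⟩, rfl⟩⟩
  obtain ⟨m, hm, hm'⟩ := hcomp.exists_isLeast hne
  obtain ⟨M, hM, hM'⟩ := hcomp.exists_isGreatest hne
  have hm0 : 0 < m := by
    rcases hm with ⟨z, hz, rfl⟩ | ⟨z, hz, rfl⟩
    · exact h₁.pos z (hsub₁ hz)
    · exact h₂.pos z (hsub₂ hz)
  have i₁ : ∀ z ∈ Icc 0 β, y₁ z ∈ Icc m M := fun z hz =>
    ⟨hm' (Or.inl ⟨z, hz, rfl⟩), hM' (Or.inl ⟨z, hz, rfl⟩)⟩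
  have i₂ : ∀ z ∈ Icc 0 β, y₂ z ∈ Icc m M := fun z hz =>
    ⟨hm' (Or.inr ⟨z, hz, rfl⟩), hM' (Or.inr ⟨z, hz, rfl⟩)⟩
  obtain ⟨K, hK⟩ : ∃ K, LipschitzOnWith K (fun t : ℝ => t ^ n) (Icc m M) := by
    refine ContDiffOn.exists_lipschitzOnWith (n := 1) ?_ one_ne_zero (convex_Icc m M)
      isCompact_Icc
    intro t ht
    exact (Real.contDiffAt_rpow_const_of_ne (hm0.trans_le ht.1).ne').contDiffWithinAt
  have hLip : ∀ z ∈ Icc 0 β, |y₁ z ^ n - y₂ z ^ n| ≤ K * |y₁ z - y₂ z| := by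
    intro z hz
    have := hK.dist_le_mul _ (i₁ z hz) _ (i₂ z hz)
    simpa [Real.dist_eq] using this
  set d : ℝ → ℝ := fun z => y₁ z - y₂ z with hd
  have cd : ContinuousOn d (Icc 0 β) := c₁.sub c₂
  have cad : ContinuousOn (fun z => |d z|) (Icc 0 β) := cd.abs
  set F : ℝ → ℝ := fun z => ∫ t in (0 : ℝ)..z, |d t| with hF
  have Iad : ∀ z ∈ Icc 0 β, IntervalIntegrable (fun z => |d z|) volume 0 z := fun z hz =>
    ContinuousOn.intervalIntegrable_of_Icc hz.1 (cad.mono (Icc_subset_Icc_right hz.2))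
  have hFmono : ∀ z ∈ Icc 0 β, ∀ w ∈ Icc 0 z, F w ≤ F z := by
    intro z hz w hw
    exact intervalIntegral.integral_mono_interval le_rfl hw.1 hw.2
      (Eventually.of_forall fun t => abs_nonneg _) (Iad z hz)
  have hF0 : ∀ z ∈ Icc 0 β, 0 ≤ F z := fun z hz =>
    intervalIntegral.integral_nonneg hz.1 fun t _ => abs_nonneg _
  have hlam := h₁.lam_pos
  have hder : ∀ z ∈ Ioo 0 β, ∃ d', HasDerivAt d d' z ∧ |d'| ≤ lam * K * F z := by
    intro z hz
    refine ⟨_, (h₁.hasDerivAt z ⟨hz.1, hz.2.trans hβ⟩).sub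
      (h₂.hasDerivAt z ⟨hz.1, (hz.2.trans hβ).trans_le hb⟩), ?_⟩
    have hzI : Icc 0 z ⊆ Icc 0 β := Icc_subset_Icc_right hz.2.le
    have I₁ : IntervalIntegrable (fun t => t ^ 2 * y₁ t ^ n) volume 0 z :=
      ContinuousOn.intervalIntegrable_of_Icc hz.1.le
        ((continuousOn_sq_mul_rpow h₁.cont h₁.pos).mono (hzI.trans hsub₁))
    have I₂ : IntervalIntegrable (fun t => t ^ 2 * y₂ t ^ n) volume 0 z :=
      ContinuousOn.intervalIntegrable_of_Icc hz.1.le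
        ((continuousOn_sq_mul_rpow h₂.cont h₂.pos).mono (hzI.trans hsub₂))
    have e : -(lam * (∫ t in (0 : ℝ)..z, t ^ 2 * y₁ t ^ n) / z ^ 2)
        - -(lam * (∫ t in (0 : ℝ)..z, t ^ 2 * y₂ t ^ n) / z ^ 2)
        = -(lam / z ^ 2 * ∫ t in (0 : ℝ)..z, (t ^ 2 * y₁ t ^ n - t ^ 2 * y₂ t ^ n)) := by
      rw [intervalIntegral.integral_sub I₁ I₂]; ring
    rw [e, abs_neg, abs_mul, abs_of_pos (div_pos hlam (pow_pos hz.1 2))]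
    have hle : |∫ t in (0 : ℝ)..z, (t ^ 2 * y₁ t ^ n - t ^ 2 * y₂ t ^ n)|
        ≤ ∫ t in (0 : ℝ)..z, z ^ 2 * K * |d t| := by
      refine (intervalIntegral.abs_integral_le_integral_abs hz.1.le).trans ?_
      refine intervalIntegral.integral_mono_on hz.1.le (I₁.sub I₂).abs
        ((Iad z ⟨hz.1.le, hz.2.le⟩).const_mul _) ?_
      intro t ht
      rw [← mul_sub, abs_mul, abs_of_nonneg (sq_nonneg t), mul_assoc]
      exact mul_le_mul (pow_le_pow_left₀ ht.1 ht.2 2) (hLip t (hzI ht)) (abs_nonneg _)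
        (sq_nonneg z)
    rw [intervalIntegral.integral_const_mul] at hle
    calc lam / z ^ 2 * _ ≤ lam / z ^ 2 * (z ^ 2 * K * F z) :=
          mul_le_mul_of_nonneg_left hle (div_pos hlam (pow_pos hz.1 2)).le
      _ = lam * K * F z := by have := hz.1.ne'; field_simp
  have hdz : ∀ z ∈ Icc 0 β, |d z| ≤ lam * K * β * F z := by
    intro z hz
    rcases hz.1.eq_or_lt with h0 | h0
    · rw [← h0]; simp [d, h₁.map_zero, h₂.map_zero, hF]
    · obtain ⟨ξ, hξ, hξ'⟩ := exists_deriv_eq_slope d h0 (cd.mono (Icc_subset_Icc_right hz.2))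
        (fun w hw => by
          obtain ⟨d', h, -⟩ := hder w ⟨hw.1, hw.2.trans_le hz.2⟩
          exact h.differentiableAt.differentiableWithinAt)
      obtain ⟨d', h, hb'⟩ := hder ξ ⟨hξ.1, hξ.2.trans_le hz.2⟩
      rw [h.deriv] at hξ'
      have hd0 : d 0 = 0 := by simp [d, h₁.map_zero, h₂.map_zero]
      rw [hd0, sub_zero, sub_zero, eq_div_iff h0.ne'] at hξ'
      rw [← hξ', abs_mul, abs_of_pos h0]
      have h6 : |d'| ≤ lam * K * F z := hb'.trans
        (mul_le_mul_of_nonneg_left (hFmono z hz ξ ⟨hξ.1.le, hξ.2.le⟩)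
          (mul_nonneg hlam.le K.coe_nonneg))
      calc |d'| * z ≤ lam * K * F z * β := mul_le_mul h6 hz.2 h0.le
            (mul_nonneg (mul_nonneg hlam.le K.coe_nonneg) (hF0 z hz))
        _ = _ := by ring
  have hFc : ContinuousOn F (Icc 0 β) := by
    have := continuousOn_primitive_interval (μ := volume) (f := fun z => |d z|) (a := 0) (b := β)
      (by rw [uIcc_of_le hβ0.le]; exact cad.integrableOn_Icc)
    rwa [uIcc_of_le hβ0.le] at this
  -- Grönwall is applied to F, the integral of |d|, because `hdz` bounds |d| = F' by a multiple of
  -- F.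
  have hFz : ∀ z ∈ Icc 0 β, F z = 0 := by
    refine eq_zero_of_abs_deriv_le_mul_abs_self_of_eq_zero_right (K := lam * K * β)
      (f' := fun z => |d z|) hFc ?_ (by simp [hF]) ?_
    · intro z hz
      refine integral_hasDerivWithinAt_right (Iad z ⟨hz.1, hz.2.le⟩) (s := Ici z) (t := Ioi z) ?_ ?_
      · rw [← nhdsWithin_Ioo_eq_nhdsGT hz.2]
        exact (cad.mono fun t ht => ⟨hz.1.trans ht.1.le, ht.2.le⟩
          ).stronglyMeasurableAtFilter_nhdsWithin measurableSet_Ioo z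
      · exact (cad z ⟨hz.1, hz.2.le⟩).mono_of_mem_nhdsWithin (mem_of_superset
          (Ioo_mem_nhdsGT hz.2) fun t ht => ⟨hz.1.trans ht.1.le, ht.2.le⟩)
    · intro z hz
      simpa [abs_of_nonneg (hF0 z ⟨hz.1, hz.2.le⟩)] using hdz z ⟨hz.1, hz.2.le⟩
  have hx' : x ∈ Icc 0 β := ⟨hx.1, hxβ.le⟩
  have := hdz x hx'
  rw [hFz x hx', mul_zero] at this
  exact sub_eq_zero.1 (abs_nonpos_iff.1 this)

theorem IsLaneEmden.end_eq {n lam b₁ b₂ : ℝ} {y₁ y₂ : ℝ → ℝ} (h₁ : IsLaneEmden n lam b₁ y₁)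
    (h₂ : IsLaneEmden n lam b₂ y₂) (hb : b₁ ≤ b₂) : b₁ = b₂ := by
  by_contra hne
  have hlt : b₁ < b₂ := lt_of_le_of_ne hb hne
  have he : EqOn y₁ y₂ (closure (Ico 0 b₁)) := by
    rw [closure_Ico h₁.b_pos.ne]
    refine (h₁.eqOn_Ico h₂ hb).of_subset_closure h₁.cont (h₂.cont.mono (Icc_subset_Icc_right hb))
      Ico_subset_Icc_self ?_
    rw [closure_Ico h₁.b_pos.ne]
  rw [closure_Ico h₁.b_pos.ne] at he
  have := he ⟨h₁.b_pos.le, le_rfl⟩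
  rw [h₁.map_end] at this
  exact (h₂.pos b₁ ⟨h₁.b_pos.le, hlt⟩).ne this

/-- Dilating the second solution by c = √(λ₁/λ₂) ≤ 1 gives it the eigenvalue of the first and moves
its zero to b/c ≥ b. Equality of first zeros forces c = 1, so the solutions coincide. -/
theorem IsLaneEmden.moment_unique_of_le {n lam₁ lam₂ b : ℝ} {y₁ y₂ : ℝ → ℝ}
    (h₁ : IsLaneEmden n lam₁ b y₁) (h₂ : IsLaneEmden n lam₂ b y₂) (hl : lam₁ ≤ lam₂) :
    ∫ z in (0 : ℝ)..b, y₁ z ^ n * z ^ 2 = ∫ z in (0 : ℝ)..b, y₂ z ^ n * z ^ 2 := by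
  set c := √(lam₁ / lam₂) with hc
  have hr : 0 < lam₁ / lam₂ := div_pos h₁.lam_pos h₂.lam_pos
  have hc0 : 0 < c := Real.sqrt_pos.2 hr
  have hc1 : c ≤ 1 := by
    exact Real.sqrt_le_one.2 ((div_le_one h₂.lam_pos).2 hl)
  have hsq : lam₂ * c ^ 2 = lam₁ := by
    rw [hc, Real.sq_sqrt hr.le]; have := h₂.lam_pos.ne'; field_simp
  have h₂' := h₂.scale hc0
  rw [hsq] at h₂'
  have hle : b ≤ b / c := by
    rw [le_div_iff₀ hc0]; nlinarith [h₁.b_pos]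
  have hb := h₁.end_eq h₂' hle
  have hc1' : c = 1 := by
    rw [eq_div_iff hc0.ne'] at hb
    have := h₁.b_pos.ne'
    exact mul_left_cancel₀ this (by linarith)
  rw [hc1', div_one] at h₂'
  simp only [one_mul] at h₂'
  have he := h₁.eqOn_Ico h₂' le_rfl
  refine intervalIntegral.integral_congr_ae ?_
  have : ∀ᵐ z : ℝ, z ≠ b := by simp [ae_iff]
  filter_upwards [this] with z hz hz'
  rw [uIoc_of_le h₁.b_pos.le] at hz'
  rw [he ⟨hz'.1.le, lt_of_le_of_ne hz'.2 hz⟩]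

theorem IsLaneEmden.moment_unique {n lam₁ lam₂ b : ℝ} {y₁ y₂ : ℝ → ℝ}
    (h₁ : IsLaneEmden n lam₁ b y₁) (h₂ : IsLaneEmden n lam₂ b y₂) :
    ∫ z in (0 : ℝ)..b, y₁ z ^ n * z ^ 2 = ∫ z in (0 : ℝ)..b, y₂ z ^ n * z ^ 2 := by
  rcases le_total lam₁ lam₂ with h | h
  · exact h₁.moment_unique_of_le h₂ h
  · exact (h₂.moment_unique_of_le h₁ h).symm

theorem IsLaneEmden.isScaledPolytrope {n lam S : ℝ} {y : ℝ → ℝ} (h : IsLaneEmden n lam π y)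
    (hS : 0 < S) (hlam : S ^ (n - 1) = lam) : IsScaledPolytrope n S y := by
  set f : ℝ → ℝ := fun t => t ^ 2 * y t ^ n with hf
  have hfc : ContinuousOn f (Ico 0 π) := continuousOn_sq_mul_rpow h.cont h.pos
  set M : ℝ → ℝ := fun z => ∫ t in (0 : ℝ)..z, f t with hM
  have hMd : ∀ z ∈ Ioo 0 π, HasDerivAt M (f z) z := fun z hz =>
    hasDerivAt_integral_of_continuousOn_Ico hfc hz
  have hMc : ContinuousOn M (Ioo 0 π) := fun z hz => (hMd z hz).continuousAt.continuousWithinAt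
  have hfc' := hfc.mono Ioo_subset_Ico_self
  have hyd : ∀ z ∈ Ioo 0 π, HasDerivAt y (-(lam * M z / z ^ 2)) z := h.hasDerivAt
  have hdM : ∀ z ∈ Ioo 0 π, HasDerivAt (fun z => -(lam * M z / z ^ 2))
      (-((lam * f z * z ^ 2 - lam * M z * (2 * z)) / (z ^ 2) ^ 2)) z := by
    intro z hz
    have h1 : HasDerivAt (fun z : ℝ => z ^ 2) (2 * z) z := by simpa using hasDerivAt_pow 2 z
    exact (((hMd z hz).const_mul lam).div h1 (pow_ne_zero 2 hz.1.ne')).neg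
  refine ⟨hS, h.cont, ?_, h.map_zero, ?_, h.pos, h.map_end, ?_⟩
  · have e2 : (2 : WithTop ℕ∞) = 1 + 1 := by norm_num
    rw [e2, contDiffOn_succ_iff_deriv_of_isOpen isOpen_Ioo]
    refine ⟨fun z hz => (hyd z hz).differentiableAt.differentiableWithinAt, by simp, ?_⟩
    have hcd : ContDiffOn ℝ 1 (fun z => -(lam * M z / z ^ 2)) (Ioo 0 π) := by
      have e1 : (1 : WithTop ℕ∞) = 0 + 1 := by norm_num
      rw [e1, contDiffOn_succ_iff_deriv_of_isOpen isOpen_Ioo]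
      refine ⟨fun z hz => (hdM z hz).differentiableAt.differentiableWithinAt, by simp, ?_⟩
      rw [contDiffOn_zero]
      refine ContinuousOn.congr (f := fun z =>
        (-((lam * f z * z ^ 2 - lam * M z * (2 * z)) / (z ^ 2) ^ 2))) ?_
        (fun z hz => (hdM z hz).deriv)
      refine (ContinuousOn.div ?_ (by fun_prop) fun z hz =>
        pow_ne_zero 2 (pow_ne_zero 2 hz.1.ne')).neg
      fun_prop
    exact hcd.congr fun z hz => (hyd z hz).deriv
  · have hsub : Icc (0 : ℝ) 1 ⊆ Ico 0 π := fun z hz =>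
      ⟨hz.1, hz.2.trans_lt (by linarith [pi_gt_three])⟩
    have hrc : ContinuousOn (fun t => y t ^ n) (Icc 0 1) := by
      refine (h.cont.mono (hsub.trans Ico_subset_Icc_self)).rpow_const fun z hz => ?_
      exact Or.inl (h.pos z (hsub hz)).ne'
    obtain ⟨C, hC⟩ := isCompact_Icc.exists_bound_of_continuousOn hrc
    -- The mass is O(z³), so Θ' = -λ M / z² is O(z) and tends to 0 at the origin.
    have hMb : ∀ z ∈ Ioo (0 : ℝ) 1, |M z| ≤ C * z ^ 3 := by
      intro z hz
      have := intervalIntegral.norm_integral_le_of_norm_le_const (f := f) (a := 0) (b := z)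
        (C := z ^ 2 * C) (fun t ht => by
          rw [uIoc_of_le hz.1.le] at ht
          rw [hf, norm_mul, norm_pow, Real.norm_eq_abs t, abs_of_pos ht.1]
          exact mul_le_mul (pow_le_pow_left₀ ht.1.le ht.2 2)
            (hC t ⟨ht.1.le, ht.2.trans hz.2.le⟩) (norm_nonneg _) (sq_nonneg z))
      rw [sub_zero, abs_of_pos hz.1] at this
      calc |M z| ≤ z ^ 2 * C * z := this
        _ = _ := by ring
    refine hasDerivWithinAt_Ici_of_tendsto_deriv (s := Ioo 0 1) ?_ ?_
      (Ioo_mem_nhdsGT one_pos) ?_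
    · exact fun z hz => (hyd z ⟨hz.1, hz.2.trans (by linarith [pi_gt_three])⟩
        ).differentiableAt.differentiableWithinAt
    · exact (h.cont 0 ⟨le_rfl, pi_pos.le⟩).mono
        (fun z hz => ⟨hz.1.le, hz.2.le.trans (by linarith [pi_gt_three])⟩)
    · have hlim : Tendsto (fun z : ℝ => lam * C * z) (𝓝[>] 0) (𝓝 0) := by
        have : Tendsto (fun z : ℝ => lam * C * z) (𝓝 0) (𝓝 (lam * C * 0)) :=
          (continuous_const.mul continuous_id).tendsto 0
        rw [mul_zero] at this
        exact this.mono_left nhdsWithin_le_nhds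
      refine squeeze_zero_norm' ?_ hlim
      filter_upwards [Ioo_mem_nhdsGT (zero_lt_one' ℝ)] with z hz
      rw [(hyd z ⟨hz.1, hz.2.trans (by linarith [pi_gt_three])⟩).deriv, norm_neg, norm_div, norm_mul,
        Real.norm_eq_abs, Real.norm_eq_abs, Real.norm_eq_abs, abs_of_pos h.lam_pos,
        abs_of_pos (pow_pos hz.1 2), div_le_iff₀ (pow_pos hz.1 2)]
      calc lam * |M z| ≤ lam * (C * z ^ 3) := mul_le_mul_of_nonneg_left (hMb z hz) h.lam_pos.le
        _ = _ := by ring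
  · intro z hz
    have hz0 : z ≠ 0 := hz.1.ne'
    have e : (fun s => s ^ 2 * deriv y s) =ᶠ[𝓝 z] fun s => -(lam * M s) := by
      filter_upwards [isOpen_Ioo.mem_nhds hz] with s hs
      rw [(hyd s hs).deriv]
      have := hs.1.ne'
      field_simp
    have h5 : HasDerivAt (fun s => -(lam * M s)) (-(lam * f z)) z := ((hMd z hz).const_mul lam).neg
    rw [radialLaplacian, e.deriv_eq, h5.deriv, hlam, hf]
    field_simp

theorem isSecondMoment_of_isLaneEmden {n lam S : ℝ} {y : ℝ → ℝ} (h : IsLaneEmden n lam π y)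
    (hS : 0 < S) (hlam : S ^ (n - 1) = lam) :
    IsSecondMoment n (∫ z in (0 : ℝ)..π, y z ^ n * z ^ 2) :=
  ⟨S, y, h.isScaledPolytrope hS hlam, rfl⟩

theorem IsSecondMoment.unique {n m₁ m₂ : ℝ} (h₁ : IsSecondMoment n m₁) (h₂ : IsSecondMoment n m₂) :
    m₁ = m₂ := by
  obtain ⟨S₁, Θ₁, p₁, rfl⟩ := h₁
  obtain ⟨S₂, Θ₂, p₂, rfl⟩ := h₂
  exact p₁.isLaneEmden.moment_unique p₂.isLaneEmden

/-! ### A contraction principle for bounded continuous functions on a set -/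

/-- Picard iteration from 0. The iterates converge geometrically and uniformly on s, which preserves
continuity and the bound R. The number d plays the role of the sup distance, so functions need no
control outside s. -/
theorem exists_fixedPoint_of_contracting {R κ : ℝ} (hR : 0 ≤ R) (hκ0 : 0 ≤ κ) (hκ : κ < 1)
    (s : Set ℝ) (Φ : (ℝ → ℝ) → ℝ → ℝ)
    (hmap : ∀ f, ContinuousOn f s → (∀ x ∈ s, |f x| ≤ R) →
      ContinuousOn (Φ f) s ∧ ∀ x ∈ s, |Φ f x| ≤ R)
    (hcontr : ∀ f g, ContinuousOn f s → (∀ x ∈ s, |f x| ≤ R) → ContinuousOn g s →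
      (∀ x ∈ s, |g x| ≤ R) → ∀ d, (∀ x ∈ s, |f x - g x| ≤ d) → ∀ x ∈ s, |Φ f x - Φ g x| ≤ κ * d) :
    ∃ f, ContinuousOn f s ∧ (∀ x ∈ s, |f x| ≤ R) ∧ ∀ x ∈ s, Φ f x = f x := by
  set u : ℕ → ℝ → ℝ := fun k => Φ^[k] (fun _ => 0) with hu
  have husucc : ∀ k, u (k + 1) = Φ (u k) := fun k => Function.iterate_succ_apply' Φ k _
  have hcl : ∀ k, ContinuousOn (u k) s ∧ ∀ x ∈ s, |u k x| ≤ R := by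
    intro k
    induction k with
    | zero => exact ⟨continuousOn_const, fun x _ => by simpa [hu] using hR⟩
    | succ k ih => rw [husucc]; exact hmap _ ih.1 ih.2
  have hstep : ∀ k, ∀ x ∈ s, |u k x - u (k + 1) x| ≤ R * κ ^ k := by
    intro k
    induction k with
    | zero => intro x hx; simpa [hu] using (hcl 1).2 x hx
    | succ k ih =>
      intro x hx
      have := hcontr _ _ (hcl k).1 (hcl k).2 (hcl (k + 1)).1 (hcl (k + 1)).2 _ ih x hx
      rw [← husucc, ← husucc] at this
      exact this.trans (by rw [pow_succ]; linarith)
  have hcau : ∀ x ∈ s, CauchySeq fun k => u k x := fun x hx =>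
    cauchySeq_of_le_geometric κ R hκ fun k => by simpa [Real.dist_eq] using hstep k x hx
  set f : ℝ → ℝ := fun x => limUnder atTop fun k => u k x with hf
  have hlim : ∀ x ∈ s, Tendsto (fun k => u k x) atTop (𝓝 (f x)) := fun x hx =>
    (hcau x hx).tendsto_limUnder
  have hrate : ∀ k, ∀ x ∈ s, |u k x - f x| ≤ R * κ ^ k / (1 - κ) := by
    intro k x hx
    have := dist_le_of_le_geometric_of_tendsto κ R hκ
      (fun k => by simpa [Real.dist_eq] using hstep k x hx) (hlim x hx) k
    simpa [Real.dist_eq] using this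
  have hrate0 : Tendsto (fun k => R * κ ^ k / (1 - κ)) atTop (𝓝 0) := by
    have := ((tendsto_pow_atTop_nhds_zero_of_lt_one hκ0 hκ).const_mul R).div_const (1 - κ)
    simpa using this
  have hunif : TendstoUniformlyOn u f atTop s := by
    rw [Metric.tendstoUniformlyOn_iff]
    intro ε hε
    filter_upwards [hrate0.eventually_lt_const hε] with k hk x hx
    rw [dist_comm, Real.dist_eq]
    exact (hrate k x hx).trans_lt hk
  have hfc : ContinuousOn f s :=
    hunif.continuousOn (Eventually.of_forall fun k => (hcl k).1).frequently
  have hfR : ∀ x ∈ s, |f x| ≤ R := fun x hx =>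
    le_of_tendsto (hlim x hx).abs (Eventually.of_forall fun k => (hcl k).2 x hx)
  refine ⟨f, hfc, hfR, fun x hx => ?_⟩
  have h1 : Tendsto (fun k => u (k + 1) x) atTop (𝓝 (f x)) :=
    (hlim x hx).comp (tendsto_add_atTop_nat 1)
  have h2 : Tendsto (fun k => u (k + 1) x) atTop (𝓝 (Φ f x)) := by
    rw [tendsto_iff_norm_sub_tendsto_zero]
    refine squeeze_zero (fun _ => norm_nonneg _) (fun k => ?_)
      (by simpa using hrate0.const_mul κ)
    rw [husucc]
    exact hcontr _ _ (hcl k).1 (hcl k).2 hfc hfR _ (hrate k) x hx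
  exact tendsto_nhds_unique h2 h1

/-! ### A calculus of integrals with known values -/

/-- `f` is integrable on `[a, b]` with integral `v`. -/
def HasInt (f : ℝ → ℝ) (a b v : ℝ) : Prop :=
  IntervalIntegrable f volume a b ∧ ∫ x in a..b, f x = v

namespace HasInt

variable {f g : ℝ → ℝ} {a b v w : ℝ}

theorem of_integrable (h : IntervalIntegrable f volume a b) : HasInt f a b (∫ x in a..b, f x) :=
  ⟨h, rfl⟩

theorem add (hf : HasInt f a b v) (hg : HasInt g a b w) :
    HasInt (fun x => f x + g x) a b (v + w) :=
  ⟨hf.1.add hg.1, by rw [intervalIntegral.integral_add hf.1 hg.1, hf.2, hg.2]⟩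

theorem sub (hf : HasInt f a b v) (hg : HasInt g a b w) :
    HasInt (fun x => f x - g x) a b (v - w) :=
  ⟨hf.1.sub hg.1, by rw [intervalIntegral.integral_sub hf.1 hg.1, hf.2, hg.2]⟩

theorem const_mul (c : ℝ) (hf : HasInt f a b v) : HasInt (fun x => c * f x) a b (c * v) :=
  ⟨hf.1.const_mul c, by rw [intervalIntegral.integral_const_mul, hf.2]⟩

theorem neg (hf : HasInt f a b v) : HasInt (fun x => -f x) a b (-v) :=
  ⟨hf.1.neg, by rw [intervalIntegral.integral_neg, hf.2]⟩

theorem congr_val (hf : HasInt f a b v) (h : v = w) : HasInt f a b w := h ▸ hf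

theorem congr (hf : HasInt f a b v) (hab : a ≤ b) (h : ∀ x ∈ Ioo a b, f x = g x) :
    HasInt g a b v := by
  have hae : ∀ᵐ x ∂volume.restrict (uIoc a b), f x = g x := by
    rw [uIoc_of_le hab, ← restrict_Ioo_eq_restrict_Ioc]
    exact (ae_restrict_iff' measurableSet_Ioo).2 (Eventually.of_forall h)
  exact ⟨hf.1.congr_ae hae, by
    rw [← hf.2]; exact (intervalIntegral.integral_congr_ae_restrict hae).symm⟩

theorem unique (hf : HasInt f a b v) (hg : HasInt f a b w) : v = w := hf.2.symm.trans hg.2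

theorem mono (hf : HasInt f a b v) (hg : HasInt g a b w) (hab : a ≤ b)
    (h : ∀ x ∈ Ioo a b, f x ≤ g x) : v ≤ w := by
  rw [← hf.2, ← hg.2]
  exact intervalIntegral.integral_mono_on_of_le_Ioo hab hf.1 hg.1 h

theorem abs_val_le (hf : HasInt f a b v) (hg : HasInt g a b w) (hab : a ≤ b)
    (h : ∀ x ∈ Ioo a b, |f x| ≤ g x) : |v| ≤ w :=
  abs_le.2 ⟨by
    have := hg.neg.mono hf hab fun x hx => (abs_le.1 (h x hx)).1
    exact this, hf.mono hg hab fun x hx => (abs_le.1 (h x hx)).2⟩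

theorem of_hasDerivAt {F : ℝ → ℝ} (hab : a ≤ b) (hF : ContinuousOn F (Icc a b))
    (hd : ∀ x ∈ Ioo a b, HasDerivAt F (f x) x) (hf : IntervalIntegrable f volume a b) :
    HasInt f a b (F b - F a) :=
  ⟨hf, intervalIntegral.integral_eq_sub_of_hasDerivAt_of_le hab hF hd hf⟩

/-- A nonnegative derivative of a continuous function is automatically integrable, so no prior bound
on f is required. -/
theorem of_hasDerivAt_nonneg {F : ℝ → ℝ} (hab : a ≤ b) (hF : ContinuousOn F (Icc a b))
    (hd : ∀ x ∈ Ioo a b, HasDerivAt F (f x) x) (hf : ∀ x ∈ Ioo a b, 0 ≤ f x) :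
    HasInt f a b (F b - F a) := by
  refine of_hasDerivAt hab hF hd ?_
  refine intervalIntegral.intervalIntegrable_deriv_of_nonneg (g := F) ?_ ?_ ?_
  · rwa [uIcc_of_le hab]
  · rwa [min_eq_left hab, max_eq_right hab]
  · rwa [min_eq_left hab, max_eq_right hab]

theorem reflect (hf : HasInt f 0 1 v) : HasInt (fun x => f (1 - x)) 0 1 v := by
  refine ⟨?_, ?_⟩
  · have := hf.1.comp_sub_left 1
    simpa using this.symm
  · rw [intervalIntegral.integral_comp_sub_left (fun x => f x) 1]
    simpa using hf.2

end HasInt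

theorem intervalIntegrable_of_abs_le {f g : ℝ → ℝ} {a b : ℝ} (hab : a ≤ b)
    (hf : ContinuousOn f (Ioo a b)) (hg : IntervalIntegrable g volume a b)
    (h : ∀ x ∈ Ioo a b, |f x| ≤ g x) : IntervalIntegrable f volume a b := by
  rw [intervalIntegrable_iff_integrableOn_Ioo_of_le hab] at hg ⊢
  refine Integrable.mono' hg (hf.aestronglyMeasurable measurableSet_Ioo) ?_
  exact (ae_restrict_iff' measurableSet_Ioo).2 (Eventually.of_forall h)

/-- Termwise integration of a series of nonnegative functions. The condition V ≠ 0 is what yields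
integrability of the sum. -/
theorem HasInt.hasSum {f : ℕ → ℝ → ℝ} {F : ℝ → ℝ} {v : ℕ → ℝ} {V a b : ℝ} (hab : a ≤ b)
    (hf : ∀ k, HasInt (f k) a b (v k)) (hpos : ∀ k, ∀ x ∈ Ioo a b, 0 ≤ f k x)
    (hV : HasSum v V) (hV0 : V ≠ 0) (hF : ∀ x ∈ Ioo a b, HasSum (fun k => f k x) (F x)) :
    HasInt F a b V := by
  have hI : ∀ k, IntegrableOn (f k) (Ioo a b) := fun k =>
    (intervalIntegrable_iff_integrableOn_Ioo_of_le hab).1 (hf k).1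
  have hv : ∀ k, ∫ x in Ioo a b, f k x = v k := fun k => by
    rw [← integral_Ioc_eq_integral_Ioo, ← intervalIntegral.integral_of_le hab, (hf k).2]
  have hn : ∀ k, ∫ x in Ioo a b, ‖f k x‖ = v k := fun k => by
    rw [← hv k]
    exact setIntegral_congr_fun measurableSet_Ioo fun x hx => by
      simp [abs_of_nonneg (hpos k x hx)]
  have hs : Summable fun k => ∫ x in Ioo a b, ‖f k x‖ := by
    simp only [hn]; exact hV.summable
  have h1 := MeasureTheory.hasSum_integral_of_summable_integral_norm hI hs
  have hcongr : ∫ x in Ioo a b, ∑' k, f k x = ∫ x in Ioo a b, F x :=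
    setIntegral_congr_fun measurableSet_Ioo fun x hx => (hF x hx).tsum_eq
  simp only [hv] at h1
  rw [hcongr] at h1
  have hval := h1.unique hV
  refine ⟨?_, ?_⟩
  · rw [intervalIntegrable_iff_integrableOn_Ioo_of_le hab]
    -- The integral of a non-integrable function is 0 by convention, while here it equals V ≠ 0.
    by_contra hne
    exact hV0 (hval ▸ integral_undef hne)
  · rw [intervalIntegral.integral_of_le hab, integral_Ioc_eq_integral_Ioo]
    exact hval

theorem HasSum.congr_of_eq {f g : ℕ → ℝ} {a b : ℝ} (h : HasSum f a) (hfg : ∀ k, g k = f k)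
    (hab : b = a) : HasSum g b := by
  rw [hab, show g = f from funext hfg]; exact h

/-! ### Integrals of monomials times powers of log s and log (1 - s) -/

/-- With k = i + 1 and r = s^(1/k), s logᵏ s = kᵏ (r log r)ᵏ, and r log r is continuous. At s = 0
both sides are 0. -/
theorem continuousOn_mul_log_pow (i : ℕ) :
    ContinuousOn (fun s : ℝ => s * log s ^ (i + 1)) (Ici 0) := by
  have hc : Continuous fun s : ℝ =>
      ((i + 1 : ℕ) : ℝ) ^ (i + 1) * (s ^ (1 / ((i + 1 : ℕ) : ℝ)) * log (s ^ (1 / ((i + 1 : ℕ) : ℝ)))) ^ (i + 1) := by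
    have h1 : Continuous fun s : ℝ => s ^ (1 / ((i + 1 : ℕ) : ℝ)) :=
      Real.continuous_rpow_const (by positivity)
    exact continuous_const.mul ((Real.continuous_mul_log.comp h1).pow _)
  refine hc.continuousOn.congr fun s hs => ?_
  rcases (mem_Ici.1 hs).eq_or_lt with h0 | h0
  · rw [← h0]
    have : (0 : ℝ) ^ (1 / ((i + 1 : ℕ) : ℝ)) = 0 := zero_rpow (by positivity)
    simp only [this]; simp
  · have hi : ((i + 1 : ℕ) : ℝ) ≠ 0 := by positivity
    have h2 : (s ^ (1 / ((i + 1 : ℕ) : ℝ))) ^ (i + 1) = s := by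
      rw [← rpow_natCast, ← rpow_mul h0.le, one_div, inv_mul_cancel₀ hi, rpow_one]
    beta_reduce
    rw [log_rpow h0, mul_pow, h2]
    have h3 : (1 / ((i + 1 : ℕ) : ℝ) * log s) ^ (i + 1) * ((i + 1 : ℕ) : ℝ) ^ (i + 1)
        = log s ^ (i + 1) := by
      rw [← mul_pow]; congr 1; field_simp
    calc s * log s ^ (i + 1) = s * ((1 / ((i + 1 : ℕ) : ℝ) * log s) ^ (i + 1) * ((i + 1 : ℕ) : ℝ) ^ (i + 1)) := by rw [h3]
      _ = _ := by ring

theorem continuousOn_mul_log_pow_one_sub (i : ℕ) :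
    ContinuousOn (fun s : ℝ => (1 - s) * log (1 - s) ^ (i + 1)) (Iic 1) :=
  (continuousOn_mul_log_pow i).comp (f := fun s : ℝ => 1 - s) (by fun_prop) fun s hs => by
    simpa using hs

/-- At s = 1 the first-order zero of log s beats the logarithmic pole of log (1 - s): log s is (1 -
s) times a continuous function, and (1 - s) log (1 - s) is continuous. At s = 1 itself log 0 = 0. -/
theorem continuousOn_log_mul_log_one_sub (i : ℕ) :
    ContinuousOn (fun s : ℝ => log s ^ (i + 1) * log (1 - s)) (Ioc 0 1) := by
  have h1 : ContinuousOn (dslope log 1) (Ioi 0) := by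
    intro s hs
    refine (ContinuousAt.continuousWithinAt ?_)
    rcases eq_or_ne s 1 with rfl | h
    · exact continuousAt_dslope_same.2 (Real.differentiableAt_log one_ne_zero)
    · exact (continuousAt_dslope_of_ne h).2 (Real.continuousAt_log (ne_of_gt hs))
  have h2 : ∀ s, log s = -((1 - s) * dslope log 1 s) := fun s => by
    have := sub_smul_dslope log 1 s
    rw [log_one, sub_zero, smul_eq_mul] at this
    rw [← this]; ring
  have h3 : ContinuousOn (fun s : ℝ => -(log s ^ i * dslope log 1 s * ((1 - s) * log (1 - s) ^ (0 + 1))))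
      (Ioc 0 1) := by
    refine (((continuousOn_log.mono fun s hs => hs.1.ne').pow i).mul
      (h1.mono fun s hs => hs.1)).mul ((continuousOn_mul_log_pow_one_sub 0).mono fun s hs => hs.2) |>.neg
  refine h3.congr fun s hs => ?_
  beta_reduce
  rw [pow_succ]
  nth_rewrite 2 [h2 s]
  ring

theorem continuousOn_mul_log_pow_mul_log_one_sub (i : ℕ) :
    ContinuousOn (fun s : ℝ => s * log s ^ (i + 1) * log (1 - s)) (Icc 0 1) := by
  have h1 : ContinuousOn (fun s : ℝ => s * (log s ^ (i + 1) * log (1 - s))) (Ioc 0 1) :=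
    continuousOn_id.mul (continuousOn_log_mul_log_one_sub i)
  have h2 : ContinuousOn (fun s : ℝ => s * log s ^ (i + 1) * log (1 - s)) (Ico 0 1) :=
    ((continuousOn_mul_log_pow i).mono fun s hs => hs.1).mul
      (ContinuousOn.log (by fun_prop) fun s hs => (sub_pos.2 hs.2).ne')
  intro s hs
  rcases hs.1.eq_or_lt with h0 | h0
  · refine (h2 s ⟨hs.1, by rw [← h0]; exact one_pos⟩).mono_of_mem_nhdsWithin ?_
    rw [← h0]
    exact mem_nhdsWithin.2 ⟨Iio 1, isOpen_Iio, by simp, fun x hx => ⟨hx.2.1, hx.1⟩⟩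
  · have := (h1 s ⟨h0, hs.2⟩).mono_of_mem_nhdsWithin
      (show Ioc 0 1 ∈ 𝓝[Icc 0 1] s from mem_nhdsWithin.2 ⟨Ioi 0, isOpen_Ioi, h0, fun x hx => ⟨hx.1, hx.2.2⟩⟩)
    simpa only [mul_assoc] using this

theorem hasDerivAt_log_pow (i : ℕ) {s : ℝ} (hs : 0 < s) :
    HasDerivAt (fun s => log s ^ (i + 1)) ((i + 1) * log s ^ i / s) s := by
  have := (Real.hasDerivAt_log hs.ne').pow (i + 1)
  refine this.congr_deriv ?_
  rw [Nat.add_sub_cancel, div_eq_mul_inv]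
  push_cast
  rfl

theorem hasDerivAt_log_one_sub {s : ℝ} (hs : s < 1) :
    HasDerivAt (fun s => log (1 - s)) (-(1 / (1 - s))) s := by
  have := ((hasDerivAt_id s).const_sub 1).log (sub_pos.2 hs).ne'
  exact this.congr_deriv (by simp [neg_div])

namespace HasInt

theorem pow_zero_one (k : ℕ) : HasInt (fun s : ℝ => s ^ k) 0 1 (1 / (k + 1)) :=
  ⟨(continuous_pow k).intervalIntegrable _ _, by simp [integral_pow]⟩

theorem log_pow_integrable (i : ℕ) : IntervalIntegrable (fun s : ℝ => log s ^ i) volume 0 1 := by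
  -- The exponent t is chosen so that |log s| ≤ t⁻¹ s^(-t) costs at most s^(-1/2) after the i-th
  -- power.
  have ht : (0 : ℝ) < 1 / (2 * (i + 1)) := by positivity
  refine intervalIntegrable_of_abs_le (g := fun s => (2 * (i + 1 : ℝ)) ^ i * s ^ (-(1 / 2) : ℝ))
    zero_le_one ?_ ((intervalIntegrable_rpow' (by norm_num)).const_mul _) ?_
  · exact (continuousOn_log.mono fun s hs => hs.1.ne').pow i
  · intro s hs
    have h1 := (Real.abs_log_mul_self_rpow_lt s _ hs.1 hs.2.le ht).le
    rw [one_div_one_div, abs_mul, abs_of_pos (rpow_pos_of_pos hs.1 _)] at h1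
    have h2 := pow_le_pow_left₀ (by have := rpow_pos_of_pos hs.1 (1 / (2 * (i + 1 : ℝ))); positivity) h1 i
    rw [mul_pow, ← rpow_natCast (s ^ _), ← rpow_mul hs.1.le] at h2
    have h3 : s ^ ((1 : ℝ) / 2) ≤ s ^ (1 / (2 * (i + 1 : ℝ)) * i) := by
      refine rpow_le_rpow_of_exponent_ge hs.1 hs.2.le ?_
      rw [one_div_mul_eq_div, div_le_div_iff₀ (by positivity) (by norm_num)]
      linarith
    have h4 : |log s| ^ i * s ^ ((1 : ℝ) / 2) ≤ (2 * (i + 1 : ℝ)) ^ i :=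
      (mul_le_mul_of_nonneg_left h3 (by positivity)).trans h2
    rw [abs_pow, rpow_neg hs.1.le, ← div_eq_mul_inv, le_div_iff₀ (rpow_pos_of_pos hs.1 _)]
    exact h4

theorem pow_mul_log_pow_integrable (k i : ℕ) :
    IntervalIntegrable (fun s : ℝ => s ^ k * log s ^ i) volume 0 1 :=
  (log_pow_integrable i).continuousOn_mul (continuous_pow k).continuousOn

theorem continuousOn_pow_mul_log_pow (k i : ℕ) :
    ContinuousOn (fun s : ℝ => s ^ (k + 1) * log s ^ i) (Ici 0) := by
  cases i with
  | zero => simpa using (continuous_pow (k + 1)).continuousOn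
  | succ i =>
    refine ((continuous_pow k).continuousOn.mul (continuousOn_mul_log_pow i)).congr fun s _ => ?_
    simp only [Pi.mul_apply]; ring

/-- Integration by parts with s^(k+1) log^(i+1) s, which vanishes at both endpoints. -/
theorem pow_mul_log_pow_succ {k i : ℕ} {v : ℝ}
    (h : HasInt (fun s : ℝ => s ^ k * log s ^ i) 0 1 v) :
    HasInt (fun s : ℝ => s ^ k * log s ^ (i + 1)) 0 1 (-((i + 1) / (k + 1) * v)) := by
  have hd : ∀ s ∈ Ioo (0 : ℝ) 1, HasDerivAt (fun s => s ^ (k + 1) * log s ^ (i + 1))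
      ((k + 1) * (s ^ k * log s ^ (i + 1)) + (i + 1) * (s ^ k * log s ^ i)) s := by
    intro s hs
    have h1 := (hasDerivAt_pow (k + 1) s).mul (hasDerivAt_log_pow i hs.1)
    refine h1.congr_deriv ?_
    have := hs.1.ne'
    rw [Nat.add_sub_cancel, pow_succ s k]
    push_cast
    field_simp
  have h1 := of_hasDerivAt zero_le_one ((continuousOn_pow_mul_log_pow k (i + 1)).mono fun s hs => hs.1)
    hd (((pow_mul_log_pow_integrable k (i + 1)).const_mul _).add (h.1.const_mul _))
  have h2 := (h1.sub (h.const_mul (i + 1))).const_mul (1 / (k + 1))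
  have hk : (k + 1 : ℝ) ≠ 0 := by positivity
  refine (h2.congr_val ?_).congr zero_le_one fun s _ => ?_
  · simp
    field_simp
  · field_simp
    ring

theorem pow_mul_log (k : ℕ) : HasInt (fun s : ℝ => s ^ k * log s) 0 1 (-(1 / (k + 1) ^ 2)) := by
  have h := pow_mul_log_pow_succ (i := 0) (by simpa using pow_zero_one k)
  simp only [zero_add, pow_one] at h
  exact h.congr_val (by have hk : (k + 1 : ℝ) ≠ 0 := by positivity
                        field_simp; simp)

theorem pow_mul_log_sq (k : ℕ) : HasInt (fun s : ℝ => s ^ k * log s ^ 2) 0 1 (2 / (k + 1) ^ 3) :=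
  (pow_mul_log_pow_succ (i := 1) (by simpa using pow_mul_log k)).congr_val (by
    have hk : (k + 1 : ℝ) ≠ 0 := by positivity
    field_simp; norm_num)

theorem pow_mul_log_cube (k : ℕ) : HasInt (fun s : ℝ => s ^ k * log s ^ 3) 0 1 (-(6 / (k + 1) ^ 4)) :=
  (pow_mul_log_pow_succ (i := 2) (pow_mul_log_sq k)).congr_val (by
    have hk : (k + 1 : ℝ) ≠ 0 := by positivity
    field_simp; norm_num)

theorem hasSum_pow_one_sub {s : ℝ} (hs : s ∈ Ioo (0 : ℝ) 1) :
    HasSum (fun k : ℕ => s ^ k) (1 / (1 - s)) := by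
  simpa using hasSum_geometric_of_lt_one hs.1.le hs.2

/-- Expanding 1/(1 - s) in a geometric series reduces the integral to -∑ 1/(k+1)² = -ζ(2). -/
theorem log_div_one_sub : HasInt (fun s : ℝ => log s / (1 - s)) 0 1 (-(π ^ 2 / 6)) := by
  have h0 : HasSum (fun k : ℕ => (1 : ℝ) / ((k : ℝ) + 1) ^ 2) (π ^ 2 / 6) := by
    have := (hasSum_nat_add_iff' 1).2 hasSum_zeta_two
    simpa using this
  have := HasInt.hasSum zero_le_one (fun k => (pow_mul_log k).neg) (F := fun s => -(log s / (1 - s)))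
    (V := π ^ 2 / 6) (fun k s hs => ?_) (by simpa using h0) (by positivity) (fun s hs => ?_)
  · simpa using this.neg
  · exact neg_nonneg.2 (mul_nonpos_of_nonneg_of_nonpos (pow_nonneg hs.1.le k)
      (Real.log_nonpos hs.1.le hs.2.le))
  · have := ((hasSum_pow_one_sub hs).mul_right (log s)).neg
    exact this.congr_of_eq (fun k => by ring) (by ring)

end HasInt

/-- `ζ(3)`. -/
noncomputable def zetaThree : ℝ := (riemannZeta 3).re

theorem hasSum_zetaThree : HasSum (fun k : ℕ => (1 : ℝ) / ((k : ℝ) + 1) ^ 3) zetaThree := by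
  have h1 : HasSum (fun n : ℕ => (1 : ℝ) / (n : ℝ) ^ 3) zetaThree := by
    have hs : Summable (fun n : ℕ => (1 : ℝ) / (n : ℝ) ^ 3) :=
      Real.summable_one_div_nat_pow.2 (by norm_num)
    have h2 := zeta_nat_eq_tsum_of_gt_one (k := 3) (by norm_num)
    have h3 : (∑' n : ℕ, 1 / (n : ℂ) ^ 3) = ((∑' n : ℕ, (1 : ℝ) / (n : ℝ) ^ 3 : ℝ) : ℂ) := by
      push_cast; rfl
    have h4 : zetaThree = ∑' n : ℕ, (1 : ℝ) / (n : ℝ) ^ 3 := by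
      rw [zetaThree, show (3 : ℂ) = ((3 : ℕ) : ℂ) by norm_num, h2, h3, Complex.ofReal_re]
    rw [h4]; exact hs.hasSum
  simpa using (hasSum_nat_add_iff' 1).2 h1

theorem zetaThree_pos : 0 < zetaThree := by
  have h := hasSum_zetaThree
  rw [← h.tsum_eq]
  exact h.summable.tsum_pos (fun k => by positivity) 0 (by norm_num)

namespace HasInt

/-- The same geometric expansion, with ∫ sᵏ log² s = 2/(k+1)³; this is the source of every ζ(3)
below. -/
theorem log_sq_div_one_sub : HasInt (fun s : ℝ => log s ^ 2 / (1 - s)) 0 1 (2 * zetaThree) := by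
  refine HasInt.hasSum zero_le_one pow_mul_log_sq (fun k s hs => ?_)
    (by simpa [div_eq_mul_inv] using hasSum_zetaThree.mul_left 2)
    (by have := zetaThree_pos; positivity) (fun s hs => ?_)
  · exact mul_nonneg (pow_nonneg hs.1.le k) (sq_nonneg _)
  · exact ((hasSum_pow_one_sub hs).mul_right (log s ^ 2)).congr_of_eq (fun k => rfl) (by ring)

theorem log_one_sub : HasInt (fun s : ℝ => log (1 - s)) 0 1 (-1) :=
  ((pow_mul_log 0).congr (g := fun s => log s) zero_le_one fun s _ => by simp).reflect.congr_val
    (by norm_num)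

theorem continuousOn_pow_mul_one_sub_mul_logs (k i : ℕ) :
    ContinuousOn (fun s : ℝ => s ^ (k + 1) * (1 - s) * (log s ^ i * log (1 - s))) (Icc 0 1) := by
  refine (((continuousOn_pow_mul_log_pow k i).mono fun s hs => hs.1).mul
    ((continuousOn_mul_log_pow_one_sub 0).mono fun s hs => hs.2)).congr fun s _ => ?_
  simp only [Pi.mul_apply]; ring

/-- The factor 1 - s cancels the pole produced by differentiating log (1 - s). The derivative
therefore contains only moments of orders k and k + 1, which makes it a recursion in k. -/
theorem hasDerivAt_pow_mul_one_sub_mul_logs (k i : ℕ) {s : ℝ} (hs : s ∈ Ioo (0 : ℝ) 1) :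
    HasDerivAt (fun s : ℝ => s ^ (k + 1) * (1 - s) * (log s ^ (i + 1) * log (1 - s)))
      ((k + 1) * (s ^ k * (log s ^ (i + 1) * log (1 - s)))
        - (k + 2) * (s ^ (k + 1) * (log s ^ (i + 1) * log (1 - s)))
        + (i + 1) * (s ^ k * (log s ^ i * log (1 - s)) - s ^ (k + 1) * (log s ^ i * log (1 - s)))
        - s ^ (k + 1) * log s ^ (i + 1)) s := by
  have h1 := ((hasDerivAt_pow (k + 1) s).mul ((hasDerivAt_id s).const_sub 1)).mul
    ((hasDerivAt_log_pow i hs.1).mul (hasDerivAt_log_one_sub hs.2))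
  refine h1.congr_deriv ?_
  have := hs.1.ne'
  have := (sub_pos.2 hs.2).ne'
  rw [Nat.add_sub_cancel, pow_succ s k]
  simp only [id, Pi.mul_apply]
  push_cast
  field_simp
  ring

theorem hasDerivAt_pow_mul_one_sub_mul_log (k : ℕ) {s : ℝ} (hs : s ∈ Ioo (0 : ℝ) 1) :
    HasDerivAt (fun s : ℝ => s ^ (k + 1) * (1 - s) * (log s ^ 0 * log (1 - s)))
      ((k + 1) * (s ^ k * log (1 - s)) - (k + 2) * (s ^ (k + 1) * log (1 - s)) - s ^ (k + 1)) s := by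
  have h1 := ((hasDerivAt_pow (k + 1) s).mul ((hasDerivAt_id s).const_sub 1)).mul
    (hasDerivAt_log_one_sub hs.2)
  simp only [pow_zero, one_mul]
  refine h1.congr_deriv ?_
  have := hs.1.ne'
  have := (sub_pos.2 hs.2).ne'
  rw [Nat.add_sub_cancel, pow_succ s k]
  simp only [id, Pi.mul_apply]
  push_cast
  field_simp
  ring

theorem pow_succ_integrable {f : ℝ → ℝ} {k : ℕ} (h : IntervalIntegrable (fun s => s ^ k * f s) volume 0 1) :
    IntervalIntegrable (fun s => s ^ (k + 1) * f s) volume 0 1 := by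
  refine (h.continuousOn_mul continuous_id.continuousOn).congr_ae (Eventually.of_forall fun s => ?_)
  simp only [id]; ring

/-- The integrals of `s ^ k * log (1 - s)`. -/
theorem pow_succ_mul_log_one_sub {k : ℕ} {v : ℝ}
    (h : HasInt (fun s : ℝ => s ^ k * log (1 - s)) 0 1 v) :
    HasInt (fun s : ℝ => s ^ (k + 1) * log (1 - s)) 0 1
      (((k + 1) * v - 1 / (k + 2)) / (k + 2)) := by
  have h1 := of_hasDerivAt zero_le_one (continuousOn_pow_mul_one_sub_mul_logs k 0)
    (fun s hs => hasDerivAt_pow_mul_one_sub_mul_log k hs)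
    (((h.1.const_mul _).sub ((pow_succ_integrable h.1).const_mul _)).sub (pow_zero_one (k + 1)).1)
  have h2 := (((h.const_mul (k + 1)).sub (pow_zero_one (k + 1))).sub h1).const_mul (1 / (k + 2))
  have hk : (k + 2 : ℝ) ≠ 0 := by positivity
  refine (h2.congr_val ?_).congr zero_le_one fun s _ => ?_
  · have hk' : (k + 1 + 1 : ℝ) ≠ 0 := by positivity
    push_cast
    simp
    rw [add_assoc, one_add_one_eq_two]
    field_simp
  · field_simp
    ring

theorem pow_succ_mul_logs {k i : ℕ} {v w : ℝ}
    (h : HasInt (fun s : ℝ => s ^ k * (log s ^ (i + 1) * log (1 - s))) 0 1 v)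
    (h' : HasInt (fun s : ℝ => s ^ k * (log s ^ i * log (1 - s))) 0 1 w)
    {w' u : ℝ} (h'' : HasInt (fun s : ℝ => s ^ (k + 1) * (log s ^ i * log (1 - s))) 0 1 w')
    (hu : HasInt (fun s : ℝ => s ^ (k + 1) * log s ^ (i + 1)) 0 1 u) :
    HasInt (fun s : ℝ => s ^ (k + 1) * (log s ^ (i + 1) * log (1 - s))) 0 1
      (((k + 1) * v + (i + 1) * (w - w') - u) / (k + 2)) := by
  have h1 := of_hasDerivAt zero_le_one (continuousOn_pow_mul_one_sub_mul_logs k (i + 1))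
    (fun s hs => hasDerivAt_pow_mul_one_sub_mul_logs k i hs)
    ((((h.1.const_mul _).sub ((pow_succ_integrable h.1).const_mul _)).add
      ((h'.1.sub h''.1).const_mul _)).sub hu.1)
  have h2 := ((((h.const_mul (k + 1)).add ((h'.sub h'').const_mul (i + 1))).sub hu).sub h1).const_mul
    (1 / (k + 2))
  have hk : (k + 2 : ℝ) ≠ 0 := by positivity
  refine (h2.congr_val ?_).congr zero_le_one fun s _ => ?_
  · simp
    field_simp
  · field_simp
    ring

theorem logs_integrable (i : ℕ) :
    IntervalIntegrable (fun s : ℝ => log s ^ i * log (1 - s)) volume 0 1 := by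
  have h1 : IntervalIntegrable (fun s : ℝ => log (1 - s) ^ 2) volume 0 1 :=
    (of_integrable (log_pow_integrable 2)).reflect.1
  refine intervalIntegrable_of_abs_le zero_le_one ?_ ((log_pow_integrable (i * 2)).add h1) ?_
  · exact ((continuousOn_log.mono fun s hs => hs.1.ne').pow i).mul
      (ContinuousOn.log (by fun_prop) fun s hs => (sub_pos.2 hs.2).ne')
  · intro s hs
    rw [abs_le, pow_mul]
    constructor <;> nlinarith [sq_nonneg (log s ^ i + log (1 - s)),
      sq_nonneg (log s ^ i - log (1 - s)), sq_nonneg (log s ^ i), sq_nonneg (log (1 - s))]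

/-- Start of the recursion in k. Differentiating s log s log (1 - s) leaves s log s / (1 - s) = log
s / (1 - s) - log s, whose integral is already known. -/
theorem log_mul_log_one_sub : HasInt (fun s : ℝ => log s * log (1 - s)) 0 1 (2 - π ^ 2 / 6) := by
  have hI : IntervalIntegrable (fun s : ℝ => log s * log (1 - s)) volume 0 1 := by
    simpa using logs_integrable 1
  have hA : HasInt (fun s : ℝ => log s) 0 1 (-1) := by simpa using pow_mul_log 0
  have hd : ∀ s ∈ Ioo (0 : ℝ) 1, HasDerivAt (fun s => s * log s ^ (0 + 1) * log (1 - s))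
      (log s * log (1 - s) + log (1 - s) + log s - log s / (1 - s)) s := by
    intro s hs
    have h1 := ((hasDerivAt_id s).mul (hasDerivAt_log_pow 0 hs.1)).mul (hasDerivAt_log_one_sub hs.2)
    refine h1.congr_deriv ?_
    have := hs.1.ne'
    have := (sub_pos.2 hs.2).ne'
    simp only [id, Pi.mul_apply, zero_add, pow_one, pow_zero, Nat.cast_zero]
    field_simp
    ring
  have h1 := of_hasDerivAt zero_le_one (continuousOn_mul_log_pow_mul_log_one_sub 0) hd
    (((hI.add log_one_sub.1).add hA.1).sub log_div_one_sub.1)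
  refine ((((h1.add log_div_one_sub).sub hA).sub log_one_sub).congr_val ?_).congr zero_le_one
    fun s _ => ?_
  · simp; ring
  · ring

theorem log_sq_mul_log_one_sub :
    HasInt (fun s : ℝ => log s ^ 2 * log (1 - s)) 0 1 (-6 + π ^ 2 / 3 + 2 * zetaThree) := by
  have hI := logs_integrable 2
  have hA : HasInt (fun s : ℝ => log s ^ 2) 0 1 2 := by simpa using pow_mul_log_sq 0
  have hd : ∀ s ∈ Ioo (0 : ℝ) 1, HasDerivAt (fun s => s * log s ^ (1 + 1) * log (1 - s))
      (log s ^ 2 * log (1 - s) + 2 * (log s * log (1 - s)) + log s ^ 2 - log s ^ 2 / (1 - s)) s := by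
    intro s hs
    have h1 := ((hasDerivAt_id s).mul (hasDerivAt_log_pow 1 hs.1)).mul (hasDerivAt_log_one_sub hs.2)
    refine h1.congr_deriv ?_
    have := hs.1.ne'
    have := (sub_pos.2 hs.2).ne'
    simp only [id, Pi.mul_apply, Nat.cast_one]
    field_simp
    ring
  have h1 := of_hasDerivAt zero_le_one (continuousOn_mul_log_pow_mul_log_one_sub 1) hd
    (((hI.add (log_mul_log_one_sub.1.const_mul 2)).add hA.1).sub log_sq_div_one_sub.1)
  refine ((((h1.add log_sq_div_one_sub).sub hA).sub (log_mul_log_one_sub.const_mul 2)).congr_val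
    ?_).congr zero_le_one fun s _ => ?_
  · simp; ring
  · ring

end HasInt

/-! ### Quartic polynomials times logarithms, and reflection about 1/2 -/

namespace HasInt

/-- In the variable s = (1 + x)/2 the polynomial factors that occur in the profile integrals have
degree at most four, so five moments of each logarithmic factor suffice. -/
theorem quartic_mul {f : ℝ → ℝ} {v₀ v₁ v₂ v₃ v₄ : ℝ} (h₀ : HasInt f 0 1 v₀)
    (h₁ : HasInt (fun s => s ^ 1 * f s) 0 1 v₁) (h₂ : HasInt (fun s => s ^ 2 * f s) 0 1 v₂)
    (h₃ : HasInt (fun s => s ^ 3 * f s) 0 1 v₃) (h₄ : HasInt (fun s => s ^ 4 * f s) 0 1 v₄)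
    (c₀ c₁ c₂ c₃ c₄ : ℝ) :
    HasInt (fun s => (c₀ + c₁ * s + c₂ * s ^ 2 + c₃ * s ^ 3 + c₄ * s ^ 4) * f s) 0 1
      (c₀ * v₀ + c₁ * v₁ + c₂ * v₂ + c₃ * v₃ + c₄ * v₄) :=
  (((((h₀.const_mul c₀).add (h₁.const_mul c₁)).add (h₂.const_mul c₂)).add (h₃.const_mul c₃)).add
    (h₄.const_mul c₄)).congr zero_le_one fun s _ => by ring

theorem quartic (c₀ c₁ c₂ c₃ c₄ : ℝ) :
    HasInt (fun s => c₀ + c₁ * s + c₂ * s ^ 2 + c₃ * s ^ 3 + c₄ * s ^ 4) 0 1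
      (c₀ + c₁ / 2 + c₂ / 3 + c₃ / 4 + c₄ / 5) :=
  (((((pow_zero_one 0).const_mul c₀).add ((pow_zero_one 1).const_mul c₁)).add
    ((pow_zero_one 2).const_mul c₂)).add ((pow_zero_one 3).const_mul c₃)).add
    ((pow_zero_one 4).const_mul c₄) |>.congr_val (by push_cast; ring)
    |>.congr zero_le_one fun s _ => by ring

theorem quartic_mul_log (c₀ c₁ c₂ c₃ c₄ : ℝ) :
    HasInt (fun s => (c₀ + c₁ * s + c₂ * s ^ 2 + c₃ * s ^ 3 + c₄ * s ^ 4) * log s) 0 1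
      (-(c₀ + c₁ / 4 + c₂ / 9 + c₃ / 16 + c₄ / 25)) :=
  (quartic_mul (by simpa using pow_mul_log 0) (pow_mul_log 1) (pow_mul_log 2) (pow_mul_log 3)
    (pow_mul_log 4) c₀ c₁ c₂ c₃ c₄).congr_val (by push_cast; ring)

theorem quartic_mul_log_sq (c₀ c₁ c₂ c₃ c₄ : ℝ) :
    HasInt (fun s => (c₀ + c₁ * s + c₂ * s ^ 2 + c₃ * s ^ 3 + c₄ * s ^ 4) * log s ^ 2) 0 1
      (2 * (c₀ + c₁ / 8 + c₂ / 27 + c₃ / 64 + c₄ / 125)) :=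
  (quartic_mul (by simpa using pow_mul_log_sq 0) (pow_mul_log_sq 1) (pow_mul_log_sq 2)
    (pow_mul_log_sq 3) (pow_mul_log_sq 4) c₀ c₁ c₂ c₃ c₄).congr_val (by push_cast; ring)

theorem quartic_mul_log_cube (c₀ c₁ c₂ c₃ c₄ : ℝ) :
    HasInt (fun s => (c₀ + c₁ * s + c₂ * s ^ 2 + c₃ * s ^ 3 + c₄ * s ^ 4) * log s ^ 3) 0 1
      (-(6 * (c₀ + c₁ / 16 + c₂ / 81 + c₃ / 256 + c₄ / 625))) :=
  (quartic_mul (by simpa using pow_mul_log_cube 0) (pow_mul_log_cube 1) (pow_mul_log_cube 2)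
    (pow_mul_log_cube 3) (pow_mul_log_cube 4) c₀ c₁ c₂ c₃ c₄).congr_val (by push_cast; ring)

theorem one_mul_log_one_sub : HasInt (fun s : ℝ => s ^ 1 * log (1 - s)) 0 1 (-(3 / 4)) :=
  (pow_succ_mul_log_one_sub (k := 0) (by simpa using log_one_sub)).congr_val (by norm_num)

theorem sq_mul_log_one_sub : HasInt (fun s : ℝ => s ^ 2 * log (1 - s)) 0 1 (-(11 / 18)) :=
  (pow_succ_mul_log_one_sub (k := 1) one_mul_log_one_sub).congr_val (by norm_num)

theorem cube_mul_log_one_sub : HasInt (fun s : ℝ => s ^ 3 * log (1 - s)) 0 1 (-(25 / 48)) :=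
  (pow_succ_mul_log_one_sub (k := 2) sq_mul_log_one_sub).congr_val (by norm_num)

theorem pow_four_mul_log_one_sub : HasInt (fun s : ℝ => s ^ 4 * log (1 - s)) 0 1 (-(137 / 300)) :=
  (pow_succ_mul_log_one_sub (k := 3) cube_mul_log_one_sub).congr_val (by norm_num)

theorem pow_succ_mul_log_mul_log {k : ℕ} {v w w' : ℝ}
    (h : HasInt (fun s : ℝ => s ^ k * (log s * log (1 - s))) 0 1 v)
    (h' : HasInt (fun s : ℝ => s ^ k * log (1 - s)) 0 1 w)
    (h'' : HasInt (fun s : ℝ => s ^ (k + 1) * log (1 - s)) 0 1 w') :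
    HasInt (fun s : ℝ => s ^ (k + 1) * (log s * log (1 - s))) 0 1
      (((k + 1) * v + (w - w') + 1 / (k + 2) ^ 2) / (k + 2)) := by
  have := pow_succ_mul_logs (i := 0) (by simpa using h) (by simpa using h') (by simpa using h'')
    (by simpa using pow_mul_log (k + 1))
  simp only [zero_add, pow_one] at this
  refine this.congr_val ?_
  push_cast
  rw [add_assoc (k : ℝ) 1 1, one_add_one_eq_two]
  ring

theorem one_mul_log_mul_log :
    HasInt (fun s : ℝ => s ^ 1 * (log s * log (1 - s))) 0 1 (1 - π ^ 2 / 12) :=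
  (pow_succ_mul_log_mul_log (k := 0) (by simpa using log_mul_log_one_sub)
    (by simpa using log_one_sub) one_mul_log_one_sub).congr_val (by push_cast; ring)

theorem sq_mul_log_mul_log :
    HasInt (fun s : ℝ => s ^ 2 * (log s * log (1 - s))) 0 1 (71 / 108 - π ^ 2 / 18) :=
  (pow_succ_mul_log_mul_log (k := 1) one_mul_log_mul_log one_mul_log_one_sub
    sq_mul_log_one_sub).congr_val (by push_cast; ring)

theorem cube_mul_log_mul_log :
    HasInt (fun s : ℝ => s ^ 3 * (log s * log (1 - s))) 0 1 (35 / 72 - π ^ 2 / 24) :=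
  (pow_succ_mul_log_mul_log (k := 2) sq_mul_log_mul_log sq_mul_log_one_sub
    cube_mul_log_one_sub).congr_val (by push_cast; ring)

theorem pow_four_mul_log_mul_log :
    HasInt (fun s : ℝ => s ^ 4 * (log s * log (1 - s))) 0 1 (6913 / 18000 - π ^ 2 / 30) :=
  (pow_succ_mul_log_mul_log (k := 3) cube_mul_log_mul_log cube_mul_log_one_sub
    pow_four_mul_log_one_sub).congr_val (by push_cast; ring)

theorem pow_succ_mul_log_sq_mul_log {k : ℕ} {v w w' : ℝ}
    (h : HasInt (fun s : ℝ => s ^ k * (log s ^ 2 * log (1 - s))) 0 1 v)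
    (h' : HasInt (fun s : ℝ => s ^ k * (log s * log (1 - s))) 0 1 w)
    (h'' : HasInt (fun s : ℝ => s ^ (k + 1) * (log s * log (1 - s))) 0 1 w') :
    HasInt (fun s : ℝ => s ^ (k + 1) * (log s ^ 2 * log (1 - s))) 0 1
      (((k + 1) * v + 2 * (w - w') - 2 / (k + 2) ^ 3) / (k + 2)) := by
  have := pow_succ_mul_logs (i := 1) h (by simpa using h') (by simpa using h'')
    (by simpa using pow_mul_log_sq (k + 1))
  refine this.congr_val ?_
  push_cast
  rw [add_assoc (k : ℝ) 1 1, one_add_one_eq_two]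

theorem one_mul_log_sq_mul_log :
    HasInt (fun s : ℝ => s ^ 1 * (log s ^ 2 * log (1 - s))) 0 1
      (-(17 / 8) + π ^ 2 / 12 + zetaThree) :=
  (pow_succ_mul_log_sq_mul_log (k := 0) (by simpa using log_sq_mul_log_one_sub)
    (by simpa using log_mul_log_one_sub) one_mul_log_mul_log).congr_val (by push_cast; ring)

theorem sq_mul_log_sq_mul_log :
    HasInt (fun s : ℝ => s ^ 2 * (log s ^ 2 * log (1 - s))) 0 1
      (-(131 / 108) + π ^ 2 / 27 + 2 / 3 * zetaThree) :=
  (pow_succ_mul_log_sq_mul_log (k := 1) one_mul_log_sq_mul_log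
    one_mul_log_mul_log sq_mul_log_mul_log).congr_val (by push_cast; ring)

theorem cube_mul_log_sq_mul_log :
    HasInt (fun s : ℝ => s ^ 3 * (log s ^ 2 * log (1 - s))) 0 1
      (-(2875 / 3456) + π ^ 2 / 48 + 1 / 2 * zetaThree) :=
  (pow_succ_mul_log_sq_mul_log (k := 2) sq_mul_log_sq_mul_log
    sq_mul_log_mul_log cube_mul_log_mul_log).congr_val (by push_cast; ring)

theorem pow_four_mul_log_sq_mul_log :
    HasInt (fun s : ℝ => s ^ 4 * (log s ^ 2 * log (1 - s))) 0 1
      (-(339059 / 540000) + π ^ 2 / 75 + 2 / 5 * zetaThree) :=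
  (pow_succ_mul_log_sq_mul_log (k := 3) cube_mul_log_sq_mul_log
    cube_mul_log_mul_log pow_four_mul_log_mul_log).congr_val (by push_cast; ring)

theorem quartic_mul_log_mul_log (c₀ c₁ c₂ c₃ c₄ : ℝ) :
    HasInt (fun s => (c₀ + c₁ * s + c₂ * s ^ 2 + c₃ * s ^ 3 + c₄ * s ^ 4)
        * (log s * log (1 - s))) 0 1
      (c₀ * (2 - π ^ 2 / 6) + c₁ * (1 - π ^ 2 / 12) + c₂ * (71 / 108 - π ^ 2 / 18)
        + c₃ * (35 / 72 - π ^ 2 / 24) + c₄ * (6913 / 18000 - π ^ 2 / 30)) :=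
  quartic_mul log_mul_log_one_sub one_mul_log_mul_log sq_mul_log_mul_log cube_mul_log_mul_log
    pow_four_mul_log_mul_log c₀ c₁ c₂ c₃ c₄

theorem quartic_mul_log_sq_mul_log (c₀ c₁ c₂ c₃ c₄ : ℝ) :
    HasInt (fun s => (c₀ + c₁ * s + c₂ * s ^ 2 + c₃ * s ^ 3 + c₄ * s ^ 4)
        * (log s ^ 2 * log (1 - s))) 0 1
      (c₀ * (-6 + π ^ 2 / 3 + 2 * zetaThree) + c₁ * (-(17 / 8) + π ^ 2 / 12 + zetaThree)
        + c₂ * (-(131 / 108) + π ^ 2 / 27 + 2 / 3 * zetaThree)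
        + c₃ * (-(2875 / 3456) + π ^ 2 / 48 + 1 / 2 * zetaThree)
        + c₄ * (-(339059 / 540000) + π ^ 2 / 75 + 2 / 5 * zetaThree)) :=
  quartic_mul log_sq_mul_log_one_sub one_mul_log_sq_mul_log sq_mul_log_sq_mul_log
    cube_mul_log_sq_mul_log pow_four_mul_log_sq_mul_log c₀ c₁ c₂ c₃ c₄

/-- An integrand of the form `g s + g (1 - s)`, pulled back to the half interval. -/
theorem symm_half {f g : ℝ → ℝ} {v : ℝ} (hg : HasInt g 0 1 v)
    (h : ∀ x ∈ Ioo (0 : ℝ) 1, f x = g ((1 + x) / 2) + g ((1 - x) / 2)) : HasInt f 0 1 (2 * v) := by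
  have hg1 : IntervalIntegrable g volume (1 / 2) 1 := hg.1.mono_set (by
    rw [uIcc_of_le (by norm_num), uIcc_of_le zero_le_one]; exact Icc_subset_Icc (by norm_num) le_rfl)
  have hg2 : IntervalIntegrable g volume 0 (1 / 2) := hg.1.mono_set (by
    rw [uIcc_of_le (by norm_num), uIcc_of_le zero_le_one]; exact Icc_subset_Icc le_rfl (by norm_num))
  have i1 : IntervalIntegrable (fun x => g ((1 + x) / 2)) volume 0 1 := by
    have := (hg1.comp_mul_left (c := 1 / 2)).comp_add_left 1
    norm_num at this
    exact this.congr_ae (Eventually.of_forall fun x => by simp only; ring_nf)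
  have i2 : IntervalIntegrable (fun x => g ((1 - x) / 2)) volume 0 1 := by
    have := (hg2.comp_mul_left (c := 1 / 2)).comp_sub_left 1
    norm_num at this
    exact this.symm.congr_ae (Eventually.of_forall fun x => by simp only; ring_nf)
  have e1 : ∫ x in (0 : ℝ)..1, g ((1 + x) / 2) = 2 * ∫ s in (1 / 2)..1, g s := by
    calc ∫ x in (0 : ℝ)..1, g ((1 + x) / 2) = ∫ x in (0 : ℝ)..1, g (1 / 2 * x + 1 / 2) := by
          congr 1; ext x; congr 1; ring
      _ = (1 / 2 : ℝ)⁻¹ • ∫ s in (1 / 2 * 0 + 1 / 2 : ℝ)..(1 / 2 * 1 + 1 / 2), g s :=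
          intervalIntegral.integral_comp_mul_add g (by norm_num) _
      _ = _ := by norm_num
  have e2 : ∫ x in (0 : ℝ)..1, g ((1 - x) / 2) = 2 * ∫ s in (0 : ℝ)..(1 / 2), g s := by
    calc ∫ x in (0 : ℝ)..1, g ((1 - x) / 2) = ∫ x in (0 : ℝ)..1, g (1 / 2 - 1 / 2 * x) := by
          congr 1; ext x; congr 1; ring
      _ = (1 / 2 : ℝ)⁻¹ • ∫ s in (1 / 2 - 1 / 2 * 1 : ℝ)..(1 / 2 - 1 / 2 * 0), g s :=
          intervalIntegral.integral_comp_sub_mul g (by norm_num) _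
      _ = _ := by norm_num
  refine HasInt.congr (f := fun x => g ((1 + x) / 2) + g ((1 - x) / 2)) ?_ zero_le_one
    fun x hx => (h x hx).symm
  refine ⟨i1.add i2, ?_⟩
  rw [intervalIntegral.integral_add i1 i2, e1, e2, ← hg.2,
    ← intervalIntegral.integral_add_adjacent_intervals hg2 hg1]
  ring

end HasInt

/-! ### Closed-form integrals of the index-zero profile and its first correction -/

/-- The index-zero profile. -/
noncomputable def seed (x : ℝ) : ℝ := (1 - x ^ 2) / 4

/-- `x` times the first-order correction to the index-zero profile. -/
noncomputable def corrNum (x : ℝ) : ℝ :=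
  (3 * ((1 + x) / 2) ^ 2 - 2 * ((1 + x) / 2) ^ 3) * log ((1 + x) / 2)
    - (3 * ((1 - x) / 2) ^ 2 - 2 * ((1 - x) / 2) ^ 3) * log ((1 - x) / 2)
    - 5 / 3 * x * seed x

theorem log_seed {x : ℝ} (hx : x ∈ Ioo (0 : ℝ) 1) :
    log (seed x) = log ((1 + x) / 2) + log ((1 - x) / 2) := by
  have h1 : (1 + x) / 2 ≠ 0 := by linarith [hx.1]
  have h2 : (1 - x) / 2 ≠ 0 := by linarith [hx.2]
  rw [← Real.log_mul h1 h2, seed]; congr 1; ring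

namespace HasInt

theorem sq_mul_seed : HasInt (fun x => x ^ 2 * seed x) 0 1 (1 / 30) := by
  have h := (quartic (0 : ℝ) (1 / 2) (-(5 / 2)) 4 (-2)).symm_half
    (f := fun x => x ^ 2 * seed x) (fun x _ => by rw [seed]; ring)
  exact h.congr_val (by norm_num)

/-- With s = (1 + x)/2 one has x² seed = (2s-1)² s(1-s) = s - 5s² + 8s³ - 4s⁴, a polynomial
symmetric under s ↦ 1 - s. Since log seed = log s + log (1 - s), only the log s half has to be
integrated. The normalisation of `seed` is what makes this splitting clean. -/
theorem sq_mul_seed_mul_log :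
    HasInt (fun x => x ^ 2 * (seed x * log (seed x))) 0 1 (-(31 / 450)) := by
  have h := (quartic_mul_log (0 : ℝ) 1 (-5) 8 (-4)).symm_half
    (f := fun x => x ^ 2 * (seed x * log (seed x))) (fun x hx => by
      rw [log_seed hx, seed]; ring)
  exact h.congr_val (by norm_num)

/-- Here q(s) = (2s-1)(3s²-2s³) = -3s² + 8s³ - 4s⁴ is the coefficient of log s in x * `corrNum x`;
the coefficient of log (1 - s) is its reflection q(1 - s). -/
theorem mul_corrNum : HasInt (fun x => x * corrNum x) 0 1 (-(31 / 450)) := by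
  have h := ((quartic_mul_log (0 : ℝ) 0 (-3) 8 (-4)).add
    ((quartic (0 : ℝ) 1 (-5) 8 (-4)).const_mul (-(5 / 6)))).symm_half
    (f := fun x => x * corrNum x) (fun x hx => by
      rw [corrNum, seed]; ring)
  exact h.congr_val (by norm_num)

theorem sq_mul_seed_mul_log_sq :
    HasInt (fun x => x ^ 2 * (seed x * log (seed x) ^ 2)) 0 1 (886 / 3375 - π ^ 2 / 90) := by
  have h := ((quartic_mul_log_sq (0 : ℝ) 1 (-5) 8 (-4)).add
    (quartic_mul_log_mul_log (0 : ℝ) 1 (-5) 8 (-4))).symm_half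
    (f := fun x => x ^ 2 * (seed x * log (seed x) ^ 2)) (fun x hx => by
      have e1 : 1 - (1 + x) / 2 = (1 - x) / 2 := by ring
      have e2 : 1 - (1 - x) / 2 = (1 + x) / 2 := by ring
      rw [log_seed hx, seed, e1, e2]; ring)
  exact h.congr_val (by ring)

theorem sq_mul_seed_mul_log_cube :
    HasInt (fun x => x ^ 2 * (seed x * log (seed x) ^ 3)) 0 1
      (-(25816 / 16875) + 2 / 5 * zetaThree + 31 / 450 * π ^ 2) := by
  have h := ((quartic_mul_log_cube (0 : ℝ) 1 (-5) 8 (-4)).add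
    ((quartic_mul_log_sq_mul_log (0 : ℝ) 1 (-5) 8 (-4)).const_mul 3)).symm_half
    (f := fun x => x ^ 2 * (seed x * log (seed x) ^ 3)) (fun x hx => by
      have e1 : 1 - (1 + x) / 2 = (1 - x) / 2 := by ring
      have e2 : 1 - (1 - x) / 2 = (1 + x) / 2 := by ring
      rw [log_seed hx, seed, e1, e2]; ring)
  exact h.congr_val (by ring)

theorem mul_corrNum_mul_log :
    HasInt (fun x => x * (corrNum x * log (seed x))) 0 1 (2711 / 3375 - π ^ 2 / 15) := by
  have h := (((quartic_mul_log_sq (0 : ℝ) 0 (-3) 8 (-4)).add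
    (quartic_mul_log_mul_log (0 : ℝ) 0 (-3) 8 (-4))).add
    ((quartic_mul_log (0 : ℝ) 1 (-5) 8 (-4)).const_mul (-(5 / 3)))).symm_half
    (f := fun x => x * (corrNum x * log (seed x))) (fun x hx => by
      have e1 : 1 - (1 + x) / 2 = (1 - x) / 2 := by ring
      have e2 : 1 - (1 - x) / 2 = (1 + x) / 2 := by ring
      rw [log_seed hx, corrNum, seed, e1, e2]; ring)
  exact h.congr_val (by ring)

theorem mul_corrNum_mul_log_sq :
    HasInt (fun x => x * (corrNum x * log (seed x) ^ 2)) 0 1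
      (-(345223 / 50625) + 493 / 1350 * π ^ 2 + 12 / 5 * zetaThree) := by
  have h := (((((quartic_mul_log_cube (0 : ℝ) 0 (-3) 8 (-4)).add
    ((quartic_mul_log_sq_mul_log (0 : ℝ) 0 (-3) 8 (-4)).const_mul 2)).add
    -- The polynomial 1 - 2s - 3s² + 8s³ - 4s⁴ is q(1 - s). It comes from the term q(s) log s log²
    -- (1 - s), which the reflection s ↦ 1 - s turns into a log² s log (1 - s) term.
    (quartic_mul_log_sq_mul_log (1 : ℝ) (-2) (-3) 8 (-4)))).add
    (((quartic_mul_log_sq (0 : ℝ) 1 (-5) 8 (-4)).add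
      (quartic_mul_log_mul_log (0 : ℝ) 1 (-5) 8 (-4))).const_mul (-(5 / 3)))).symm_half
    (f := fun x => x * (corrNum x * log (seed x) ^ 2)) (fun x hx => by
      have e1 : 1 - (1 + x) / 2 = (1 - x) / 2 := by ring
      have e2 : 1 - (1 - x) / 2 = (1 + x) / 2 := by ring
      rw [log_seed hx, corrNum, seed, e1, e2]; ring)
  exact h.congr_val (by ring)

/-- Dividing by seed = s(1-s) leaves a pole only in the squared logarithms. Polynomial division of
s³(3-2s)² by 1 - s has remainder 1, so exactly one term log² s / (1 - s) survives; the rest is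
quartic. -/
theorem corrNum_sq_div :
    HasInt (fun x => corrNum x ^ 2 / seed x) 0 1
      (4 * zetaThree - 45553 / 6750 + 19 / 90 * π ^ 2) := by
  have h := (((((log_sq_div_one_sub).sub (quartic_mul_log_sq (1 : ℝ) 1 1 (-8) 4)).sub
    (quartic_mul_log_mul_log (0 : ℝ) 3 1 (-8) 4)).sub
    ((quartic_mul_log (0 : ℝ) 0 (-3) 8 (-4)).const_mul (10 / 3))).add
    ((quartic (0 : ℝ) 1 (-5) 8 (-4)).const_mul (25 / 18))).symm_half
    (f := fun x => corrNum x ^ 2 / seed x) (fun x hx => by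
      have e1 : 1 - (1 + x) / 2 = (1 - x) / 2 := by ring
      have e2 : 1 - (1 - x) / 2 = (1 + x) / 2 := by ring
      have h1 : 1 + x ≠ 0 := by linarith [hx.1]
      have h2 : 1 - x ≠ 0 := by linarith [hx.2]
      have h3 : (1 - x ^ 2) / 4 = (1 + x) * (1 - x) / 4 := by ring
      rw [corrNum, seed, e1, e2, h3]
      field_simp
      ring)
  exact h.congr_val (by ring)

end HasInt

/-! ### The radial Green operator on the unit ball -/

theorem hasDerivAt_integral_of_continuousOn_Ioo {f : ℝ → ℝ} {a b z : ℝ}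
    (hf : ContinuousOn f (Ioo a b)) (hi : IntervalIntegrable f volume a b) (hz : z ∈ Ioo a b) :
    HasDerivAt (fun u => ∫ t in a..u, f t) (f z) z := by
  refine integral_hasDerivAt_right (hi.mono_set ?_)
    (hf.stronglyMeasurableAtFilter isOpen_Ioo z hz) (hf.continuousAt (isOpen_Ioo.mem_nhds hz))
  rw [uIcc_of_le hz.1.le, uIcc_of_le (hz.1.trans hz.2).le]
  exact Icc_subset_Icc_right hz.2.le

theorem continuousOn_integral_Icc {f : ℝ → ℝ} {a b : ℝ} (hab : a ≤ b)
    (hi : IntervalIntegrable f volume a b) :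
    ContinuousOn (fun u => ∫ t in a..u, f t) (Icc a b) := by
  have := continuousOn_primitive_interval' hi (left_mem_uIcc)
  rwa [uIcc_of_le hab] at this

/-- The second moment of `h` on `[0, x]`. -/
noncomputable def massOf (h : ℝ → ℝ) (x : ℝ) : ℝ := ∫ t in (0 : ℝ)..x, t ^ 2 * h t

/-- The radial solution of `-(x² u')' = x² h` on the unit ball with `u 1 = 0`. -/
noncomputable def green (h : ℝ → ℝ) (x : ℝ) : ℝ :=
  (∫ τ in (0 : ℝ)..1, massOf h τ / τ ^ 2) - ∫ τ in (0 : ℝ)..x, massOf h τ / τ ^ 2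

/-- Sources admissible for `green`. -/
structure IsSource (h : ℝ → ℝ) : Prop where
  cont : ContinuousOn h (Ioo 0 1)
  int : IntervalIntegrable h volume 0 1

namespace IsSource

variable {h g : ℝ → ℝ}

theorem sq_mul (hh : IsSource h) : IsSource fun t => t ^ 2 * h t :=
  ⟨(continuous_pow 2).continuousOn.mul hh.cont,
    hh.int.continuousOn_mul (continuous_pow 2).continuousOn⟩

theorem add (hh : IsSource h) (hg : IsSource g) : IsSource fun t => h t + g t :=
  ⟨hh.cont.add hg.cont, hh.int.add hg.int⟩

theorem sub (hh : IsSource h) (hg : IsSource g) : IsSource fun t => h t - g t :=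
  ⟨hh.cont.sub hg.cont, hh.int.sub hg.int⟩

theorem const_mul (c : ℝ) (hh : IsSource h) : IsSource fun t => c * h t :=
  ⟨continuousOn_const.mul hh.cont, hh.int.const_mul c⟩

theorem const (c : ℝ) : IsSource fun _ => c :=
  ⟨continuousOn_const, intervalIntegrable_const⟩

theorem of_abs_le {w : ℝ} {H : ℝ → ℝ} (hc : ContinuousOn h (Ioo 0 1)) (hH : HasInt H 0 1 w)
    (hle : ∀ x ∈ Ioo (0 : ℝ) 1, |h x| ≤ H x) : IsSource h :=
  ⟨hc, intervalIntegrable_of_abs_le zero_le_one hc hH.1 hle⟩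

theorem integrable_of_le (hh : IsSource h) {x : ℝ} (hx : x ∈ Icc (0 : ℝ) 1) :
    IntervalIntegrable h volume 0 x := hh.int.mono_set (by
  rw [uIcc_of_le hx.1, uIcc_of_le zero_le_one]; exact Icc_subset_Icc_right hx.2)

theorem mass_hasDerivAt (hh : IsSource h) {x : ℝ} (hx : x ∈ Ioo (0 : ℝ) 1) :
    HasDerivAt (massOf h) (x ^ 2 * h x) x :=
  hasDerivAt_integral_of_continuousOn_Ioo hh.sq_mul.cont hh.sq_mul.int hx

theorem mass_continuousOn (hh : IsSource h) : ContinuousOn (massOf h) (Icc 0 1) :=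
  continuousOn_integral_Icc zero_le_one hh.sq_mul.int

theorem mass_le_of_le (hh : IsSource h) (hg : IsSource g) (hle : ∀ x ∈ Ioo (0 : ℝ) 1, h x ≤ g x)
    {x : ℝ} (hx : x ∈ Icc (0 : ℝ) 1) : massOf h x ≤ massOf g x :=
  intervalIntegral.integral_mono_on_of_le_Ioo hx.1 (hh.sq_mul.integrable_of_le hx)
    (hg.sq_mul.integrable_of_le hx) fun t ht =>
    mul_le_mul_of_nonneg_left (hle t ⟨ht.1, ht.2.trans_le hx.2⟩) (sq_nonneg t)

/-- Bounding t² by x² under the integral cancels the singular 1/x² in the slope, so integrable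
unbounded sources are admissible. -/
theorem abs_mass_le {w : ℝ} {H : ℝ → ℝ} (hh : IsSource h) (hH : HasInt H 0 1 w)
    (hle : ∀ x ∈ Ioo (0 : ℝ) 1, |h x| ≤ H x) {x : ℝ} (hx : x ∈ Icc (0 : ℝ) 1) :
    |massOf h x| ≤ x ^ 2 * w := by
  have hH' : IntervalIntegrable H volume 0 x := hH.1.mono_set (by
    rw [uIcc_of_le hx.1, uIcc_of_le zero_le_one]; exact Icc_subset_Icc_right hx.2)
  have hH'' : IntervalIntegrable H volume x 1 := hH.1.mono_set (by
    rw [uIcc_of_le hx.2, uIcc_of_le zero_le_one]; exact Icc_subset_Icc_left hx.1)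
  have h1 := HasInt.abs_val_le (HasInt.of_integrable (hh.sq_mul.integrable_of_le hx))
    ((HasInt.of_integrable hH').const_mul (x ^ 2)) hx.1 fun t ht => by
      rw [abs_mul, abs_of_nonneg (sq_nonneg t)]
      exact mul_le_mul (pow_le_pow_left₀ ht.1.le ht.2.le 2) (hle t ⟨ht.1, ht.2.trans_le hx.2⟩)
        (abs_nonneg _) (sq_nonneg x)
  refine h1.trans (mul_le_mul_of_nonneg_left ?_ (sq_nonneg x))
  rw [← hH.2, ← intervalIntegral.integral_add_adjacent_intervals hH' hH'']
  have : 0 ≤ ∫ x in x..1, H x := by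
    have := (HasInt.mono (f := fun _ => 0) (v := 0) ⟨intervalIntegrable_const, by simp⟩
      (HasInt.of_integrable hH'') hx.2 fun t ht => ?_)
    · exact this
    · exact (abs_nonneg _).trans (hle t ⟨hx.1.trans_lt ht.1, ht.2⟩)
  linarith

theorem abs_mass_le_l1 (hh : IsSource h) {x : ℝ} (hx : x ∈ Icc (0 : ℝ) 1) :
    |massOf h x| ≤ x ^ 2 * ∫ t in (0 : ℝ)..1, |h t| :=
  hh.abs_mass_le (HasInt.of_integrable hh.int.abs) (fun _ _ => le_rfl) hx

theorem slope (hh : IsSource h) : IsSource fun τ => massOf h τ / τ ^ 2 := by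
  refine of_abs_le (H := fun _ => ∫ t in (0 : ℝ)..1, |h t|) ?_
    (HasInt.of_integrable intervalIntegrable_const) fun x hx => ?_
  · exact (hh.mass_continuousOn.mono Ioo_subset_Icc_self).div (continuous_pow 2).continuousOn
      fun x hx => pow_ne_zero 2 hx.1.ne'
  · have := hh.abs_mass_le_l1 ⟨hx.1.le, hx.2.le⟩
    rw [abs_div, abs_of_pos (pow_pos hx.1 2), div_le_iff₀ (pow_pos hx.1 2)]
    linarith

theorem green_continuousOn (hh : IsSource h) : ContinuousOn (green h) (Icc 0 1) :=
  continuousOn_const.sub (continuousOn_integral_Icc zero_le_one hh.slope.int)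

theorem green_hasDerivAt (hh : IsSource h) {x : ℝ} (hx : x ∈ Ioo (0 : ℝ) 1) :
    HasDerivAt (green h) (-(massOf h x / x ^ 2)) x :=
  (hasDerivAt_integral_of_continuousOn_Ioo hh.slope.cont hh.slope.int hx).const_sub _

theorem green_eq (hh : IsSource h) {x : ℝ} (hx : x ∈ Icc (0 : ℝ) 1) :
    green h x = ∫ τ in x..1, massOf h τ / τ ^ 2 := by
  have h1 := hh.slope.integrable_of_le hx
  rw [green, intervalIntegral.integral_interval_sub_left hh.slope.int h1]

theorem slope_integrable_right (hh : IsSource h) {x : ℝ} (hx : x ∈ Icc (0 : ℝ) 1) :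
    IntervalIntegrable (fun τ => massOf h τ / τ ^ 2) volume x 1 := hh.slope.int.mono_set (by
  rw [uIcc_of_le hx.2, uIcc_of_le zero_le_one]; exact Icc_subset_Icc_left hx.1)

theorem green_le_of_le (hh : IsSource h) (hg : IsSource g) (hle : ∀ x ∈ Ioo (0 : ℝ) 1, h x ≤ g x)
    {x : ℝ} (hx : x ∈ Icc (0 : ℝ) 1) : green h x ≤ green g x := by
  rw [hh.green_eq hx, hg.green_eq hx]
  exact intervalIntegral.integral_mono_on_of_le_Ioo hx.2 (hh.slope_integrable_right hx)
    (hg.slope_integrable_right hx) fun t ht => div_le_div_of_nonneg_right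
      (hh.mass_le_of_le hg hle ⟨hx.1.trans ht.1.le, ht.2.le⟩) (sq_nonneg t)

/-- The slope is bounded by w, hence the solution vanishes at least linearly at x = 1. The factor 1
- x is needed later to divide by `seed`. -/
theorem abs_green_le {w : ℝ} {H : ℝ → ℝ} (hh : IsSource h) (hH : HasInt H 0 1 w)
    (hle : ∀ x ∈ Ioo (0 : ℝ) 1, |h x| ≤ H x) {x : ℝ} (hx : x ∈ Icc (0 : ℝ) 1) :
    |green h x| ≤ (1 - x) * w := by
  rw [hh.green_eq hx]
  refine HasInt.abs_val_le (HasInt.of_integrable (hh.slope_integrable_right hx))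
    (g := fun _ => w) ⟨intervalIntegrable_const, by simp⟩ hx.2 fun t ht => ?_
  have ht0 : 0 < t := hx.1.trans_lt ht.1
  have := hh.abs_mass_le hH hle ⟨ht0.le, ht.2.le⟩
  rw [abs_div, abs_of_pos (pow_pos ht0 2), div_le_iff₀ (pow_pos ht0 2)]
  linarith

end IsSource

theorem massOf_congr {h g : ℝ → ℝ} (hhg : ∀ x ∈ Ioo (0 : ℝ) 1, h x = g x) {x : ℝ}
    (hx : x ∈ Icc (0 : ℝ) 1) : massOf h x = massOf g x := by
  refine intervalIntegral.integral_congr_ae_restrict ?_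
  rw [uIoc_of_le hx.1, ← restrict_Ioo_eq_restrict_Ioc]
  refine (ae_restrict_iff' measurableSet_Ioo).2 (Eventually.of_forall fun t ht => ?_)
  simp only [hhg t ⟨ht.1, ht.2.trans_le hx.2⟩]

theorem massOf_const_mul (c : ℝ) (h : ℝ → ℝ) (x : ℝ) :
    massOf (fun t => c * h t) x = c * massOf h x := by
  rw [massOf, massOf, ← intervalIntegral.integral_const_mul]
  congr 1; ext t; ring

theorem green_const_mul (c : ℝ) (h : ℝ → ℝ) (x : ℝ) :
    green (fun t => c * h t) x = c * green h x := by
  simp only [green, massOf_const_mul, mul_div_assoc, intervalIntegral.integral_const_mul]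
  ring

theorem IsSource.massOf_add {h g : ℝ → ℝ} (hh : IsSource h) (hg : IsSource g) {x : ℝ}
    (hx : x ∈ Icc (0 : ℝ) 1) : massOf (fun t => h t + g t) x = massOf h x + massOf g x := by
  rw [massOf, massOf, massOf, ← intervalIntegral.integral_add (hh.sq_mul.integrable_of_le hx)
    (hg.sq_mul.integrable_of_le hx)]
  congr 1; ext t; ring

theorem IsSource.green_add {h g : ℝ → ℝ} (hh : IsSource h) (hg : IsSource g) {x : ℝ}
    (hx : x ∈ Icc (0 : ℝ) 1) : green (fun t => h t + g t) x = green h x + green g x := by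
  rw [(hh.add hg).green_eq hx, hh.green_eq hx, hg.green_eq hx,
    ← intervalIntegral.integral_add (hh.slope_integrable_right hx) (hg.slope_integrable_right hx)]
  refine ((HasInt.of_integrable ((hh.add hg).slope_integrable_right hx)).congr hx.2
    fun t ht => ?_).2.symm
  rw [hh.massOf_add hg ⟨hx.1.trans ht.1.le, ht.2.le⟩, add_div]

theorem IsSource.green_sub {h g : ℝ → ℝ} (hh : IsSource h) (hg : IsSource g) {x : ℝ}
    (hx : x ∈ Icc (0 : ℝ) 1) : green (fun t => h t - g t) x = green h x - green g x := by
  have := hh.green_add (hg.const_mul (-1)) hx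
  rw [green_const_mul] at this
  simp only [sub_eq_add_neg]
  simpa using this

/-- The factor 3/2 in the unit-ball problem is chosen to make this profile equal to ((1 + x)/2)((1 -
x)/2). -/
theorem green_one {x : ℝ} (hx : x ∈ Icc (0 : ℝ) 1) : 3 / 2 * green (fun _ => 1) x = seed x := by
  have hm : ∀ t, massOf (fun _ => 1) t = t ^ 3 / 3 := fun t => by
    simp [massOf, integral_pow]; norm_num
  rw [(IsSource.const 1).green_eq hx]
  have h1 := HasInt.congr (f := fun t : ℝ => t / 3) (g := fun t => massOf (fun _ => 1) t / t ^ 2)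
    (a := x) (b := 1) (v := (1 - x ^ 2) / 6) ⟨(continuous_id.div_const 3).intervalIntegrable _ _, by
      rw [intervalIntegral.integral_div, integral_id]; ring⟩ hx.2 fun t ht => by
      have : t ≠ 0 := (hx.1.trans_lt ht.1).ne'
      rw [hm]; field_simp
  rw [h1.2, seed]; ring

theorem IsSource.mass_div_continuousOn {h : ℝ → ℝ} (hh : IsSource h) :
    ContinuousOn (fun x => massOf h x / x) (Icc 0 1) := by
  intro x hx
  rcases hx.1.eq_or_lt with h0 | h0
  · rw [← h0]
    have : Tendsto (fun x => massOf h x / x) (𝓝[Icc 0 1] 0) (𝓝 0) := by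
      refine squeeze_zero_norm' (a := fun x => x * ∫ t in (0 : ℝ)..1, |h t|) ?_ ?_
      · filter_upwards [self_mem_nhdsWithin] with y hy
        rcases hy.1.eq_or_lt with h1 | h1
        · rw [← h1]; simp
        · have := hh.abs_mass_le_l1 hy
          rw [norm_div, Real.norm_eq_abs, Real.norm_eq_abs, abs_of_pos h1, div_le_iff₀ h1]
          linarith
      · have : Tendsto (fun x : ℝ => x * ∫ t in (0 : ℝ)..1, |h t|) (𝓝 0)
            (𝓝 (0 * ∫ t in (0 : ℝ)..1, |h t|)) := (continuous_id.mul continuous_const).tendsto 0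
        rw [zero_mul] at this
        exact this.mono_left nhdsWithin_le_nhds
    simpa [ContinuousWithinAt] using this
  · exact (hh.mass_continuousOn x hx).div continuousWithinAt_id h0.ne'

/-- Integration by parts on `massOf h x / x` turns the double integral at the centre into one
integral with kernel t - t². -/
theorem IsSource.green_zero {h : ℝ → ℝ} (hh : IsSource h) :
    HasInt (fun t => (t - t ^ 2) * h t) 0 1 (green h 0) := by
  have hth : IntervalIntegrable (fun t => t * h t) volume 0 1 :=
    hh.int.continuousOn_mul continuous_id.continuousOn
  have h1 := HasInt.of_hasDerivAt (F := fun x => -(massOf h x / x))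
    (f := fun x => massOf h x / x ^ 2 - x * h x) zero_le_one hh.mass_div_continuousOn.neg
    (fun x hx => by
      have hx0 := hx.1.ne'
      refine ((hh.mass_hasDerivAt hx).div (hasDerivAt_id x) hx0).neg.congr_deriv ?_
      simp only [id]
      field_simp
      ring) (hh.slope.int.sub hth)
  have h2 := (HasInt.of_integrable hth).add ((HasInt.of_integrable hh.sq_mul.int).neg)
  have h3 : HasInt (fun t => massOf h t / t ^ 2) 0 1 (green h 0) := by
    refine ⟨hh.slope.int, ?_⟩
    rw [hh.green_eq ⟨le_rfl, zero_le_one⟩]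
  refine ((h2.congr zero_le_one fun t _ => by ring)).congr_val ?_
  have h4 := (h1.add (HasInt.of_integrable hth)).congr zero_le_one
    (g := fun t => massOf h t / t ^ 2) (fun t _ => by ring)
  have h5 := h3.unique h4
  rw [h5]
  simp [massOf]
  ring

/-- Self-adjointness of the Green operator: the integrand is the derivative of a Wronskian-type
expression whose masses vanish at 0 and whose solutions vanish at 1. -/
theorem HasInt.mul_green_sub {h g : ℝ → ℝ} (hh : IsSource h) (hg : IsSource g) :
    HasInt (fun x => x ^ 2 * (h x * green g x - g x * green h x)) 0 1 0 := by
  have h1 := HasInt.of_hasDerivAt (F := fun x => massOf h x * green g x - massOf g x * green h x)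
    (f := fun x => x ^ 2 * (h x * green g x - g x * green h x)) zero_le_one
    ((hh.mass_continuousOn.mul hg.green_continuousOn).sub
      (hg.mass_continuousOn.mul hh.green_continuousOn))
    (fun x hx => by
      refine (((hh.mass_hasDerivAt hx).mul (hg.green_hasDerivAt hx)).sub
        ((hg.mass_hasDerivAt hx).mul (hh.green_hasDerivAt hx))).congr_deriv ?_
      have := hx.1.ne'
      field_simp
      ring)
    (by
      have e1 : IntervalIntegrable (fun x => x ^ 2 * h x * green g x) volume 0 1 :=
        hh.sq_mul.int.mul_continuousOn (by
          rw [uIcc_of_le zero_le_one]; exact hg.green_continuousOn)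
      have e2 : IntervalIntegrable (fun x => x ^ 2 * g x * green h x) volume 0 1 :=
        hg.sq_mul.int.mul_continuousOn (by
          rw [uIcc_of_le zero_le_one]; exact hh.green_continuousOn)
      exact (e1.sub e2).congr_ae (Eventually.of_forall fun x => by simp only; ring))
  refine h1.congr_val ?_
  have e1 : green g 1 = 0 := by simp [green]
  have e2 : green h 1 = 0 := by simp [green]
  simp [e1, e2, massOf]

/-! ### Existence of the profile for small n -/

/-- The logarithm of the index-zero profile. -/
noncomputable def logSeed (x : ℝ) : ℝ := log (seed x)

theorem seed_pos {x : ℝ} (hx : x ∈ Ioo (0 : ℝ) 1) : 0 < seed x := by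
  rw [seed]; nlinarith [hx.1, hx.2]

theorem seed_le {x : ℝ} : seed x ≤ 1 / 4 := by
  rw [seed]; nlinarith [sq_nonneg x]

theorem le_seed {x : ℝ} (hx : x ∈ Icc (0 : ℝ) 1) : (1 - x) / 4 ≤ seed x := by
  rw [seed]; nlinarith [hx.1, hx.2]

theorem exp_logSeed {x : ℝ} (hx : x ∈ Ioo (0 : ℝ) 1) : exp (logSeed x) = seed x :=
  exp_log (seed_pos hx)

theorem logSeed_neg {x : ℝ} (hx : x ∈ Ioo (0 : ℝ) 1) : logSeed x < 0 :=
  Real.log_neg (seed_pos hx) (seed_le.trans_lt (by norm_num))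

theorem logSeed_continuousOn : ContinuousOn logSeed (Ioo 0 1) :=
  ContinuousOn.log (by unfold seed; fun_prop) fun x hx => (seed_pos hx).ne'

/-- An integrable weight dominating all powers of `logSeed`. -/
noncomputable def weight (x : ℝ) : ℝ := exp (-(logSeed x) / 2)

theorem weight_pos (x : ℝ) : 0 < weight x := exp_pos _

/-- The weight is seed^(-1/2), and seed ≥ (1 - x)/4 bounds it by 2 (1 - x)^(-1/2). -/
theorem weight_isSource : IsSource weight := by
  have h1 : IntervalIntegrable (fun x : ℝ => 2 * (1 - x) ^ (-(1 / 2) : ℝ)) volume 0 1 :=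
    ((HasInt.of_integrable (intervalIntegrable_rpow' (by norm_num))).reflect.1).const_mul 2
  refine IsSource.of_abs_le (by
    have := logSeed_continuousOn
    unfold weight
    fun_prop) (HasInt.of_integrable h1) fun x hx => ?_
  have hx1 : 0 < 1 - x := sub_pos.2 hx.2
  rw [abs_of_pos (weight_pos x), weight, logSeed]
  have h2 : exp (-log (seed x) / 2) ≤ exp (-log ((1 - x) / 4) / 2) := by
    have := Real.log_le_log (by positivity) (le_seed ⟨hx.1.le, hx.2.le⟩)
    exact exp_le_exp.2 (by linarith)
  refine h2.trans (le_of_eq ?_)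
  rw [rpow_def_of_pos hx1, Real.log_div hx1.ne' (by norm_num),
    show (4 : ℝ) = 2 ^ 2 by norm_num, Real.log_pow]
  have e : ∀ u : ℝ, 2 * exp u = exp (log 2 + u) := fun u => by rw [exp_add, exp_log zero_lt_two]
  rw [e]
  congr 1
  push_cast
  ring

theorem one_le_weight {x : ℝ} (hx : x ∈ Ioo (0 : ℝ) 1) : 1 ≤ weight x := by
  rw [weight, ← exp_zero]
  exact exp_le_exp.2 (by linarith [logSeed_neg hx])

/-- With a = |logSeed| + C, the inequality (a/4)ᵏ/k! ≤ exp (a/4) leaves exp (a/2), a constant times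
the weight. The rate 1/4 in the exponent corresponds to the restriction n ≤ 1/4 in the Taylor
remainders. -/
theorem exists_pow_mul_exp_le_weight {C : ℝ} (hC : 0 ≤ C) (k : ℕ) :
    ∃ K, 0 ≤ K ∧ ∀ x ∈ Ioo (0 : ℝ) 1,
      (|logSeed x| + C) ^ k * exp ((|logSeed x| + C) / 4) ≤ K * weight x := by
  refine ⟨4 ^ k * k.factorial * exp (C / 2), by positivity, fun x hx => ?_⟩
  set a := |logSeed x| + C with ha
  have ha0 : 0 ≤ a := by positivity
  have h1 := Real.pow_div_factorial_le_exp (a / 4) (by positivity) k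
  rw [div_le_iff₀ (by positivity), div_pow, div_le_iff₀ (by positivity)] at h1
  have hw : weight x = exp (|logSeed x| / 2) := by
    rw [weight, abs_of_neg (logSeed_neg hx)]
  calc a ^ k * exp (a / 4) ≤ exp (a / 4) * k.factorial * 4 ^ k * exp (a / 4) :=
        mul_le_mul_of_nonneg_right h1 (exp_pos _).le
    _ = 4 ^ k * k.factorial * (exp (a / 4) * exp (a / 4)) := by ring
    _ = 4 ^ k * k.factorial * (exp (C / 2) * exp (|logSeed x| / 2)) := by
        rw [← exp_add, ← exp_add]; congr 2; rw [ha]; ring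
    _ = _ := by rw [hw]; ring

theorem logSeed_isSource : IsSource logSeed := by
  obtain ⟨K, -, hK⟩ := exists_pow_mul_exp_le_weight le_rfl 1
  refine IsSource.of_abs_le logSeed_continuousOn
    (HasInt.of_integrable (weight_isSource.const_mul K).int) fun x hx => ?_
  refine le_trans ?_ (hK x hx)
  rw [add_zero, pow_one]
  exact le_mul_of_one_le_right (abs_nonneg _) (one_le_exp (by positivity))

/-- The source `Yⁿ` for `Y = seed * exp ℓ`. -/
noncomputable def src (n : ℝ) (ℓ : ℝ → ℝ) (t : ℝ) : ℝ := exp (n * (logSeed t + ℓ t))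

theorem src_pos (n : ℝ) (ℓ : ℝ → ℝ) (t : ℝ) : 0 < src n ℓ t := exp_pos _

theorem src_le {n R : ℝ} {ℓ : ℝ → ℝ} (hn : 0 ≤ n) (hb : ∀ x ∈ Ioo (0 : ℝ) 1, |ℓ x| ≤ R) {x : ℝ}
    (hx : x ∈ Ioo (0 : ℝ) 1) : src n ℓ x ≤ exp (n * R) := by
  refine exp_le_exp.2 (mul_le_mul_of_nonneg_left ?_ hn)
  linarith [logSeed_neg hx, (abs_le.1 (hb x hx)).2]

theorem src_isSource {n R : ℝ} {ℓ : ℝ → ℝ} (hn : 0 ≤ n) (hc : ContinuousOn ℓ (Ioo 0 1))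
    (hb : ∀ x ∈ Ioo (0 : ℝ) 1, |ℓ x| ≤ R) : IsSource (src n ℓ) := by
  refine IsSource.of_abs_le (H := fun _ => exp (n * R)) ?_
    (HasInt.of_integrable intervalIntegrable_const) fun x hx => ?_
  · have := logSeed_continuousOn
    unfold src
    fun_prop
  · rw [abs_of_pos (src_pos _ _ _)]
    exact src_le hn hb hx

theorem IsSource.green_pos {h : ℝ → ℝ} (hh : IsSource h) (hp : ∀ x ∈ Ioo (0 : ℝ) 1, 0 < h x) {x : ℝ}
    (hx : x ∈ Ico (0 : ℝ) 1) : 0 < green h x := by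
  rw [hh.green_eq ⟨hx.1, hx.2.le⟩]
  refine intervalIntegral_pos_of_pos_on (hh.slope_integrable_right ⟨hx.1, hx.2.le⟩) (fun t ht => ?_) hx.2
  have ht0 : 0 < t := hx.1.trans_lt ht.1
  refine div_pos ?_ (pow_pos ht0 2)
  exact intervalIntegral_pos_of_pos_on (hh.sq_mul.integrable_of_le ⟨ht0.le, ht.2.le⟩)
    (fun s hs => mul_pos (pow_pos hs.1 2) (hp s ⟨hs.1, hs.2.trans ht.2⟩)) ht0

theorem abs_log_le_of_mem {a c : ℝ} (ha : 0 ≤ a) (ha' : a ≤ 1 / 2) (hc : 1 - a ≤ c) (hc1 : c ≤ 1) :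
    |log c| ≤ 2 * a := by
  have hc0 : 0 < c := by linarith
  rw [abs_of_nonpos (Real.log_nonpos hc0.le hc1)]
  have h1 := Real.one_sub_inv_le_log_of_pos hc0
  have h2 : c⁻¹ ≤ 1 + 2 * a := by
    rw [inv_le_comm₀ hc0 (by positivity)]
    refine le_trans ?_ hc
    rw [inv_le_iff_one_le_mul₀ (by positivity)]
    nlinarith
  linarith

/-- `seed * exp ℓ` solves the Dirichlet problem of index `n` on the unit ball. -/
structure IsProfile (C n : ℝ) (ℓ : ℝ → ℝ) : Prop where
  cont : ContinuousOn ℓ (Ioo 0 1)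
  bound : ∀ x ∈ Ioo (0 : ℝ) 1, |ℓ x| ≤ C * n
  fixed : ∀ x ∈ Ioo (0 : ℝ) 1, 3 / 2 * green (src n ℓ) x = seed x * exp (ℓ x)

/-- If ℓ ≤ m + d then the source grows by at most the factor exp (n d), and the Green operator is
linear and order preserving. On the logarithmic scale the map therefore contracts by n. -/
theorem abs_log_ratio_le {n R d : ℝ} {ℓ m : ℝ → ℝ} (hn : 0 ≤ n) (hℓ : ContinuousOn ℓ (Ioo 0 1))
    (hℓb : ∀ x ∈ Ioo (0 : ℝ) 1, |ℓ x| ≤ R) (hm : ContinuousOn m (Ioo 0 1))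
    (hmb : ∀ x ∈ Ioo (0 : ℝ) 1, |m x| ≤ R) (hd : ∀ x ∈ Ioo (0 : ℝ) 1, |ℓ x - m x| ≤ d) {x : ℝ}
    (hx : x ∈ Ioo (0 : ℝ) 1) :
    log (3 / 2 * green (src n ℓ) x / seed x) ≤ log (3 / 2 * green (src n m) x / seed x) + n * d := by
  have h1 := src_isSource hn hℓ hℓb
  have h2 := src_isSource hn hm hmb
  have hx' : x ∈ Icc (0 : ℝ) 1 := ⟨hx.1.le, hx.2.le⟩
  have p1 := h1.green_pos (fun _ _ => src_pos _ _ _) ⟨hx.1.le, hx.2⟩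
  have p2 := h2.green_pos (fun _ _ => src_pos _ _ _) ⟨hx.1.le, hx.2⟩
  have ps := seed_pos hx
  have hle : green (src n ℓ) x ≤ exp (n * d) * green (src n m) x := by
    rw [← green_const_mul]
    refine h1.green_le_of_le (h2.const_mul _) (fun t ht => ?_) hx'
    rw [src, src, ← exp_add]
    refine exp_le_exp.2 ?_
    nlinarith [(abs_le.1 (hd t ht)).2]
  rw [← Real.log_exp (n * d), ← Real.log_mul (by positivity) (exp_pos _).ne']
  refine Real.log_le_log (by positivity) ?_
  calc 3 / 2 * green (src n ℓ) x / seed x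
      ≤ 3 / 2 * (exp (n * d) * green (src n m) x) / seed x :=
        div_le_div_of_nonneg_right (mul_le_mul_of_nonneg_left hle (by norm_num)) ps.le
    _ = _ := by ring

theorem exists_isProfile : ∃ C, 0 ≤ C ∧ ∃ n₀ > 0, n₀ ≤ 1 / 4 ∧
    ∀ n, 0 ≤ n → n ≤ n₀ → ∃ ℓ, IsProfile C n ℓ := by
  set w := ∫ x in (0 : ℝ)..1, |logSeed x| with hw
  have hwI : HasInt (fun x => |logSeed x|) 0 1 w := HasInt.of_integrable logSeed_isSource.int.abs
  have hw0 : 0 ≤ w := intervalIntegral.integral_nonneg zero_le_one fun _ _ => abs_nonneg _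
  -- The choice of n₀ gives both n ≤ 1/4 and 6nw ≤ 1/2. The map sends 0 within 12wn of 0, and as it
  -- contracts by n ≤ 1/4 it preserves the ball of radius 24wn.
  refine ⟨24 * w, by positivity, 1 / (4 + 12 * w), by positivity,
    one_div_le_one_div_of_le (by norm_num) (by linarith), fun n hn hn' => ?_⟩
  have hn4 : n ≤ 1 / 4 :=
    hn'.trans (one_div_le_one_div_of_le (by norm_num) (by linarith))
  have hnw : 6 * n * w ≤ 1 / 2 := by
    rw [le_div_iff₀ (by positivity)] at hn'
    nlinarith
  have hR : 0 ≤ 24 * w * n := by positivity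
  set Φ : (ℝ → ℝ) → ℝ → ℝ := fun ℓ x => log (3 / 2 * green (src n ℓ) x / seed x) with hΦ
  have hzero : ∀ x ∈ Ioo (0 : ℝ) 1, |Φ (fun _ => 0) x| ≤ 12 * w * n := by
    intro x hx
    have hx' : x ∈ Icc (0 : ℝ) 1 := ⟨hx.1.le, hx.2.le⟩
    have hs := src_isSource (R := 0) (ℓ := fun _ => 0) hn continuousOn_const (fun x _ => by simp)
    have hg := hs.green_sub (IsSource.const 1) hx'
    have hle : ∀ t ∈ Ioo (0 : ℝ) 1, |src n (fun _ => 0) t - 1| ≤ n * |logSeed t| := by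
      intro t ht
      have h1 : src n (fun _ => 0) t ≤ 1 := by simpa using src_le hn (R := 0) (ℓ := fun _ => 0) (by simp) ht
      have h2 := Real.add_one_le_exp (n * (logSeed t + 0))
      rw [abs_of_nonpos (by linarith), abs_of_neg (logSeed_neg ht)]
      rw [src]
      linarith
    have hb := (hs.sub (IsSource.const 1)).abs_green_le (hwI.const_mul n) hle hx'
    rw [hg] at hb
    have h1 := green_one hx'
    have h2 := le_seed hx'
    have hup : green (src n fun _ => 0) x ≤ green (fun _ => 1) x :=
      hs.green_le_of_le (IsSource.const 1) (fun t ht => by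
        simpa using src_le hn (R := 0) (ℓ := fun _ => 0) (by simp) ht) hx'
    have hsp := seed_pos hx
    -- The Green bound gives a deviation of at most (3/2)(1 - x)nw, and 1 - x ≤ 4 seed turns it into
    -- the relative deviation 6nw.
    have := abs_log_le_of_mem (a := 6 * n * w) (c := 3 / 2 * green (src n fun _ => 0) x / seed x)
      (by positivity) hnw ?_ ?_
    · refine this.trans (le_of_eq (by ring))
    · rw [le_div_iff₀ hsp]
      have := (abs_le.1 hb).1
      have hnw0 : 0 ≤ n * w := by positivity
      nlinarith
    · rw [div_le_one hsp]; linarith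
  have hcontr : ∀ f g, ContinuousOn f (Ioo 0 1) → (∀ x ∈ Ioo (0 : ℝ) 1, |f x| ≤ 24 * w * n) →
      ContinuousOn g (Ioo 0 1) → (∀ x ∈ Ioo (0 : ℝ) 1, |g x| ≤ 24 * w * n) → ∀ d,
      (∀ x ∈ Ioo (0 : ℝ) 1, |f x - g x| ≤ d) → ∀ x ∈ Ioo (0 : ℝ) 1, |Φ f x - Φ g x| ≤ n * d := by
    intro f g hf hfb hg hgb d hd x hx
    have h1 := abs_log_ratio_le hn hf hfb hg hgb hd hx
    have h2 := abs_log_ratio_le hn hg hgb hf hfb (fun x hx => by rw [abs_sub_comm]; exact hd x hx) hx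
    rw [abs_le]
    constructor <;> simp only [hΦ] <;> linarith
  obtain ⟨ℓ, hc, hb, hfix⟩ := exists_fixedPoint_of_contracting hR hn (by linarith : n < 1) (Ioo 0 1) Φ
    (fun f hf hfb => ⟨by
      have hs := src_isSource hn hf hfb
      refine ContinuousOn.log ((continuousOn_const.mul (hs.green_continuousOn.mono
        Ioo_subset_Icc_self)).div (by unfold seed; fun_prop) fun x hx => (seed_pos hx).ne')
        fun x hx => ?_
      have p1 := hs.green_pos (fun _ _ => src_pos _ _ _) ⟨hx.1.le, hx.2⟩
      have := seed_pos hx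
      positivity, fun x hx => by
      have h1 := hcontr f (fun _ => 0) hf hfb continuousOn_const (fun _ _ => by simpa using hR)
        (24 * w * n) (fun x hx => by simpa using hfb x hx) x hx
      have h2 := hzero x hx
      have h3 := abs_add_le (Φ f x - Φ (fun _ => 0) x) (Φ (fun _ => 0) x)
      rw [sub_add_cancel] at h3
      have : n * (24 * w * n) ≤ 12 * w * n := by
        have : 0 ≤ w * n := by positivity
        nlinarith
      linarith⟩) hcontr
  refine ⟨ℓ, hc, hb, fun x hx => ?_⟩
  have hs := src_isSource hn hc hb
  have p1 := hs.green_pos (fun _ _ => src_pos _ _ _) ⟨hx.1.le, hx.2⟩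
  have p2 := seed_pos hx
  rw [← hfix x hx, exp_log (by positivity)]
  field_simp

/-! ### From the profile to the second moment; the Pohozaev identity -/

/-- The profile with source `src n ℓ`. -/
noncomputable def prof (n : ℝ) (ℓ : ℝ → ℝ) (x : ℝ) : ℝ := 3 / 2 * green (src n ℓ) x

namespace IsProfile

variable {C n : ℝ} {ℓ : ℝ → ℝ}

theorem isSource (h : IsProfile C n ℓ) (hn : 0 ≤ n) : IsSource (src n ℓ) :=
  src_isSource hn h.cont h.bound

theorem prof_pos (h : IsProfile C n ℓ) (hn : 0 ≤ n) {x : ℝ} (hx : x ∈ Ico (0 : ℝ) 1) :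
    0 < prof n ℓ x :=
  mul_pos (by norm_num) ((h.isSource hn).green_pos (fun _ _ => src_pos _ _ _) hx)

theorem prof_eq (h : IsProfile C n ℓ) {x : ℝ} (hx : x ∈ Ioo (0 : ℝ) 1) :
    prof n ℓ x = exp (logSeed x + ℓ x) := by
  rw [prof, h.fixed x hx, exp_add, exp_logSeed hx]

theorem prof_rpow (h : IsProfile C n ℓ) {x : ℝ} (hx : x ∈ Ioo (0 : ℝ) 1) :
    prof n ℓ x ^ n = src n ℓ x := by
  rw [h.prof_eq hx, ← exp_mul, src, mul_comm]

theorem prof_one : prof n ℓ 1 = 0 := by simp [prof, green]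

theorem prof_continuousOn (h : IsProfile C n ℓ) (hn : 0 ≤ n) : ContinuousOn (prof n ℓ) (Icc 0 1) :=
  continuousOn_const.mul (h.isSource hn).green_continuousOn

theorem prof_hasDerivAt (h : IsProfile C n ℓ) (hn : 0 ≤ n) {x : ℝ} (hx : x ∈ Ioo (0 : ℝ) 1) :
    HasDerivAt (prof n ℓ) (-(3 / 2 * (massOf (src n ℓ) x / x ^ 2))) x :=
  (((h.isSource hn).green_hasDerivAt hx).const_mul (3 / 2)).congr_deriv (by ring)

theorem massOf_normalized (h : IsProfile C n ℓ) (hn : 0 ≤ n) {z : ℝ} (hz : z ∈ Icc (0 : ℝ) 1) :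
    (∫ t in (0 : ℝ)..z, t ^ 2 * (prof n ℓ t / prof n ℓ 0) ^ n)
      = massOf (src n ℓ) z / prof n ℓ 0 ^ n := by
  have h0 := h.prof_pos hn ⟨le_rfl, zero_lt_one⟩
  have := massOf_congr (h := fun t => (prof n ℓ t / prof n ℓ 0) ^ n)
    (g := fun t => (prof n ℓ 0 ^ n)⁻¹ * src n ℓ t) (fun x hx => by
      rw [Real.div_rpow (h.prof_pos hn ⟨hx.1.le, hx.2⟩).le h0.le, h.prof_rpow hx, div_eq_inv_mul]) hz
  rw [massOf_const_mul] at this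
  rw [div_eq_inv_mul, ← this, massOf]

/-- Dividing Y by Y(0) normalises the central value and leaves the eigenvalue (3/2) Y(0)^(n-1),
which a dilation by π then carries to [0, π]. -/
theorem isLaneEmden (h : IsProfile C n ℓ) (hn : 0 ≤ n) :
    IsLaneEmden n (3 / 2 * prof n ℓ 0 ^ (n - 1)) 1 (fun x => prof n ℓ x / prof n ℓ 0) := by
  have h0 := h.prof_pos hn ⟨le_rfl, zero_lt_one⟩
  refine ⟨by positivity, one_pos, (h.prof_continuousOn hn).div_const _, div_self h0.ne',
    fun z hz => div_pos (h.prof_pos hn hz) h0, by simp [prof_one], fun z hz => ?_⟩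
  refine ((h.prof_hasDerivAt hn hz).div_const (prof n ℓ 0)).congr_deriv ?_
  rw [h.massOf_normalized hn ⟨hz.1.le, hz.2.le⟩, rpow_sub_one h0.ne']
  have h1 := (rpow_pos_of_pos h0 n).ne'
  have h2 := hz.1.ne'
  have h3 := h0.ne'
  field_simp

theorem isSecondMoment (h : IsProfile C n ℓ) (hn : 0 ≤ n) (hn1 : n < 1) :
    IsSecondMoment n (π ^ 3 * (massOf (src n ℓ) 1 / prof n ℓ 0 ^ n)) := by
  have hπ := pi_pos
  have h1 := (h.isLaneEmden hn).scale (c := 1 / π) (by positivity)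
  rw [one_div_one_div] at h1
  have hne : n - 1 ≠ 0 := by linarith
  -- Since n ≠ 1, every positive eigenvalue λ has the form S^(n-1), with S = λ^(1/(n-1)).
  have h2 := isSecondMoment_of_isLaneEmden h1 (rpow_pos_of_pos h1.lam_pos (1 / (n - 1))) (by
    rw [← rpow_mul h1.lam_pos.le, one_div_mul_cancel hne, rpow_one])
  have h3 := IsLaneEmden.moment_eq_of_scale (n := n) (b := 1) (c := 1 / π)
    (y := fun x => prof n ℓ x / prof n ℓ 0) (by positivity)
  rw [one_div_one_div] at h3
  rw [h3] at h2
  have h4 := h.massOf_normalized hn (z := 1) ⟨zero_le_one, le_rfl⟩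
  convert h2 using 1
  rw [← h4, one_div, inv_pow, div_inv_eq_mul, mul_comm]
  congr 2
  ext t; ring

/-- The Pohozaev identity. -/
theorem pohozaev (h : IsProfile C n ℓ) (hn : 0 ≤ n) (hn1' : n < 1) :
    HasInt (fun x => x ^ 2 * (src n ℓ x * prof n ℓ x)) 0 1
      (3 / 2 * ((n + 1) / (5 - n)) * massOf (src n ℓ) 1 ^ 2) := by
  have hs := h.isSource hn
  have hn1 : n + 1 ≠ 0 := by positivity
  have hI : IntervalIntegrable (fun x => x ^ 2 * (src n ℓ x * prof n ℓ x)) volume 0 1 := by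
    refine (hs.sq_mul.int.mul_continuousOn (g := prof n ℓ) (by
      rw [uIcc_of_le zero_le_one]; exact h.prof_continuousOn hn)).congr_ae
      (Eventually.of_forall fun x => by simp only; ring)
  -- Write M for the mass, f for the source and y for the profile. The weights 9/8, 3/2 and 3/4 are
  -- chosen so that the M²/x² terms cancel and the x M f terms cancel, leaving a multiple of x² f y.
  -- At x = 1 only 9/8 M(1)² survives, and at x = 0 nothing does.
  have hd : ∀ x ∈ Ioo (0 : ℝ) 1, HasDerivAt
      (fun x => 9 / 8 * (massOf (src n ℓ) x * (massOf (src n ℓ) x / x))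
        + 3 / 2 * (x ^ 3 * prof n ℓ x ^ (n + 1)) / (n + 1)
        - 3 / 4 * (prof n ℓ x * massOf (src n ℓ) x))
      (3 / 2 * (3 / (n + 1) - 1 / 2) * (x ^ 2 * (src n ℓ x * prof n ℓ x))) x := by
    intro x hx
    have hm := hs.mass_hasDerivAt hx
    have hy := h.prof_hasDerivAt hn hx
    have hyp := h.prof_pos hn ⟨hx.1.le, hx.2⟩
    have hp := hy.rpow_const (p := n + 1) (Or.inl hyp.ne')
    rw [add_sub_cancel_right, h.prof_rpow hx] at hp
    refine ((((hm.mul (hm.div (hasDerivAt_id x) hx.1.ne')).const_mul (9 / 8)).add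
      ((((hasDerivAt_pow 3 x).mul hp).const_mul (3 / 2)).div_const (n + 1))).sub
      ((hy.mul hm).const_mul (3 / 4))).congr_deriv ?_
    have e : prof n ℓ x ^ (n + 1) = src n ℓ x * prof n ℓ x := by
      rw [rpow_add hyp, rpow_one, h.prof_rpow hx]
    have hx0 := hx.1.ne'
    simp only [Pi.div_apply, id, e]
    field_simp
    push_cast
    ring
  have hcont : ContinuousOn (fun x => 9 / 8 * (massOf (src n ℓ) x * (massOf (src n ℓ) x / x))
        + 3 / 2 * (x ^ 3 * prof n ℓ x ^ (n + 1)) / (n + 1)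
        - 3 / 4 * (prof n ℓ x * massOf (src n ℓ) x)) (Icc 0 1) := by
    have c1 := hs.mass_continuousOn
    have c2 := hs.mass_div_continuousOn
    have c3 := h.prof_continuousOn hn
    have c4 : ContinuousOn (fun x => prof n ℓ x ^ (n + 1)) (Icc 0 1) :=
      c3.rpow_const fun x _ => Or.inr (by positivity)
    exact (((c1.mul c2).const_mul _).add ((((continuous_pow 3).continuousOn.mul c4).const_mul _
      ).div_const _)).sub ((c3.mul c1).const_mul _)
  have h1 := HasInt.of_hasDerivAt zero_le_one hcont hd (hI.const_mul _)
  have h5 : 5 - n ≠ 0 := by linarith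
  have h6 := h1.const_mul (2 / 3 * (2 * (n + 1) / (5 - n)))
  refine (h6.congr_val ?_).congr zero_le_one fun x _ => ?_
  · have h0 : massOf (src n ℓ) 0 = 0 := by simp [massOf]
    rw [prof_one, zero_rpow hn1, h0]
    field_simp
    ring
  · have : 3 / (n + 1) - 1 / 2 = (5 - n) / (2 * (n + 1)) := by field_simp; ring
    rw [this]
    field_simp

end IsProfile

/-! ### Closed form of the first-order correction -/

theorem logSeed_eq {x : ℝ} (hx : x ∈ Ioo (0 : ℝ) 1) :
    logSeed x = log ((1 + x) / 2) + log ((1 - x) / 2) := log_seed hx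

theorem hasDerivAt_seed (x : ℝ) : HasDerivAt seed (-(x / 2)) x := by
  have := (((hasDerivAt_pow 2 x).const_sub 1).div_const 4)
  refine this.congr_deriv ?_
  norm_num; ring

theorem hasDerivAt_log_half_add {x : ℝ} (hx : -1 < x) :
    HasDerivAt (fun x => log ((1 + x) / 2)) (1 / (1 + x)) x := by
  have h : 0 < (1 + x) / 2 := by linarith
  have := (((hasDerivAt_id x).const_add 1).div_const 2).log h.ne'
  refine this.congr_deriv ?_
  have : 1 + x ≠ 0 := by linarith
  simp only [id]
  field_simp

theorem hasDerivAt_log_half_sub {x : ℝ} (hx : x < 1) :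
    HasDerivAt (fun x => log ((1 - x) / 2)) (-(1 / (1 - x))) x := by
  have h : 0 < (1 - x) / 2 := by linarith
  have := (((hasDerivAt_id x).const_sub 1).div_const 2).log h.ne'
  refine this.congr_deriv ?_
  have : 1 - x ≠ 0 := by linarith
  simp only [id]
  field_simp

theorem hasDerivAt_corrNum {x : ℝ} (hx : x ∈ Ioo (-1 : ℝ) 1) :
    HasDerivAt corrNum (3 * seed x * (log ((1 + x) / 2) + log ((1 - x) / 2))
      + 7 / 12 + 3 / 4 * x ^ 2) x := by
  have hs : HasDerivAt (fun x : ℝ => (1 + x) / 2) (1 / 2) x :=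
    (((hasDerivAt_id x).const_add 1).div_const 2)
  have hs' : HasDerivAt (fun x : ℝ => (1 - x) / 2) (-1 / 2) x :=
    (((hasDerivAt_id x).const_sub 1).div_const 2)
  have h1 := ((((hs.pow 2).const_mul 3).sub ((hs.pow 3).const_mul 2)).mul
    (hasDerivAt_log_half_add hx.1)).sub
    ((((hs'.pow 2).const_mul 3).sub ((hs'.pow 3).const_mul 2)).mul (hasDerivAt_log_half_sub hx.2))
  have h2 := h1.sub (((hasDerivAt_id x).const_mul (5 / 3)).mul (hasDerivAt_seed x))
  refine h2.congr_deriv ?_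
  have e1 : 1 + x ≠ 0 := by linarith [hx.1]
  have e2 : 1 - x ≠ 0 := by linarith [hx.2]
  simp only [id, seed, Pi.sub_apply, Pi.pow_apply]
  field_simp
  push_cast
  ring

/-- The first-order correction to the index-zero profile. -/
noncomputable def corr (x : ℝ) : ℝ := 3 / 2 * green logSeed x

/-- For u = x * corr one has x² corr' = x u' - u, so the mass of `logSeed` is -(2/3)(x u' - u). The
proof checks this with u = `corrNum`, by differentiating. -/
theorem massOf_logSeed {x : ℝ} (hx : x ∈ Ioo (0 : ℝ) 1) :
    massOf logSeed x = -(2 / 3) * (x * (3 * seed x * logSeed x + 7 / 12 + 3 / 4 * x ^ 2)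
      - corrNum x) := by
  have hcn : ContinuousOn corrNum (Icc 0 x) := fun t ht =>
    (hasDerivAt_corrNum ⟨by linarith [ht.1], by linarith [ht.2, hx.2]⟩).continuousAt.continuousWithinAt
  have hpos : ∀ t ∈ Icc 0 x, seed t ≠ 0 := fun t ht => by
    have := le_seed ⟨ht.1, ht.2.trans hx.2.le⟩
    have : 0 < 1 - t := by linarith [ht.2, hx.2]
    linarith
  have hls : ContinuousOn logSeed (Icc 0 x) :=
    ContinuousOn.log (by unfold seed; fun_prop) hpos
  have hsc : ContinuousOn seed (Icc 0 x) := by unfold seed; fun_prop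
  have h1 := HasInt.of_hasDerivAt (f := fun t => t ^ 2 * logSeed t)
    (F := fun t => -(2 / 3) * (t * (3 * seed t * logSeed t + 7 / 12 + 3 / 4 * t ^ 2) - corrNum t))
    hx.1.le (by fun_prop) (fun t ht => by
      have ht' : t ∈ Ioo (0 : ℝ) 1 := ⟨ht.1, ht.2.trans hx.2⟩
      have hsp := (seed_pos ht').ne'
      have hl : HasDerivAt logSeed (-(t / 2) / seed t) t := (hasDerivAt_seed t).log hsp
      have h2 := (hasDerivAt_id t).mul ((((((hasDerivAt_seed t).const_mul 3).mul hl).add_const (7 / 12)).add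
        ((hasDerivAt_pow 2 t).const_mul (3 / 4))))
      refine ((h2.sub (hasDerivAt_corrNum ⟨by linarith [ht'.1], ht'.2⟩)).const_mul
        (-(2 / 3))).congr_deriv ?_
      rw [← logSeed_eq ht']
      simp only [id, Pi.mul_apply, Pi.add_apply]
      field_simp
      push_cast
      ring)
    (((continuous_pow 2).continuousOn.mul hls).intervalIntegrable_of_Icc hx.1.le)
  rw [massOf, h1.2]
  simp [corrNum]

/-- By `massOf_logSeed`, -(2/3) corrNum/t is an antiderivative of the slope on [x, 1], and `corrNum`
vanishes at 1. -/
theorem mul_corr {x : ℝ} (hx : x ∈ Ioo (0 : ℝ) 1) : x * corr x = corrNum x := by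
  have hx0 := hx.1.ne'
  have hcn : ContinuousOn corrNum (Icc x 1) := by
    have h1 : ContinuousOn (fun t : ℝ => log ((1 + t) / 2)) (Icc x 1) :=
      ContinuousOn.log (by fun_prop) fun t ht => by linarith [ht.1, hx.1]
    have h2 : ContinuousOn (fun t : ℝ => (1 - t) / 2 * log ((1 - t) / 2)) (Icc x 1) :=
      (Real.continuous_mul_log.comp (g := fun s => s * log s) (f := fun t : ℝ => (1 - t) / 2)
        (by fun_prop)).continuousOn
    have h3 : ContinuousOn (fun t : ℝ => (3 * ((1 + t) / 2) ^ 2 - 2 * ((1 + t) / 2) ^ 3) * log ((1 + t) / 2)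
      - (3 * ((1 - t) / 2) - 2 * ((1 - t) / 2) ^ 2) * ((1 - t) / 2 * log ((1 - t) / 2))
      - 5 / 3 * t * seed t) (Icc x 1) := by
      unfold seed
      fun_prop
    refine h3.congr fun t _ => ?_
    rw [corrNum]; ring
  have h1 := HasInt.of_hasDerivAt (f := fun t => massOf logSeed t / t ^ 2)
    (F := fun t => -(2 / 3) * (corrNum t / t)) hx.2.le
    (continuousOn_const.mul (hcn.div continuousOn_id fun t ht => (hx.1.trans_le ht.1).ne'))
    (fun t ht => by
      have ht' : t ∈ Ioo (0 : ℝ) 1 := ⟨hx.1.trans ht.1, ht.2⟩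
      have ht0 := ht'.1.ne'
      refine (((hasDerivAt_corrNum ⟨by linarith [ht'.1], ht'.2⟩).div (hasDerivAt_id t) ht0).const_mul
        (-(2 / 3))).congr_deriv ?_
      rw [massOf_logSeed ht', ← logSeed_eq ht']
      simp only [id]
      field_simp)
    (logSeed_isSource.slope_integrable_right ⟨hx.1.le, hx.2.le⟩)
  rw [corr, logSeed_isSource.green_eq ⟨hx.1.le, hx.2.le⟩, h1.2]
  have : corrNum 1 = 0 := by simp [corrNum, seed]
  rw [this]
  field_simp
  ring

/-- The closed form is 0/0 at the origin, so the value is the limit of corrNum x / x, that is, the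
derivative of `corrNum` at 0. -/
theorem corr_zero : corr 0 = 7 / 12 - 3 / 2 * log 2 := by
  have h1 : HasDerivAt corrNum (7 / 12 - 3 / 2 * log 2) 0 := by
    refine (hasDerivAt_corrNum ⟨by norm_num, by norm_num⟩).congr_deriv ?_
    rw [seed, add_zero, sub_zero, one_div, Real.log_inv]
    ring
  have h2 : Tendsto corr (𝓝[>] 0) (𝓝 (7 / 12 - 3 / 2 * log 2)) := by
    have h3 := (hasDerivAt_iff_tendsto_slope.1 h1).mono_left
      (nhdsWithin_mono 0 (fun x (hx : x ∈ Ioi 0) => ne_of_gt hx))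
    refine h3.congr' ?_
    filter_upwards [Ioo_mem_nhdsGT (zero_lt_one' ℝ)] with x hx
    have hx0 := hx.1.ne'
    have : corrNum 0 = 0 := by simp [corrNum]
    rw [slope_def_field, this, sub_zero, sub_zero, ← mul_corr hx]
    field_simp
  have h4 : Tendsto corr (𝓝[>] 0) (𝓝 (corr 0)) := by
    have := (continuousOn_const.mul logSeed_isSource.green_continuousOn (f := fun _ => (3 / 2 : ℝ))) 0
      ⟨le_rfl, zero_le_one⟩
    exact this.tendsto.mono_left (nhdsWithin_le_of_mem (mem_of_superset
      (Ioo_mem_nhdsGT (zero_lt_one' ℝ)) Ioo_subset_Icc_self))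
  exact tendsto_nhds_unique h4 h2

/-! ### The second-order coefficient of the central value -/

namespace HasInt

theorem seed_mul_log_continuousOn (i : ℕ) :
    ContinuousOn (fun x => seed x * log (seed x) ^ (i + 1)) (Icc 0 1) :=
  (continuousOn_mul_log_pow i).comp (f := seed) (by unfold seed; fun_prop) fun x hx => by
    have := le_seed hx
    simp only [mem_Ici]
    linarith [hx.2]

theorem log_seed_zero : log (seed 0) = -2 * log 2 := by
  rw [seed, show ((1 : ℝ) - 0 ^ 2) / 4 = (2 ^ 2)⁻¹ by norm_num, Real.log_inv, Real.log_pow]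
  push_cast; ring

/-- The substitution s = seed x, with x dx = -2 ds, turns the integral into that of log s. -/
theorem mul_logSeed : HasInt (fun x => x * logSeed x) 0 1 (-log 2 - 1 / 2) := by
  have h1 := HasInt.of_hasDerivAt (f := fun x => x * logSeed x)
    (F := fun x => -2 * (seed x * log (seed x) ^ (0 + 1)) - x ^ 2 / 2) zero_le_one
    ((continuousOn_const.mul (seed_mul_log_continuousOn 0)).sub (by fun_prop))
    (fun x hx => by
      have hsp := (seed_pos hx).ne'
      have hl : HasDerivAt logSeed (-(x / 2) / seed x) x := (hasDerivAt_seed x).log hsp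
      have h2 := (((hasDerivAt_seed x).mul hl).const_mul (-2)).sub ((hasDerivAt_pow 2 x).div_const 2)
      simp only [zero_add, pow_one]
      refine h2.congr_deriv ?_
      field_simp
      push_cast
      ring) (logSeed_isSource.int.continuousOn_mul continuous_id.continuousOn)
  refine h1.congr_val ?_
  rw [log_seed_zero]
  simp [seed]
  ring

theorem logSeed_sq_isSource : IsSource fun x => logSeed x ^ 2 := by
  obtain ⟨K, -, hK⟩ := exists_pow_mul_exp_le_weight le_rfl 2
  refine IsSource.of_abs_le (logSeed_continuousOn.pow 2)
    (HasInt.of_integrable (weight_isSource.const_mul K).int) fun x hx => ?_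
  refine le_trans ?_ (hK x hx)
  rw [add_zero, abs_pow]
  exact le_mul_of_one_le_right (by positivity) (one_le_exp (by positivity))

theorem mul_logSeed_sq :
    HasInt (fun x => x * logSeed x ^ 2) 0 1 (2 * log 2 ^ 2 + 2 * log 2 + 1) := by
  have hI : IntervalIntegrable (fun x => x * logSeed x ^ 2) volume 0 1 :=
    logSeed_sq_isSource.int.continuousOn_mul continuous_id.continuousOn
  have h1 := HasInt.of_hasDerivAt (f := fun x => x * logSeed x ^ 2 + 2 * (x * logSeed x))
    (F := fun x => -2 * (seed x * log (seed x) ^ (1 + 1))) zero_le_one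
    ((continuousOn_const.mul (seed_mul_log_continuousOn 1)))
    (fun x hx => by
      have hsp := (seed_pos hx).ne'
      have hl : HasDerivAt logSeed (-(x / 2) / seed x) x := (hasDerivAt_seed x).log hsp
      have h2 := (((hasDerivAt_seed x).mul (hl.pow 2)).const_mul (-2))
      refine h2.congr_deriv ?_
      simp only [Pi.pow_apply]
      field_simp
      push_cast
      ring) (hI.add (mul_logSeed.1.const_mul 2))
  refine ((h1.sub (mul_logSeed.const_mul 2)).congr_val ?_).congr zero_le_one fun x _ => by ring
  rw [log_seed_zero]
  simp [seed]
  ring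

theorem sq_mul_logSeed_sq :
    HasInt (fun x => x ^ 2 * logSeed x ^ 2) 0 1 (104 / 27 - π ^ 2 / 9) := by
  have h := ((quartic_mul_log_sq (1 : ℝ) (-4) 4 0 0).add
    (quartic_mul_log_mul_log (1 : ℝ) (-4) 4 0 0)).symm_half
    (f := fun x => x ^ 2 * logSeed x ^ 2) (fun x hx => by
      have e1 : 1 - (1 + x) / 2 = (1 - x) / 2 := by ring
      have e2 : 1 - (1 - x) / 2 = (1 + x) / 2 := by ring
      rw [logSeed_eq hx, e1, e2]; ring)
  exact h.congr_val (by ring)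

theorem two_sub_sq_mul_logSeed :
    HasInt (fun x => (2 - x ^ 2) * logSeed x) 0 1 (-(28 / 9)) := by
  have hc1 : ContinuousOn (fun t : ℝ => log ((1 + t) / 2)) (Icc 0 1) :=
      ContinuousOn.log (by fun_prop) fun t ht => by linarith [ht.1]
  have hc2 : ContinuousOn (fun t : ℝ => (1 - t) / 2 * log ((1 - t) / 2)) (Icc 0 1) :=
      (Real.continuous_mul_log.comp (g := fun s => s * log s) (f := fun t : ℝ => (1 - t) / 2)
        (by fun_prop)).continuousOn
  have h1 := HasInt.of_hasDerivAt (f := fun x => (2 - x ^ 2) * logSeed x)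
    -- The integration constants ±5/3 make the coefficients of the two logarithms vanish at x = -1
    -- and x = 1 respectively. The remaining integrand is then a polynomial, and F is continuous at
    -- x = 1.
    (F := fun x => (2 * x - x ^ 3 / 3 + 5 / 3) * log ((1 + x) / 2)
      - 2 * (5 / 3 - x / 3 - x ^ 2 / 3) * ((1 - x) / 2 * log ((1 - x) / 2))
      - (10 / 3 * x - 2 / 9 * x ^ 3)) zero_le_one (by fun_prop)
    (fun x hx => by
      have e1 : 1 + x ≠ 0 := by linarith [hx.1]
      have e2 : 1 - x ≠ 0 := by linarith [hx.2]
      have p1 := ((((hasDerivAt_id x).const_mul 2).sub ((hasDerivAt_pow 3 x).div_const 3)).add_const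
        (5 / 3)).mul (hasDerivAt_log_half_add (by linarith [hx.1]))
      have p2 := ((((hasDerivAt_const x (5 / 3 : ℝ)).sub ((hasDerivAt_id x).div_const 3)).sub
        ((hasDerivAt_pow 2 x).div_const 3)).const_mul 2).mul
        ((((hasDerivAt_id x).const_sub 1).div_const 2).mul (hasDerivAt_log_half_sub hx.2))
      have p3 := ((hasDerivAt_id x).const_mul (10 / 3)).sub ((hasDerivAt_pow 3 x).const_mul (2 / 9))
      refine ((p1.sub p2).sub p3).congr_deriv ?_
      rw [logSeed_eq hx]
      simp only [id, Pi.sub_apply, Pi.mul_apply]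
      field_simp
      push_cast
      ring) (logSeed_isSource.int.continuousOn_mul (by fun_prop))
  refine h1.congr_val ?_
  norm_num
  ring

/-- A dilogarithm value at 1/2, from two linear equations. The sum of this integral and its mirror
image is -ζ(2), by reflection of log s / (1 - s); their difference is the boundary term of log
((1+x)/2) log ((1-x)/2). -/
theorem log_half_sub_div :
    HasInt (fun x => log ((1 - x) / 2) / (1 + x)) 0 1 (-(π ^ 2 / 12) - log 2 ^ 2 / 2) := by
  have hsum : HasInt (fun x => 2 * (log ((1 + x) / 2) / (1 - x) + log ((1 - x) / 2) / (1 + x))) 0 1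
      (2 * (-(π ^ 2 / 6))) := log_div_one_sub.symm_half fun x hx => by
    have e1 : 1 - (1 + x) / 2 = (1 - x) / 2 := by ring
    have e2 : 1 - (1 - x) / 2 = (1 + x) / 2 := by ring
    have h1 : 1 + x ≠ 0 := by linarith [hx.1]
    have h2 : 1 - x ≠ 0 := by linarith [hx.2]
    rw [e1, e2]
    field_simp
  -- Both summands have the same sign, so integrability of the sum passes to each.
  have hneg : ∀ x ∈ Ioo (0 : ℝ) 1, log ((1 + x) / 2) / (1 - x) ≤ 0 ∧ log ((1 - x) / 2) / (1 + x) ≤ 0 := by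
    intro x hx
    exact ⟨div_nonpos_of_nonpos_of_nonneg (Real.log_nonpos (by linarith [hx.1]) (by linarith [hx.2]))
      (by linarith [hx.2]), div_nonpos_of_nonpos_of_nonneg
      (Real.log_nonpos (by linarith [hx.2]) (by linarith [hx.1])) (by linarith [hx.1])⟩
  have i2 : IntervalIntegrable (fun x => log ((1 - x) / 2) / (1 + x)) volume 0 1 := by
    refine intervalIntegrable_of_abs_le zero_le_one ?_ (hsum.1.neg) fun x hx => ?_
    · exact (ContinuousOn.log (by fun_prop) fun x hx => by linarith [hx.2]).div (by fun_prop)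
        fun x hx => by linarith [hx.1]
    · have := hneg x hx
      simp only [Pi.neg_apply]
      rw [abs_of_nonpos this.2]
      linarith
  have h2 := of_integrable i2
  have h1 : HasInt (fun x => log ((1 + x) / 2) / (1 - x)) 0 1
      (-(π ^ 2 / 6) - ∫ x in (0 : ℝ)..1, log ((1 - x) / 2) / (1 + x)) :=
    (((hsum.const_mul (1 / 2)).sub h2).congr_val (by ring)).congr zero_le_one fun x _ => by ring
  have hcont : ContinuousOn (fun x : ℝ => log ((1 + x) / 2) * log ((1 - x) / 2)) (Icc 0 1) := by
    refine ((continuousOn_log_mul_log_one_sub 0).comp (f := fun x : ℝ => (1 + x) / 2) (by fun_prop)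
      fun x hx => ⟨by linarith [hx.1], by linarith [hx.2]⟩).congr fun x _ => ?_
    simp only [Function.comp_apply, zero_add, pow_one]
    congr 2; ring
  have h3 := of_hasDerivAt zero_le_one hcont (f := fun x => log ((1 - x) / 2) / (1 + x)
    - log ((1 + x) / 2) / (1 - x)) (fun x hx => by
      have e1 : 1 + x ≠ 0 := by linarith [hx.1]
      have e2 : 1 - x ≠ 0 := by linarith [hx.2]
      refine ((hasDerivAt_log_half_add (by linarith [hx.1])).mul
        (hasDerivAt_log_half_sub hx.2)).congr_deriv ?_
      field_simp
      ring) (i2.sub h1.1)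
  have h4 := h3.unique (h2.sub h1)
  refine h2.congr_val ?_
  have e : log (1 / 2) = -log 2 := by rw [one_div, Real.log_inv]
  simp only [sub_self, zero_div, Real.log_zero, mul_zero, add_zero, sub_zero, e] at h4
  linarith

/-- This is the kernel t - t² of the central value applied to the n² coefficient of the source. As x
(1-x) corr/seed = 4 corrNum / (x (1+x)) * x, the correction contributes 4 corrNum / (1+x), whose
pole part is the dilogarithm above. -/
theorem second_order_central :
    HasInt (fun x => (x - x ^ 2) * (logSeed x ^ 2 / 2 + corr x / seed x)) 0 1
      (7 / 18 * π ^ 2 + 3 * log 2 ^ 2 - 287 / 54) := by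
  have hI : IntervalIntegrable (fun x : ℝ => x - x ^ 2) volume 0 1 :=
    (Continuous.intervalIntegrable (by fun_prop) _ _)
  have hq : HasInt (fun x : ℝ => x - x ^ 2) 0 1 (1 / 6) :=
    ⟨hI, by rw [intervalIntegral.integral_sub (Continuous.intervalIntegrable (by fun_prop) _ _)
      (Continuous.intervalIntegrable (by fun_prop) _ _), integral_id, integral_pow]; norm_num⟩
  have h := ((((mul_logSeed_sq.const_mul (1 / 2)).sub (sq_mul_logSeed_sq.const_mul (1 / 2))).add
    (two_sub_sq_mul_logSeed.add mul_logSeed)).sub (log_half_sub_div.const_mul 4)).sub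
    (hq.const_mul (5 / 3))
  refine (h.congr_val (by ring)).congr zero_le_one fun x hx => ?_
  have e1 : 1 + x ≠ 0 := by linarith [hx.1]
  have e2 : 1 - x ≠ 0 := by linarith [hx.2]
  have e3 : x ≠ 0 := hx.1.ne'
  have e4 : corr x = corrNum x / x := by rw [← mul_corr hx]; field_simp
  have h3 : seed x = (1 + x) * (1 - x) / 4 := by rw [seed]; ring
  rw [e4, corrNum, h3, logSeed_eq hx]
  field_simp
  ring

end HasInt

/-! ### Taylor remainders -/

theorem abs_exp_sub_sum_le (u : ℝ) (k : ℕ) :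
    |exp u - ∑ m ∈ Finset.range k, u ^ m / m.factorial| ≤ |u| ^ k * exp |u| := by
  have h := Complex.norm_exp_sub_sum_le_norm_mul_exp u k
  rw [Complex.norm_real, Real.norm_eq_abs] at h
  rw [← Real.norm_eq_abs, ← Complex.norm_real]
  push_cast
  exact h

theorem abs_exp_sub_one_le' (u : ℝ) : |exp u - 1| ≤ |u| * exp |u| := by
  simpa using abs_exp_sub_sum_le u 1

theorem abs_exp_sub_linear_le (u : ℝ) : |exp u - (1 + u)| ≤ |u| ^ 2 * exp |u| := by
  simpa [Finset.sum_range_succ] using abs_exp_sub_sum_le u 2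

theorem abs_exp_sub_quadratic_le (u : ℝ) : |exp u - (1 + u + u ^ 2 / 2)| ≤ |u| ^ 3 * exp |u| := by
  simpa [Finset.sum_range_succ] using abs_exp_sub_sum_le u 3

theorem abs_exp_sub_cubic_le (u : ℝ) :
    |exp u - (1 + u + u ^ 2 / 2 + u ^ 3 / 6)| ≤ |u| ^ 4 * exp |u| := by
  simpa [Finset.sum_range_succ, Nat.factorial] using abs_exp_sub_sum_le u 4

theorem abs_log_one_add_sub_le {v : ℝ} (hv : |v| ≤ 1 / 2) :
    |log (1 + v) - (v - v ^ 2 / 2)| ≤ 2 * |v| ^ 3 := by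
  have h := Real.abs_log_sub_add_sum_range_le (x := -v) (by rw [abs_neg]; linarith) 2
  simp only [Finset.sum_range_succ, Finset.sum_range_zero, abs_neg, sub_neg_eq_add] at h
  have h2 : |v| ^ (2 + 1) / (1 - |v|) ≤ 2 * |v| ^ 3 := by
    rw [div_le_iff₀ (by linarith)]
    have := mul_nonneg (pow_nonneg (abs_nonneg v) 3) (by linarith : 0 ≤ 1 - 2 * |v|)
    norm_num
    linarith
  refine le_trans (le_of_eq ?_) (h.trans h2)
  congr 1; push_cast; ring

/-- Write the power as exp (n log (1 + v)). The exponential remainder costs n² v² and the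
logarithmic one n |v|³; both are O(n⁴) when v = O(n). -/
theorem abs_one_add_rpow_sub_le {n v : ℝ} (hn : 0 ≤ n) (hn1 : n ≤ 1) (hv : |v| ≤ 1 / 2) :
    |(1 + v) ^ n - (1 + n * (v - v ^ 2 / 2))| ≤ 12 * n ^ 2 * v ^ 2 + 2 * n * |v| ^ 3 := by
  have hv1 : 0 < 1 + v := by linarith [(abs_le.1 hv).1]
  have h1 := abs_log_one_add_sub_le hv
  have hlog : |log (1 + v)| ≤ 2 * |v| := by
    have e1 : |v - v ^ 2 / 2| ≤ |v| + |v| ^ 2 / 2 := by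
      have := abs_sub v (v ^ 2 / 2)
      rwa [abs_div, abs_pow, abs_two] at this
    have e2 := abs_add_le (log (1 + v) - (v - v ^ 2 / 2)) (v - v ^ 2 / 2)
    rw [sub_add_cancel] at e2
    have e3 : |v| ^ 2 ≤ |v| / 2 := by nlinarith [abs_nonneg v]
    have e4 : |v| ^ 3 ≤ |v| / 4 := by
      have : |v| ^ 3 = |v| * |v| ^ 2 := by ring
      nlinarith [abs_nonneg v]
    linarith [abs_nonneg v]
  have hy : |n * log (1 + v)| ≤ n * (2 * |v|) := by
    rw [abs_mul, abs_of_nonneg hn]; exact mul_le_mul_of_nonneg_left hlog hn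
  have hy1 : |n * log (1 + v)| ≤ 1 := by nlinarith [abs_nonneg v]
  have h2 := abs_exp_sub_linear_le (n * log (1 + v))
  have h3 : exp |n * log (1 + v)| ≤ 3 :=
    (exp_le_exp.2 hy1).trans (by linarith [Real.exp_one_lt_d9])
  have h4 : |n * log (1 + v)| ^ 2 * exp |n * log (1 + v)| ≤ (n * (2 * |v|)) ^ 2 * 3 :=
    mul_le_mul (pow_le_pow_left₀ (abs_nonneg _) hy 2) h3 (exp_pos _).le (sq_nonneg _)
  rw [rpow_def_of_pos hv1, mul_comm (log (1 + v)) n]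
  have h5 : |n * (log (1 + v) - (v - v ^ 2 / 2))| ≤ n * (2 * |v| ^ 3) := by
    rw [abs_mul, abs_of_nonneg hn]; exact mul_le_mul_of_nonneg_left h1 hn
  have h6 := abs_add_le (exp (n * log (1 + v)) - (1 + n * log (1 + v)))
    (n * (log (1 + v) - (v - v ^ 2 / 2)))
  have e : exp (n * log (1 + v)) - (1 + n * (v - v ^ 2 / 2))
      = exp (n * log (1 + v)) - (1 + n * log (1 + v)) + n * (log (1 + v) - (v - v ^ 2 / 2)) := by ring
  rw [e]
  have h7 : (n * (2 * |v|)) ^ 2 * 3 = 12 * n ^ 2 * v ^ 2 := by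
    rw [mul_pow, mul_pow, sq_abs]; ring
  linarith

/-- Bernoulli's inequality from both sides: the lower bound at exponent n + 1, and the upper bound
(1 + nv)(1 + v) from exponent n ≤ 1. -/
theorem abs_one_add_rpow_sub_linear_le {n v : ℝ} (hn : 0 ≤ n) (hn1 : n ≤ 1) (hv : -1 ≤ v) :
    |(1 + v) ^ (n + 1) - (1 + (n + 1) * v)| ≤ n * v ^ 2 := by
  have h1 := one_add_mul_self_le_rpow_one_add hv (p := n + 1) (by linarith)
  have h2 := rpow_one_add_le_one_add_mul_self hv hn hn1
  have hv1 : 0 ≤ 1 + v := by linarith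
  have h3 : (1 + v) ^ (n + 1) = (1 + v) ^ n * (1 + v) := rpow_add_one' hv1 (by linarith)
  rw [abs_of_nonneg (by linarith), h3]
  nlinarith

/-- The linearised logarithm of the profile. -/
noncomputable def logCorr (x : ℝ) : ℝ := corr x / seed x

/-- Both `corr` and `seed` vanish linearly at x = 1, so their quotient is bounded. -/
theorem exists_corr_bound : ∃ K, 0 ≤ K ∧ (∀ x ∈ Icc (0 : ℝ) 1, |corr x| ≤ K * (1 - x)) ∧
    ∀ x ∈ Ioo (0 : ℝ) 1, |logCorr x| ≤ K := by
  set w := ∫ x in (0 : ℝ)..1, |logSeed x| with hw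
  have hw0 : 0 ≤ w := intervalIntegral.integral_nonneg zero_le_one fun _ _ => abs_nonneg _
  have h1 : ∀ x ∈ Icc (0 : ℝ) 1, |corr x| ≤ 3 / 2 * w * (1 - x) := fun x hx => by
    have := logSeed_isSource.abs_green_le (HasInt.of_integrable logSeed_isSource.int.abs)
      (fun _ _ => le_rfl) hx
    rw [corr, abs_mul, abs_of_pos (by norm_num : (0 : ℝ) < 3 / 2)]
    linarith
  refine ⟨6 * w, by positivity, fun x hx => (h1 x hx).trans ?_, fun x hx => ?_⟩
  · have : 0 ≤ w * (1 - x) := mul_nonneg hw0 (sub_nonneg.2 hx.2)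
    linarith
  · have hp := seed_pos hx
    have h2 := h1 x ⟨hx.1.le, hx.2.le⟩
    have h3 := le_seed ⟨hx.1.le, hx.2.le⟩
    rw [logCorr, abs_div, abs_of_pos hp, div_le_iff₀ hp]
    nlinarith

theorem seed_mul_logCorr {x : ℝ} (hx : x ∈ Ioo (0 : ℝ) 1) : seed x * logCorr x = corr x := by
  have := (seed_pos hx).ne'
  rw [logCorr]; field_simp

theorem linear_isSource (n : ℝ) : IsSource fun x => 1 + n * logSeed x :=
  (IsSource.const 1).add (logSeed_isSource.const_mul n)

theorem green_linear {n x : ℝ} (hx : x ∈ Icc (0 : ℝ) 1) :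
    3 / 2 * green (fun x => 1 + n * logSeed x) x = seed x + n * corr x := by
  rw [(IsSource.const 1).green_add (logSeed_isSource.const_mul n) hx, green_const_mul, mul_add,
    green_one hx, corr]
  ring

/-! ### Expansion of the profile in n -/

namespace IsProfile

variable {C : ℝ}

theorem abs_mul_add_le {n : ℝ} {ℓ : ℝ → ℝ} (hC : 0 ≤ C) (hn : 0 ≤ n) (hn4 : n ≤ 1 / 4)
    (h : IsProfile C n ℓ) {x : ℝ} (hx : x ∈ Ioo (0 : ℝ) 1) :
    |n * (logSeed x + ℓ x)| ≤ n * (|logSeed x| + C) ∧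
      |n * (logSeed x + ℓ x)| ≤ (|logSeed x| + C) / 4 := by
  have h1 : |logSeed x + ℓ x| ≤ |logSeed x| + C := by
    have := h.bound x hx
    have h2 := abs_add_le (logSeed x) (ℓ x)
    nlinarith
  have h3 : 0 ≤ |logSeed x| + C := by positivity
  rw [abs_mul, abs_of_nonneg hn]
  constructor <;> nlinarith [abs_nonneg (logSeed x + ℓ x)]

theorem exp_remainder_le {n : ℝ} {ℓ : ℝ → ℝ} (hC : 0 ≤ C) (hn : 0 ≤ n) (hn4 : n ≤ 1 / 4)
    (h : IsProfile C n ℓ) {x : ℝ} (hx : x ∈ Ioo (0 : ℝ) 1) (k : ℕ) :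
    |n * (logSeed x + ℓ x)| ^ k * exp |n * (logSeed x + ℓ x)|
      ≤ n ^ k * ((|logSeed x| + C) ^ k * exp ((|logSeed x| + C) / 4)) := by
  obtain ⟨h1, h2⟩ := h.abs_mul_add_le hC hn hn4 hx
  rw [← mul_assoc, ← mul_pow]
  exact mul_le_mul (pow_le_pow_left₀ (abs_nonneg _) h1 k) (exp_le_exp.2 h2) (exp_pos _).le
    (by positivity)

/-- Start of a bootstrap. The a priori bound |ℓ| ≤ Cn gives the source up to O(n²); the Green
operator carries this to the profile, division by `seed` carries it to ℓ, and the improved ℓ gives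
the source up to O(n³). -/
theorem exists_src_sub_linear (hC : 0 ≤ C) : ∃ K, 0 ≤ K ∧ ∀ n, 0 ≤ n → n ≤ 1 / 4 → ∀ ℓ,
    IsProfile C n ℓ → ∀ x ∈ Ioo (0 : ℝ) 1,
      |src n ℓ x - (1 + n * logSeed x)| ≤ n ^ 2 * (K * weight x) := by
  obtain ⟨K, hK0, hK⟩ := exists_pow_mul_exp_le_weight hC 2
  refine ⟨K + C, by positivity, fun n hn hn4 ℓ h x hx => ?_⟩
  have h1 := (abs_exp_sub_linear_le (n * (logSeed x + ℓ x))).trans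
    (h.exp_remainder_le hC hn hn4 hx 2)
  have h2 := mul_le_mul_of_nonneg_left (hK x hx) (sq_nonneg n)
  have h3 : |n * ℓ x| ≤ n ^ 2 * (C * weight x) := by
    rw [abs_mul, abs_of_nonneg hn]
    have := h.bound x hx
    have hw := one_le_weight hx
    have : n * |ℓ x| ≤ n * (C * n) := mul_le_mul_of_nonneg_left this hn
    have : 0 ≤ n ^ 2 * C := by positivity
    nlinarith
  have e : src n ℓ x - (1 + n * logSeed x)
      = exp (n * (logSeed x + ℓ x)) - (1 + n * (logSeed x + ℓ x)) + n * ℓ x := by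
    rw [src]; ring
  rw [e]
  refine (abs_add_le _ _).trans ?_
  linarith

theorem exists_prof_sub (hC : 0 ≤ C) : ∃ K, 0 ≤ K ∧ ∀ n, 0 ≤ n → n ≤ 1 / 4 → ∀ ℓ,
    IsProfile C n ℓ → ∀ x ∈ Icc (0 : ℝ) 1,
      |prof n ℓ x - (seed x + n * corr x)| ≤ K * n ^ 2 * (1 - x) := by
  obtain ⟨K, hK0, hK⟩ := exists_src_sub_linear hC
  set w := ∫ x in (0 : ℝ)..1, weight x with hw
  have hwI : HasInt weight 0 1 w := HasInt.of_integrable weight_isSource.int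
  have hw0 : 0 ≤ w := intervalIntegral.integral_nonneg zero_le_one fun x _ => (weight_pos x).le
  refine ⟨3 / 2 * (K * w), by positivity, fun n hn hn4 ℓ h x hx => ?_⟩
  have hs := h.isSource hn
  have h1 := (hs.sub (linear_isSource n)).abs_green_le ((hwI.const_mul K).const_mul (n ^ 2))
    (hK n hn hn4 ℓ h) hx
  rw [hs.green_sub (linear_isSource n) hx] at h1
  have e : prof n ℓ x - (seed x + n * corr x)
      = 3 / 2 * (green (src n ℓ) x - green (fun x => 1 + n * logSeed x) x) := by
    rw [mul_sub, green_linear hx, prof]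
  rw [e, abs_mul, abs_of_pos (by norm_num : (0 : ℝ) < 3 / 2)]
  linarith

theorem exists_log_sub (hC : 0 ≤ C) : ∃ K, 0 ≤ K ∧ ∀ n, 0 ≤ n → n ≤ 1 / 4 → ∀ ℓ,
    IsProfile C n ℓ → ∀ x ∈ Ioo (0 : ℝ) 1, |ℓ x - n * logCorr x| ≤ K * n ^ 2 := by
  obtain ⟨K, hK0, hK⟩ := exists_prof_sub hC
  refine ⟨4 * K + C ^ 2 * exp C, by positivity, fun n hn hn4 ℓ h x hx => ?_⟩
  have hx' : x ∈ Icc (0 : ℝ) 1 := ⟨hx.1.le, hx.2.le⟩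
  have hp := seed_pos hx
  have h1 := hK n hn hn4 ℓ h x hx'
  have e1 : prof n ℓ x - (seed x + n * corr x) = seed x * (exp (ℓ x) - (1 + n * logCorr x)) := by
    rw [h.prof_eq hx, exp_add, exp_logSeed hx, ← seed_mul_logCorr hx]; ring
  rw [e1, abs_mul, abs_of_pos hp] at h1
  have h2 : |exp (ℓ x) - (1 + n * logCorr x)| ≤ 4 * K * n ^ 2 := by
    have h3 := le_seed hx'
    have h4 : K * n ^ 2 * (1 - x) ≤ K * n ^ 2 * (4 * seed x) :=
      mul_le_mul_of_nonneg_left (by linarith) (by positivity)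
    have h5 : seed x * |exp (ℓ x) - (1 + n * logCorr x)| ≤ seed x * (4 * K * n ^ 2) := by
      linarith
    exact le_of_mul_le_mul_left h5 hp
  have hb := h.bound x hx
  have hbC : |ℓ x| ≤ C := hb.trans (by nlinarith)
  have h6 : |exp (ℓ x) - (1 + ℓ x)| ≤ C ^ 2 * exp C * n ^ 2 :=
    (abs_exp_sub_linear_le (ℓ x)).trans (by
      calc |ℓ x| ^ 2 * exp |ℓ x| ≤ (C * n) ^ 2 * exp C :=
            mul_le_mul (pow_le_pow_left₀ (abs_nonneg _) hb 2) (exp_le_exp.2 hbC) (exp_pos _).le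
              (by positivity)
        _ = _ := by ring)
  have e2 : ℓ x - n * logCorr x
      = (exp (ℓ x) - (1 + n * logCorr x)) - (exp (ℓ x) - (1 + ℓ x)) := by ring
  rw [e2]
  refine (abs_sub _ _).trans ?_
  linarith

/-- The second-order coefficient combines the square of the leading logarithm with n times the
first-order part of ℓ, now known from `exists_log_sub`. -/
theorem exists_src_sub_quadratic (hC : 0 ≤ C) : ∃ K, 0 ≤ K ∧ ∀ n, 0 ≤ n → n ≤ 1 / 4 → ∀ ℓ,
    IsProfile C n ℓ → ∀ x ∈ Ioo (0 : ℝ) 1,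
      |src n ℓ x - (1 + n * logSeed x + n ^ 2 * (logSeed x ^ 2 / 2 + logCorr x))|
        ≤ n ^ 3 * (K * weight x) := by
  obtain ⟨K, hK0, hK⟩ := exists_pow_mul_exp_le_weight hC 3
  obtain ⟨K₁, hK₁0, hK₁⟩ := exists_log_sub hC
  obtain ⟨K₂, hK₂0, hK₂⟩ := exists_pow_mul_exp_le_weight hC 1
  refine ⟨K + K₁ + C * K₂, by positivity, fun n hn hn4 ℓ h x hx => ?_⟩
  have h1 := (abs_exp_sub_quadratic_le (n * (logSeed x + ℓ x))).trans
    (h.exp_remainder_le hC hn hn4 hx 3)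
  have h2 := mul_le_mul_of_nonneg_left (hK x hx) (pow_nonneg hn 3)
  have h3 : |n * (ℓ x - n * logCorr x)| ≤ n ^ 3 * (K₁ * weight x) := by
    rw [abs_mul, abs_of_nonneg hn]
    have hw := one_le_weight hx
    have := mul_le_mul_of_nonneg_left (hK₁ n hn hn4 ℓ h x hx) hn
    have : 0 ≤ n ^ 3 * K₁ := by positivity
    nlinarith
  have h4 : |n ^ 2 * (ℓ x * (logSeed x + ℓ x / 2))| ≤ n ^ 3 * (C * K₂ * weight x) := by
    have hb := h.bound x hx
    have hb2 : |logSeed x + ℓ x / 2| ≤ |logSeed x| + C := by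
      have h2 := abs_add_le (logSeed x) (ℓ x / 2)
      rw [abs_div, abs_two] at h2
      nlinarith [abs_nonneg (ℓ x)]
    have h5 : |logSeed x| + C ≤ K₂ * weight x := by
      refine le_trans ?_ (hK₂ x hx)
      rw [pow_one]
      exact le_mul_of_one_le_right (by positivity) (one_le_exp (by positivity))
    rw [abs_mul, abs_mul, abs_of_nonneg (sq_nonneg n)]
    calc n ^ 2 * (|ℓ x| * |logSeed x + ℓ x / 2|) ≤ n ^ 2 * ((C * n) * (K₂ * weight x)) :=
          mul_le_mul_of_nonneg_left (mul_le_mul hb (hb2.trans h5) (abs_nonneg _) (by positivity))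
            (sq_nonneg n)
      _ = _ := by ring
  have e : src n ℓ x - (1 + n * logSeed x + n ^ 2 * (logSeed x ^ 2 / 2 + logCorr x))
      = exp (n * (logSeed x + ℓ x)) - (1 + n * (logSeed x + ℓ x) + (n * (logSeed x + ℓ x)) ^ 2 / 2)
        + n * (ℓ x - n * logCorr x) + n ^ 2 * (ℓ x * (logSeed x + ℓ x / 2)) := by
    rw [src]; ring
  rw [e]
  refine (abs_add_le _ _).trans ((add_le_add_left (abs_add_le _ _) _).trans ?_)
  linarith

theorem exists_central_sub (hC : 0 ≤ C) : ∃ K, 0 ≤ K ∧ ∀ n, 0 ≤ n → n ≤ 1 / 4 → ∀ ℓ,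
    IsProfile C n ℓ →
      |prof n ℓ 0 - (1 / 4 + (7 / 12 - 3 / 2 * log 2) * n
        + (7 / 12 * π ^ 2 + 9 / 2 * log 2 ^ 2 - 287 / 36) * n ^ 2)| ≤ K * n ^ 3 := by
  obtain ⟨K, hK0, hK⟩ := exists_src_sub_quadratic hC
  set w := ∫ x in (0 : ℝ)..1, weight x with hw
  have hwI : HasInt weight 0 1 w := HasInt.of_integrable weight_isSource.int
  have hw0 : 0 ≤ w := intervalIntegral.integral_nonneg zero_le_one fun x _ => (weight_pos x).le
  refine ⟨3 / 2 * (K * w), by positivity, fun n hn hn4 ℓ h => ?_⟩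
  have h1 := (h.isSource hn).green_zero
  have h2 := (linear_isSource n).green_zero
  have h3 := HasInt.second_order_central
  have h4 := (h1.sub h2).sub (h3.const_mul (n ^ 2))
  have h5 := h4.abs_val_le ((hwI.const_mul K).const_mul (n ^ 3)) zero_le_one fun x hx => by
    have e : (x - x ^ 2) * src n ℓ x - (x - x ^ 2) * (1 + n * logSeed x)
        - n ^ 2 * ((x - x ^ 2) * (logSeed x ^ 2 / 2 + corr x / seed x))
        = (x - x ^ 2) * (src n ℓ x - (1 + n * logSeed x
          + n ^ 2 * (logSeed x ^ 2 / 2 + logCorr x))) := by rw [logCorr]; ring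
    rw [e, abs_mul]
    have h6 : |x - x ^ 2| ≤ 1 := by
      rw [abs_le]; constructor <;> nlinarith [hx.1, hx.2]
    exact (mul_le_of_le_one_left (abs_nonneg _) h6).trans (hK n hn hn4 ℓ h x hx)
  have h7 := green_linear (n := n) (x := 0) ⟨le_rfl, zero_le_one⟩
  rw [corr_zero, seed] at h7
  have e : prof n ℓ 0 - (1 / 4 + (7 / 12 - 3 / 2 * log 2) * n
        + (7 / 12 * π ^ 2 + 9 / 2 * log 2 ^ 2 - 287 / 36) * n ^ 2)
      = 3 / 2 * (green (src n ℓ) 0 - green (fun x => 1 + n * logSeed x) 0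
        - n ^ 2 * (7 / 18 * π ^ 2 + 3 * log 2 ^ 2 - 287 / 54)) := by
    rw [prof]; linarith
  rw [e, abs_mul, abs_of_pos (by norm_num : (0 : ℝ) < 3 / 2)]
  linarith

end IsProfile

/-! ### The energy to third order -/

/-- The expansion of `(seed + n * corr) ^ (n + 1)` to third order in `n`. -/
noncomputable def powTrunc (n x : ℝ) : ℝ :=
  seed x + n * (seed x * logSeed x + corr x)
    + n ^ 2 * (corr x + seed x * logSeed x ^ 2 / 2 + logSeed x * corr x)
    + n ^ 3 * (seed x * logSeed x ^ 3 / 6 + logSeed x ^ 2 * corr x / 2 + logSeed x * corr x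
      + corr x ^ 2 / (2 * seed x))

/-- The cubic Taylor polynomial of the energy. -/
noncomputable def energyPoly (n : ℝ) : ℝ :=
  1 / 60 - 77 / 900 * n + (1199 / 2250 - 7 / 180 * π ^ 2) * n ^ 2
    + (-(1344043 / 202500) + 49 / 15 * zetaThree + 719 / 2700 * π ^ 2) * n ^ 3

theorem hasInt_energyPoly (n : ℝ) :
    HasInt (fun x => x ^ 2 * (powTrunc n x
      - (n + 1) / 2 * ((1 + n * logSeed x) * (seed x + n * corr x)))) 0 1 (energyPoly n) := by
  have h0 := HasInt.sq_mul_seed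
  have h1 := HasInt.sq_mul_seed_mul_log
  have h2 := HasInt.mul_corrNum
  have h3 := HasInt.sq_mul_seed_mul_log_sq
  have h4 := HasInt.sq_mul_seed_mul_log_cube
  have h5 := HasInt.mul_corrNum_mul_log
  have h6 := HasInt.mul_corrNum_mul_log_sq
  have h7 := HasInt.corrNum_sq_div
  have hT := ((h0.add ((h1.add h2).const_mul n)).add
    (((h2.add (h3.const_mul (1 / 2))).add h5).const_mul (n ^ 2))).add
    (((((h4.const_mul (1 / 6)).add (h6.const_mul (1 / 2))).add h5).add
      (h7.const_mul (1 / 2))).const_mul (n ^ 3))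
  have hG := ((h0.add ((h1.add h2).const_mul n)).add (h5.const_mul (n ^ 2))).const_mul ((n + 1) / 2)
  refine ((hT.sub hG).congr_val ?_).congr zero_le_one fun x hx => ?_
  · rw [energyPoly]; ring
  · have hs := (seed_pos hx).ne'
    rw [powTrunc, ← mul_corr hx]
    simp only [logSeed]
    field_simp
    ring

/-- The product of the two truncations has only monomials of order n⁴ to n⁶ beyond the cubic part,
each with at most five factors L and c. -/
theorem abs_trunc_mul_trunc_sub_le {n L c W : ℝ} (hn : 0 ≤ n) (hn1 : n ≤ 1) (hW1 : 1 ≤ W)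
    (hLW : |L| ≤ W) (hcW : |c| ≤ W) :
    |(1 + n * L + (n * L) ^ 2 / 2 + (n * L) ^ 3 / 6) * (1 + n * c + n ^ 2 * c + n ^ 3 * c ^ 2 / 2)
      - (1 + n * (L + c) + n ^ 2 * (c + L ^ 2 / 2 + L * c)
        + n ^ 3 * (L ^ 3 / 6 + L ^ 2 * c / 2 + L * c + c ^ 2 / 2))| ≤ n ^ 4 * (2 * W ^ 5) := by
  have mono : ∀ i j : ℕ, i + j ≤ 5 → |L ^ i * c ^ j| ≤ W ^ 5 := fun i j hij => by
    rw [abs_mul, abs_pow, abs_pow]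
    calc |L| ^ i * |c| ^ j ≤ W ^ i * W ^ j := by gcongr
      _ = W ^ (i + j) := by rw [pow_add]
      _ ≤ W ^ 5 := pow_le_pow_right₀ hW1 hij
  have m12 := mono 1 2 (by norm_num)
  have m21 := mono 2 1 (by norm_num)
  have m31 := mono 3 1 (by norm_num)
  have m22 := mono 2 2 (by norm_num)
  have m32 := mono 3 2 (by norm_num)
  have e : (1 + n * L + (n * L) ^ 2 / 2 + (n * L) ^ 3 / 6)
        * (1 + n * c + n ^ 2 * c + n ^ 3 * c ^ 2 / 2)
      - (1 + n * (L + c) + n ^ 2 * (c + L ^ 2 / 2 + L * c)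
        + n ^ 3 * (L ^ 3 / 6 + L ^ 2 * c / 2 + L * c + c ^ 2 / 2))
      = n ^ 4 * ((L ^ 1 * c ^ 2 / 2 + L ^ 2 * c ^ 1 / 2 + L ^ 3 * c ^ 1 / 6)
        + n * (L ^ 2 * c ^ 2 / 4 + L ^ 3 * c ^ 1 / 6) + n ^ 2 * (L ^ 3 * c ^ 2 / 12)) := by
    ring
  rw [e, abs_mul, abs_of_nonneg (pow_nonneg hn 4)]
  refine mul_le_mul_of_nonneg_left ?_ (pow_nonneg hn 4)
  have hn2 : n ^ 2 ≤ 1 := pow_le_one₀ hn hn1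
  have hn20 := sq_nonneg n
  have a1 : |n * (L ^ 2 * c ^ 2 / 4 + L ^ 3 * c ^ 1 / 6)| ≤ W ^ 5 / 2 := by
    rw [abs_mul, abs_of_nonneg hn]
    have : |L ^ 2 * c ^ 2 / 4 + L ^ 3 * c ^ 1 / 6| ≤ W ^ 5 / 2 := by
      rw [abs_le] at m22 m31 ⊢; constructor <;> linarith [m22.1, m22.2, m31.1, m31.2]
    exact (mul_le_of_le_one_left (abs_nonneg _) hn1).trans this
  have a2 : |n ^ 2 * (L ^ 3 * c ^ 2 / 12)| ≤ W ^ 5 / 12 := by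
    rw [abs_mul, abs_of_nonneg hn20]
    have : |L ^ 3 * c ^ 2 / 12| ≤ W ^ 5 / 12 := by
      rw [abs_le] at m32 ⊢; constructor <;> linarith [m32.1, m32.2]
    exact (mul_le_of_le_one_left (abs_nonneg _) hn2).trans this
  have a3 : |L ^ 1 * c ^ 2 / 2 + L ^ 2 * c ^ 1 / 2 + L ^ 3 * c ^ 1 / 6| ≤ 7 / 6 * W ^ 5 := by
    rw [abs_le] at m12 m21 m31 ⊢
    constructor <;> linarith [m12.1, m12.2, m21.1, m21.2, m31.1, m31.2]
  have a4 := abs_add_le (L ^ 1 * c ^ 2 / 2 + L ^ 2 * c ^ 1 / 2 + L ^ 3 * c ^ 1 / 6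
    + n * (L ^ 2 * c ^ 2 / 4 + L ^ 3 * c ^ 1 / 6)) (n ^ 2 * (L ^ 3 * c ^ 2 / 12))
  have a5 := abs_add_le (L ^ 1 * c ^ 2 / 2 + L ^ 2 * c ^ 1 / 2 + L ^ 3 * c ^ 1 / 6)
    (n * (L ^ 2 * c ^ 2 / 4 + L ^ 3 * c ^ 1 / 6))
  have : 0 ≤ W ^ 5 := by positivity
  linarith

-- The power factors as seed * exp (nL) * (1 + nc)^(n+1), with L = `logSeed` and c = `logCorr`. Only
-- L is unbounded, and its powers are controlled by the weight, so each factor can be truncated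
-- separately.
set_option maxHeartbeats 1000000 in
theorem exists_powTrunc_bound : ∃ K, 0 ≤ K ∧ ∃ n₁ > 0, ∀ n, 0 ≤ n → n ≤ n₁ →
    ∀ x ∈ Ioo (0 : ℝ) 1,
      |(seed x + n * corr x) ^ (n + 1) - powTrunc n x| ≤ n ^ 4 * (K * weight x) := by
  obtain ⟨B, hB0, -, hB⟩ := exists_corr_bound
  obtain ⟨K₄, hK₄0, hK₄⟩ := exists_pow_mul_exp_le_weight (le_refl (0 : ℝ)) 4
  obtain ⟨K₅, hK₅0, hK₅⟩ := exists_pow_mul_exp_le_weight (C := B + 1) (by positivity) 5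
  refine ⟨K₄ * (1 + 2 * B + B ^ 2) + ((1 + B) * (12 * B ^ 2 + 2 * B ^ 3) + B ^ 3) + 2 * K₅,
    by positivity, min (1 / 4) (1 / (2 * (B + 1))), by positivity, fun n hn hn' x hx => ?_⟩
  have hn4 : n ≤ 1 / 4 := hn'.trans (min_le_left _ _)
  have hn1 : n ≤ 1 := by linarith
  have hnB : n * B ≤ 1 / 2 := by
    have := hn'.trans (min_le_right _ _)
    rw [le_div_iff₀ (by positivity)] at this
    nlinarith
  set L := logSeed x with hL
  set c := logCorr x with hc
  have hL0 : L < 0 := logSeed_neg hx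
  have hcB : |c| ≤ B := hB x hx
  have hs := seed_pos hx
  have hw := one_le_weight hx
  have hv : |n * c| ≤ 1 / 2 := by
    rw [abs_mul, abs_of_nonneg hn]
    exact (mul_le_mul_of_nonneg_left hcB hn).trans hnB
  have hv1 : 0 < 1 + n * c := by linarith [(abs_le.1 hv).1]
  have hnc : |n * c| ≤ n * B := by
    rw [abs_mul, abs_of_nonneg hn]; exact mul_le_mul_of_nonneg_left hcB hn
  set E := exp (n * L) with hE
  set E₃ := 1 + n * L + (n * L) ^ 2 / 2 + (n * L) ^ 3 / 6 with hE₃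
  set F := (1 + n * c) ^ n with hF
  -- F₃ is the product (1 + nc)(1 + n(nc - (nc)²/2)) without its n⁴ term.
  set F₃ := 1 + n * c + n ^ 2 * c + n ^ 3 * c ^ 2 / 2 with hF₃
  have hE1 : |E| ≤ 1 := by
    rw [abs_of_pos (exp_pos _), ← exp_zero]
    exact exp_le_exp.2 (mul_nonpos_of_nonneg_of_nonpos hn hL0.le)
  have hEE : |E - E₃| ≤ n ^ 4 * (K₄ * weight x) := by
    refine (abs_exp_sub_cubic_le (n * L)).trans ?_
    have h1 := hK₄ x hx
    rw [add_zero] at h1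
    refine le_trans ?_ (mul_le_mul_of_nonneg_left h1 (pow_nonneg hn 4))
    rw [abs_mul, abs_of_nonneg hn, mul_pow, mul_assoc]
    refine mul_le_mul_of_nonneg_left (mul_le_mul_of_nonneg_left (exp_le_exp.2 ?_) (by positivity))
      (by positivity)
    nlinarith [abs_nonneg L]
  have hFF : |F - (1 + n * (n * c - (n * c) ^ 2 / 2))| ≤ n ^ 4 * (12 * B ^ 2 + 2 * B ^ 3) := by
    refine (abs_one_add_rpow_sub_le hn hn1 hv).trans ?_
    have h1 : (n * c) ^ 2 ≤ (n * B) ^ 2 := by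
      rw [← sq_abs (n * c)]; exact pow_le_pow_left₀ (abs_nonneg _) hnc 2
    have h2 : |n * c| ^ 3 ≤ (n * B) ^ 3 := pow_le_pow_left₀ (abs_nonneg _) hnc 3
    calc 12 * n ^ 2 * (n * c) ^ 2 + 2 * n * |n * c| ^ 3
        ≤ 12 * n ^ 2 * (n * B) ^ 2 + 2 * n * (n * B) ^ 3 := by gcongr
      _ = _ := by ring
  have hGF : |(1 + n * c) * F - F₃| ≤ n ^ 4 * ((1 + B) * (12 * B ^ 2 + 2 * B ^ 3) + B ^ 3) := by
    have e : (1 + n * c) * F - F₃ = (1 + n * c) * (F - (1 + n * (n * c - (n * c) ^ 2 / 2)))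
        + -(n ^ 4 * (c ^ 3 / 2)) := by rw [hF₃]; ring
    rw [e]
    refine (abs_add_le _ _).trans ?_
    rw [abs_neg, abs_mul, abs_mul, abs_of_nonneg (pow_nonneg hn 4)]
    have h1 : |1 + n * c| ≤ 1 + B := by
      refine (abs_add_le _ _).trans ?_
      rw [abs_one]
      have : n * B ≤ B := mul_le_of_le_one_left hB0 hn1
      linarith
    have h2 : |c ^ 3 / 2| ≤ B ^ 3 := by
      rw [abs_div, abs_pow, abs_two]
      have := pow_le_pow_left₀ (abs_nonneg c) hcB 3
      have : 0 ≤ |c| ^ 3 := by positivity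
      linarith
    calc |1 + n * c| * |F - (1 + n * (n * c - (n * c) ^ 2 / 2))| + n ^ 4 * |c ^ 3 / 2|
        ≤ (1 + B) * (n ^ 4 * (12 * B ^ 2 + 2 * B ^ 3)) + n ^ 4 * B ^ 3 := by gcongr
      _ = _ := by ring
  have hF₃b : |F₃| ≤ 1 + 2 * B + B ^ 2 := by
    have h1 : |n * c| ≤ B := hnc.trans (mul_le_of_le_one_left hB0 hn1)
    have h2 : |n ^ 2 * c| ≤ B := by
      rw [abs_mul, abs_of_nonneg (sq_nonneg n)]
      have : n ^ 2 ≤ 1 := by nlinarith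
      nlinarith [abs_nonneg c]
    have h3 : |n ^ 3 * c ^ 2 / 2| ≤ B ^ 2 := by
      rw [abs_div, abs_mul, abs_two, abs_of_nonneg (pow_nonneg hn 3), abs_pow]
      have h4 : n ^ 3 ≤ 1 := pow_le_one₀ hn hn1
      have h5 := pow_le_pow_left₀ (abs_nonneg c) hcB 2
      have h6 : n ^ 3 * |c| ^ 2 ≤ |c| ^ 2 := mul_le_of_le_one_left (by positivity) h4
      have : 0 ≤ n ^ 3 * |c| ^ 2 := by positivity
      linarith
    have h4 := abs_add_le (1 + n * c + n ^ 2 * c) (n ^ 3 * c ^ 2 / 2)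
    have h5 := abs_add_le (1 + n * c) (n ^ 2 * c)
    have h6 := abs_add_le 1 (n * c)
    rw [abs_one] at h6
    linarith
  set W := |L| + (B + 1) with hW
  have hW1 : 1 ≤ W := by have := abs_nonneg L; linarith
  have hLW : |L| ≤ W := by linarith
  have hcW : |c| ≤ W := by have := abs_nonneg L; linarith
  have hW5 : W ^ 5 ≤ K₅ * weight x := by
    refine le_trans ?_ (hK₅ x hx)
    exact le_mul_of_one_le_right (by positivity) (one_le_exp (by positivity))
  have hprod : |E₃ * F₃ - (1 + n * (L + c) + n ^ 2 * (c + L ^ 2 / 2 + L * c)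
      + n ^ 3 * (L ^ 3 / 6 + L ^ 2 * c / 2 + L * c + c ^ 2 / 2))| ≤ n ^ 4 * (2 * (K₅ * weight x)) := by
    refine (abs_trunc_mul_trunc_sub_le hn hn1 hW1 hLW hcW).trans ?_
    exact mul_le_mul_of_nonneg_left (by linarith) (pow_nonneg hn 4)
  have hZ : (seed x + n * corr x) ^ (n + 1) = seed x * (E * ((1 + n * c) * F)) := by
    have h1 : seed x + n * corr x = seed x * (1 + n * c) := by
      rw [← seed_mul_logCorr hx]; ring
    have h2 : seed x ^ n = E := by
      rw [hE, mul_comm, rpow_def_of_pos hs, hL, logSeed]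
    rw [h1, mul_rpow hs.le hv1.le, rpow_add_one hs.ne', rpow_add_one hv1.ne', h2]
    ring
  have hP : powTrunc n x = seed x * (1 + n * (L + c) + n ^ 2 * (c + L ^ 2 / 2 + L * c)
      + n ^ 3 * (L ^ 3 / 6 + L ^ 2 * c / 2 + L * c + c ^ 2 / 2)) := by
    rw [powTrunc, ← seed_mul_logCorr hx]
    have := hs.ne'
    field_simp
    ring
  rw [hZ, hP, ← mul_sub, abs_mul, abs_of_pos hs]
  have hs1 : seed x ≤ 1 := seed_le.trans (by norm_num)
  refine (mul_le_of_le_one_left (abs_nonneg _) hs1).trans ?_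
  have e : E * ((1 + n * c) * F) - (1 + n * (L + c) + n ^ 2 * (c + L ^ 2 / 2 + L * c)
      + n ^ 3 * (L ^ 3 / 6 + L ^ 2 * c / 2 + L * c + c ^ 2 / 2))
      = (E - E₃) * F₃ + E * ((1 + n * c) * F - F₃) + (E₃ * F₃ - (1 + n * (L + c)
      + n ^ 2 * (c + L ^ 2 / 2 + L * c)
      + n ^ 3 * (L ^ 3 / 6 + L ^ 2 * c / 2 + L * c + c ^ 2 / 2))) := by ring
  rw [e]
  have b1 : |(E - E₃) * F₃| ≤ n ^ 4 * (K₄ * weight x) * (1 + 2 * B + B ^ 2) := by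
    rw [abs_mul]; gcongr
  have b2 : |E * ((1 + n * c) * F - F₃)|
      ≤ n ^ 4 * ((1 + B) * (12 * B ^ 2 + 2 * B ^ 3) + B ^ 3) * weight x := by
    rw [abs_mul]
    refine (mul_le_of_le_one_left (abs_nonneg _) hE1).trans (hGF.trans ?_)
    exact le_mul_of_one_le_right (by positivity) hw
  have b3 := abs_add_le ((E - E₃) * F₃ + E * ((1 + n * c) * F - F₃)) (E₃ * F₃ - (1 + n * (L + c)
      + n ^ 2 * (c + L ^ 2 / 2 + L * c)
      + n ^ 3 * (L ^ 3 / 6 + L ^ 2 * c / 2 + L * c + c ^ 2 / 2)))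
  have b4 := abs_add_le ((E - E₃) * F₃) (E * ((1 + n * c) * F - F₃))
  linarith

namespace IsProfile

/-- First-order Taylor expansion of Z ↦ Z^(n+1) at the exact profile y. The relative error v = (Z -
y)/y is O(n²) uniformly up to the boundary, because Z - y carries a factor 1 - x and y is bounded
below by a multiple of 1 - x. -/
theorem exists_rpow_linearization {C : ℝ} (hC : 0 ≤ C) : ∃ K, 0 ≤ K ∧ ∃ n₁ > 0, n₁ ≤ 1 / 4 ∧
    ∀ n, 0 ≤ n → n ≤ n₁ → ∀ ℓ, IsProfile C n ℓ → ∀ x ∈ Ioo (0 : ℝ) 1,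
      |(seed x + n * corr x) ^ (n + 1) - (src n ℓ x * prof n ℓ x
        + (n + 1) * (src n ℓ x * (seed x + n * corr x - prof n ℓ x)))| ≤ n ^ 4 * K := by
  obtain ⟨K, hK0, hK⟩ := exists_prof_sub hC
  set D := 4 * K * exp C with hD
  have hD0 : 0 ≤ D := by positivity
  refine ⟨exp C * exp C * D ^ 2, by positivity, 1 / (4 + D), by positivity,
    one_div_le_one_div_of_le (by norm_num) (by linarith), fun n hn hn' ℓ h x hx => ?_⟩
  have hn4 : n ≤ 1 / 4 := hn'.trans (one_div_le_one_div_of_le (by norm_num) (by linarith))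
  have hn1 : n ≤ 1 := by linarith
  have hnD : n * D ≤ 1 := by
    rw [le_div_iff₀ (by positivity)] at hn'
    nlinarith
  have hx' : x ∈ Icc (0 : ℝ) 1 := ⟨hx.1.le, hx.2.le⟩
  have hp := h.prof_pos hn ⟨hx.1.le, hx.2⟩
  set y := prof n ℓ x with hy
  set v := (seed x + n * corr x - y) / y with hv
  have hbd : |ℓ x| ≤ C := (h.bound x hx).trans (by nlinarith)
  have hylow : (1 - x) / 4 * exp (-C) ≤ y := by
    rw [hy, h.prof_eq hx, exp_add, exp_logSeed hx]
    exact mul_le_mul (le_seed hx') (exp_le_exp.2 (by linarith [(abs_le.1 hbd).1])) (exp_pos _).le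
      (seed_pos hx).le
  have hyup : y ≤ exp C := by
    rw [hy, h.prof_eq hx]
    exact exp_le_exp.2 (by linarith [(abs_le.1 hbd).2, logSeed_neg hx])
  have hvb : |v| ≤ D * n ^ 2 := by
    rw [hv, abs_div, abs_of_pos hp, div_le_iff₀ hp, abs_sub_comm]
    refine (hK n hn hn4 ℓ h x hx').trans ?_
    calc K * n ^ 2 * (1 - x) = D * n ^ 2 * ((1 - x) / 4 * exp (-C)) := by
          rw [hD, exp_neg]; have := (exp_pos C).ne'; field_simp
      _ ≤ D * n ^ 2 * y := mul_le_mul_of_nonneg_left hylow (by positivity)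
  have hv1 : -1 ≤ v := by
    have : D * n ^ 2 ≤ 1 := by nlinarith
    linarith [(abs_le.1 hvb).1]
  have hZ : seed x + n * corr x = y * (1 + v) := by rw [hv]; field_simp; ring
  have h1 := abs_one_add_rpow_sub_linear_le hn hn1 hv1
  have hyn : y ^ (n + 1) = src n ℓ x * y := by
    rw [rpow_add_one hp.ne', h.prof_rpow hx]
  have e : (seed x + n * corr x) ^ (n + 1) - (src n ℓ x * y
        + (n + 1) * (src n ℓ x * (seed x + n * corr x - y)))
      = src n ℓ x * y * ((1 + v) ^ (n + 1) - (1 + (n + 1) * v)) := by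
    rw [hZ, mul_rpow hp.le (by linarith), hyn]; ring
  have hsb : src n ℓ x ≤ exp C :=
    (src_le hn h.bound hx).trans (exp_le_exp.2 (by nlinarith [mul_nonneg hC hn]))
  rw [e, abs_mul, abs_mul, abs_of_pos (src_pos _ _ _), abs_of_pos hp]
  have h2 : n * v ^ 2 ≤ D ^ 2 * n ^ 4 := by
    have h3 : v ^ 2 ≤ (D * n ^ 2) ^ 2 := by
      rw [← sq_abs v]; exact pow_le_pow_left₀ (abs_nonneg v) hvb 2
    calc n * v ^ 2 ≤ 1 * (D * n ^ 2) ^ 2 := mul_le_mul hn1 h3 (sq_nonneg v) zero_le_one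
      _ = _ := by ring
  calc src n ℓ x * y * |(1 + v) ^ (n + 1) - (1 + (n + 1) * v)|
      ≤ exp C * exp C * (D ^ 2 * n ^ 4) := by
        refine mul_le_mul (mul_le_mul hsb hyup hp.le (exp_pos _).le) (h1.trans h2) (abs_nonneg _)
          (by positivity)
    _ = _ := by ring

/-- The variational step. At the exact profile the energy equals (1-n)/2 ∫ x² y^(n+1), which the
Pohozaev identity rewrites through the mass. Criticality removes the terms linear in Z - y, so an
O(n²) error of the trial function changes the energy by O(n⁴) only. -/
theorem exists_energy_sub {C : ℝ} (hC : 0 ≤ C) : ∃ K, 0 ≤ K ∧ ∃ n₁ > 0, n₁ ≤ 1 / 4 ∧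
    ∀ n, 0 ≤ n → n ≤ n₁ → ∀ ℓ, IsProfile C n ℓ →
      |(1 - n) / 2 * (3 / 2 * ((n + 1) / (5 - n)) * massOf (src n ℓ) 1 ^ 2) - energyPoly n|
        ≤ K * n ^ 4 := by
  obtain ⟨K₁, hK₁0, hK₁⟩ := exists_src_sub_linear hC
  obtain ⟨K₂, hK₂0, hK₂⟩ := exists_prof_sub hC
  obtain ⟨K₃, hK₃0, n₃, hn₃0, hK₃⟩ := exists_powTrunc_bound
  obtain ⟨K₄, hK₄0, n₄, hn₄0, hn₄, hK₄⟩ := exists_rpow_linearization hC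
  set w := ∫ x in (0 : ℝ)..1, weight x with hw
  have hwI : HasInt weight 0 1 w := HasInt.of_integrable weight_isSource.int
  have hw0 : 0 ≤ w := intervalIntegral.integral_nonneg zero_le_one fun x _ => (weight_pos x).le
  refine ⟨(K₃ + K₄ + K₁ * K₂) * w, by positivity, min n₃ n₄, lt_min hn₃0 hn₄0,
    (min_le_right _ _).trans hn₄, fun n hn hn' ℓ h => ?_⟩
  have hn3 : n ≤ n₃ := hn'.trans (min_le_left _ _)
  have hn4 : n ≤ n₄ := hn'.trans (min_le_right _ _)
  have hn14 : n ≤ 1 / 4 := hn4.trans hn₄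
  have hs := h.isSource hn
  have hI := h.pohozaev hn (by linarith)
  -- The cross terms ∫ x² (f Z - g y) vanish by self-adjointness. Adding this zero completes the
  -- square (f - g)(y - Z).
  have hsym := (HasInt.mul_green_sub hs (linear_isSource n)).const_mul (3 / 2)
  have hP := hasInt_energyPoly n
  have hall := ((hI.const_mul ((1 - n) / 2)).sub hP).add (hsym.const_mul ((n + 1) / 2))
  have hb := hall.abs_val_le ((hwI.const_mul (K₃ + K₄ + K₁ * K₂)).const_mul (n ^ 4)) zero_le_one
    fun x hx => ?_
  · simp only [mul_zero, add_zero] at hb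
    linarith
  · have hx' : x ∈ Icc (0 : ℝ) 1 := ⟨hx.1.le, hx.2.le⟩
    have hg := green_linear (n := n) hx'
    set g := 1 + n * logSeed x with hgdef
    set f := src n ℓ x with hf
    set y := prof n ℓ x with hy
    set Z := seed x + n * corr x with hZ
    have e1 : 3 / 2 * (x ^ 2 * (f * green (fun x => 1 + n * logSeed x) x - g * green (src n ℓ) x))
        = x ^ 2 * (f * Z - g * y) := by
      rw [hy, prof, ← hg]; ring
    -- The integrand splits into the truncation error of Z^(n+1), its linearisation error at y, and
    -- a product of two O(n²) differences.
    have e : (1 - n) / 2 * (x ^ 2 * (f * y)) - x ^ 2 * (powTrunc n x - (n + 1) / 2 * (g * Z))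
        + (n + 1) / 2 * (3 / 2 * (x ^ 2 * (f * green (fun x => 1 + n * logSeed x) x
          - g * green (src n ℓ) x)))
        = x ^ 2 * ((Z ^ (n + 1) - powTrunc n x) - (Z ^ (n + 1) - (f * y + (n + 1) * (f * (Z - y))))
          + (n + 1) / 2 * ((f - g) * (y - Z))) := by
      rw [e1]; ring
    rw [e, abs_mul, abs_of_nonneg (sq_nonneg x)]
    have hx2 : x ^ 2 ≤ 1 := pow_le_one₀ hx.1.le hx.2.le
    refine (mul_le_of_le_one_left (abs_nonneg _) hx2).trans ?_
    have b1 := hK₃ n hn hn3 x hx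
    have b2 : |Z ^ (n + 1) - (f * y + (n + 1) * (f * (Z - y)))| ≤ n ^ 4 * K₄ * weight x :=
      (hK₄ n hn hn4 ℓ h x hx).trans (le_mul_of_one_le_right (by positivity) (one_le_weight hx))
    have b3 : |(n + 1) / 2 * ((f - g) * (y - Z))| ≤ n ^ 4 * (K₁ * K₂ * weight x) := by
      rw [abs_mul, abs_mul, abs_of_nonneg (by positivity : 0 ≤ (n + 1) / 2)]
      have c1 := hK₁ n hn hn14 ℓ h x hx
      have c2 : |y - Z| ≤ K₂ * n ^ 2 := (hK₂ n hn hn14 ℓ h x hx').trans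
        (mul_le_of_le_one_right (by positivity) (by linarith [hx.1]))
      have hw' := weight_pos x
      calc (n + 1) / 2 * (|f - g| * |y - Z|)
          ≤ 1 * (n ^ 2 * (K₁ * weight x) * (K₂ * n ^ 2)) := by
            gcongr
            · linarith
        _ = _ := by ring
    have t1 := abs_add_le ((Z ^ (n + 1) - powTrunc n x)
      - (Z ^ (n + 1) - (f * y + (n + 1) * (f * (Z - y))))) ((n + 1) / 2 * ((f - g) * (y - Z)))
    have t2 := abs_sub (Z ^ (n + 1) - powTrunc n x)
      (Z ^ (n + 1) - (f * y + (n + 1) * (f * (Z - y))))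
    linarith

end IsProfile

/-! ### Algebra of cubic expansions and the expansion at n = 0 -/

/-- `f` has the given cubic Taylor expansion at `0` from the right. -/
def HasCubicExpansion (f : ℝ → ℝ) (a b c d : ℝ) : Prop :=
  (fun n => f n - (a + b * n + c * n ^ 2 + d * n ^ 3)) =O[𝓝[≥] 0] fun n : ℝ => n ^ 4

theorem isBigO_one_of_continuous {p : ℝ → ℝ} (hp : Continuous p) :
    p =O[𝓝[≥] 0] fun _ : ℝ => (1 : ℝ) :=
  ((hp.tendsto 0).mono_left nhdsWithin_le_nhds).isBigO_one ℝ

theorem isBigO_pow_pow {i j : ℕ} (h : j ≤ i) :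
    (fun n : ℝ => n ^ i) =O[𝓝[≥] 0] fun n : ℝ => n ^ j := by
  have h1 := (isBigO_refl (fun n : ℝ => n ^ j) (𝓝[≥] 0)).mul
    (isBigO_one_of_continuous (continuous_pow (i - j)))
  refine (h1.congr_left fun n => ?_).congr_right fun n => mul_one _
  rw [← pow_add, Nat.add_sub_cancel' h]

namespace HasCubicExpansion

variable {f g : ℝ → ℝ} {a b c d a' b' c' d' : ℝ}

theorem congr_coeff (h : HasCubicExpansion f a b c d) (ha : a = a') (hb : b = b') (hc : c = c')
    (hd : d = d') : HasCubicExpansion f a' b' c' d' := by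
  subst ha hb hc hd; exact h

theorem poly (a b c d : ℝ) :
    HasCubicExpansion (fun n => a + b * n + c * n ^ 2 + d * n ^ 3) a b c d := by
  simp only [HasCubicExpansion, sub_self]
  exact isBigO_zero _ _

theorem sub_isBigO (hf : HasCubicExpansion f a b c d) (hg : HasCubicExpansion g a' b' c' d')
    (ha : a' = a) (hb : b' = b) (hc : c' = c) (hd : d' = d) :
    (fun n => f n - g n) =O[𝓝[≥] 0] fun n : ℝ => n ^ 4 :=
  (IsBigO.sub hf (hg.congr_coeff ha hb hc hd)).congr_left fun n => by ring

theorem add (hf : HasCubicExpansion f a b c d) (hg : HasCubicExpansion g a' b' c' d') :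
    HasCubicExpansion (fun n => f n + g n) (a + a') (b + b') (c + c') (d + d') :=
  (IsBigO.add hf hg).congr_left fun n => by ring

theorem const_mul (k : ℝ) (hf : HasCubicExpansion f a b c d) :
    HasCubicExpansion (fun n => k * f n) (k * a) (k * b) (k * c) (k * d) :=
  (IsBigO.const_mul_left hf k).congr_left fun n => by ring

theorem isBigO_one (hf : HasCubicExpansion f a b c d) : f =O[𝓝[≥] 0] fun _ : ℝ => (1 : ℝ) := by
  have h1 := (IsBigO.trans hf (isBigO_one_of_continuous (continuous_pow 4))).add
    (isBigO_one_of_continuous (p := fun n => a + b * n + c * n ^ 2 + d * n ^ 3) (by fun_prop))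
  exact h1.congr_left fun n => by ring

theorem isBigO_id (hf : HasCubicExpansion f 0 b c d) : f =O[𝓝[≥] 0] fun n : ℝ => n := by
  have h1 := (isBigO_refl (fun n : ℝ => n) (𝓝[≥] 0)).mul
    (isBigO_one_of_continuous (p := fun n => b + c * n + d * n ^ 2) (by fun_prop))
  have h2 := (IsBigO.trans hf (isBigO_pow_pow (by norm_num : 1 ≤ 4)))
  simp only [pow_one] at h2
  simp only [mul_one] at h1
  exact (h2.add h1).congr_left fun n => by ring

theorem mul (hf : HasCubicExpansion f a b c d) (hg : HasCubicExpansion g a' b' c' d') :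
    HasCubicExpansion (fun n => f n * g n) (a * a') (a * b' + b * a') (a * c' + b * b' + c * a')
      (a * d' + b * c' + c * b' + d * a') := by
  have h1 := IsBigO.mul hf hg.isBigO_one
  have h2 := (isBigO_one_of_continuous (p := fun n => a + b * n + c * n ^ 2 + d * n ^ 3)
    (by fun_prop)).mul hg
  have h3 := (isBigO_refl (fun n : ℝ => n ^ 4) (𝓝[≥] 0)).mul
    (isBigO_one_of_continuous (p := fun n => b * d' + c * c' + d * b'
      + (c * d' + d * c') * n + d * d' * n ^ 2) (by fun_prop))
  simp only [one_mul] at h2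
  simp only [mul_one] at h1 h3
  exact ((h1.add h2).add h3).congr_left fun n => by ring

theorem exp (hf : HasCubicExpansion f 0 b c d) :
    HasCubicExpansion (fun n => exp (f n)) 1 b (c + b ^ 2 / 2) (d + b * c + b ^ 3 / 6) := by
  have h2 := hf.mul hf
  have h3 := h2.mul hf
  have h4 := (((poly 1 0 0 0).add hf).add (h2.const_mul (1 / 2))).add (h3.const_mul (1 / 6))
  have hO : (fun n => Real.exp (f n) - (1 + f n + f n ^ 2 / 2 + f n ^ 3 / 6))
      =O[𝓝[≥] 0] fun n : ℝ => n ^ 4 := by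
    have h0 : Tendsto f (𝓝[≥] 0) (𝓝 0) :=
      hf.isBigO_id.trans_tendsto (tendsto_id.mono_left nhdsWithin_le_nhds)
    have he : (fun n => Real.exp |f n|) =O[𝓝[≥] 0] fun _ : ℝ => (1 : ℝ) :=
      ((continuous_exp.comp continuous_abs).continuousAt.tendsto.comp h0).isBigO_one ℝ
    have h5 := (hf.isBigO_id.pow 4).norm_left.mul he
    simp only [mul_one] at h5
    refine IsBigO.trans (IsBigO.of_bound 1 (Eventually.of_forall fun n => ?_)) h5
    have h6 := abs_exp_sub_cubic_le (f n)
    rw [one_mul, norm_eq_abs, norm_mul, norm_norm, norm_pow, norm_eq_abs, norm_eq_abs, abs_exp]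
    exact h6
  have h5 := h4.congr_coeff (a' := 1) (b' := b) (c' := c + b ^ 2 / 2)
    (d' := d + b * c + b ^ 3 / 6) (by ring) (by ring) (by ring) (by ring)
  exact (hO.add h5).congr_left fun n => by ring

/-- The prefactor n gains one order, so v is needed only up to O(n³). -/
theorem mul_log_one_add {v : ℝ → ℝ} {p q : ℝ}
    (hv : (fun n => v n - (p * n + q * n ^ 2)) =O[𝓝[≥] 0] fun n : ℝ => n ^ 3) :
    HasCubicExpansion (fun n => n * log (1 + v n)) 0 0 p (q - p ^ 2 / 2) := by
  have hid := isBigO_refl (fun n : ℝ => n) (𝓝[≥] 0)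
  have hv2 : (fun n => v n - p * n) =O[𝓝[≥] 0] fun n : ℝ => n ^ 2 :=
    ((hv.trans (isBigO_pow_pow (by norm_num))).add
      ((isBigO_refl (fun n : ℝ => n ^ 2) _).const_mul_left q)).congr_left fun n => by ring
  have hv1 : v =O[𝓝[≥] 0] fun n : ℝ => n := by
    have h := hv2.trans (isBigO_pow_pow (by norm_num : 1 ≤ 2))
    simp only [pow_one] at h
    exact (h.add (hid.const_mul_left p)).congr_left fun n => by ring
  have hv0 : Tendsto v (𝓝[≥] 0) (𝓝 0) :=
    hv1.trans_tendsto (tendsto_id.mono_left nhdsWithin_le_nhds)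
  have hlog : (fun n => log (1 + v n) - (v n - v n ^ 2 / 2)) =O[𝓝[≥] 0] fun n : ℝ => n ^ 3 := by
    refine IsBigO.trans (IsBigO.of_bound 2 ?_) (hv1.pow 3)
    have h := hv0.eventually (Metric.closedBall_mem_nhds 0 (by norm_num : (0 : ℝ) < 1 / 2))
    filter_upwards [h] with n hn
    rw [dist_zero_right] at hn
    rw [norm_eq_abs, norm_pow]
    exact abs_log_one_add_sub_le hn
  have h1 := hid.mul hlog
  have h2 := hid.mul hv
  have h3 := ((hid.mul hv2).mul (hv1.add (hid.const_mul_left p))).const_mul_left (1 / 2)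
  refine IsBigO.congr' (((h1.add (h2.congr_right fun n => rfl)).sub
    (h3.congr_right fun n => by ring))) ?_ ?_
  · exact Eventually.of_forall fun n => by ring
  · exact Eventually.of_forall fun n => by ring

/-- A nonnegative function is determined by the expansion of its square. -/
theorem of_sq (ha : 0 < a) (hf : ∀ᶠ n in 𝓝[≥] 0, 0 ≤ f n) {r : ℝ → ℝ} (hr : ContinuousAt r 0)
    (hr0 : 0 < r 0) (h : (fun n => r n * (f n ^ 2 - (a + b * n + c * n ^ 2 + d * n ^ 3) ^ 2))
      =O[𝓝[≥] 0] fun n : ℝ => n ^ 4) : HasCubicExpansion f a b c d := by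
  -- Near 0 one has r ≥ r(0)/2 and f + p ≥ a/2, and these are the factors separating f - p from r
  -- (f² - p²).
  refine IsBigO.trans (IsBigO.of_bound (2 / r 0 * (2 / a)) ?_) h
  have h1 : ∀ᶠ n : ℝ in 𝓝[≥] 0, a / 2 < a + b * n + c * n ^ 2 + d * n ^ 3 := by
    have : ContinuousAt (fun n : ℝ => a + b * n + c * n ^ 2 + d * n ^ 3) 0 := by fun_prop
    exact nhdsWithin_le_nhds (this.eventually (lt_mem_nhds (by simp; linarith)))
  have h2 : ∀ᶠ n : ℝ in 𝓝[≥] 0, r 0 / 2 < r n :=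
    nhdsWithin_le_nhds (hr.eventually (lt_mem_nhds (by linarith)))
  filter_upwards [hf, h1, h2] with n h3 h4 h5
  set p := a + b * n + c * n ^ 2 + d * n ^ 3
  rw [norm_mul, show f n ^ 2 - p ^ 2 = (f n + p) * (f n - p) by ring, norm_mul]
  simp only [norm_eq_abs]
  rw [abs_of_pos (show 0 < r n by linarith), abs_of_pos (show 0 < f n + p by linarith)]
  have h6 : 1 ≤ 2 / r 0 * r n := by
    rw [div_mul_eq_mul_div, le_div_iff₀ hr0]; linarith
  have h7 : 1 ≤ 2 / a * (f n + p) := by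
    rw [div_mul_eq_mul_div, le_div_iff₀ ha]; linarith
  have h8 := mul_le_mul h6 h7 zero_le_one (by linarith)
  calc |f n - p| ≤ 2 / r 0 * r n * (2 / a * (f n + p)) * |f n - p| :=
        le_mul_of_one_le_left (abs_nonneg _) (by linarith)
    _ = _ := by ring

end HasCubicExpansion

/-- Let μ̂ = m / Y(0)ⁿ and let E be the energy. The Pohozaev identity gives (3/4)(1 - n²) μ̂² = (5 -
n) E Y(0)^(-2n). The right side has a known cubic expansion, so it suffices to check that the
claimed polynomial satisfies the same relation coefficient by coefficient. -/
theorem hasCubicExpansion_of_isProfile {C n₀ : ℝ} (hC : 0 ≤ C) (hn₀ : 0 < n₀) (hn₀' : n₀ ≤ 1 / 4)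
    {ℓ : ℝ → ℝ → ℝ} (h : ∀ n, 0 ≤ n → n ≤ n₀ → IsProfile C n (ℓ n)) :
    HasCubicExpansion (fun n => massOf (src n (ℓ n)) 1 / prof n (ℓ n) 0 ^ n)
      (1 / 3) (2 / 9 * (-4 + 3 * log 2))
      (1 / 54 * (-21 * π ^ 2 + 200 + 12 * log 2 + 36 * log 2 ^ 2))
      (1 / 81 * (-3464 + 75 * π ^ 2 - 210 * log 2 - 63 * π ^ 2 * log 2
        + 180 * log 2 ^ 2 + 36 * log 2 ^ 3 + 2646 * zetaThree)) := by
  obtain ⟨K₁, hK₁0, n₁, hn₁, hn₁', hE⟩ := IsProfile.exists_energy_sub hC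
  obtain ⟨K₂, hK₂0, hY⟩ := IsProfile.exists_central_sub hC
  have hmem : ∀ᶠ n : ℝ in 𝓝[≥] 0, 0 ≤ n ∧ n ≤ n₀ ∧ n ≤ n₁ := by
    filter_upwards [self_mem_nhdsWithin, nhdsWithin_le_nhds (Iic_mem_nhds hn₀),
      nhdsWithin_le_nhds (Iic_mem_nhds hn₁)] with n a b c using ⟨a, b, c⟩
  have hA : HasCubicExpansion (fun n => (1 - n) / 2 * (3 / 2 * ((n + 1) / (5 - n))
      * massOf (src n (ℓ n)) 1 ^ 2)) (1 / 60) (-77 / 900) (1199 / 2250 - 7 / 180 * π ^ 2)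
      (-(1344043 / 202500) + 49 / 15 * zetaThree + 719 / 2700 * π ^ 2) := by
    refine IsBigO.of_bound K₁ ?_
    filter_upwards [hmem] with n hn
    have h1 := hE n hn.1 hn.2.2 (ℓ n) (h n hn.1 hn.2.1)
    rw [norm_eq_abs, norm_eq_abs, abs_of_nonneg (pow_nonneg hn.1 4)]
    convert h1 using 2
    rw [energyPoly]; ring
  have hv : (fun n => (4 * prof n (ℓ n) 0 - 1) - ((7 / 3 - 6 * log 2) * n
      + 4 * (7 / 12 * π ^ 2 + 9 / 2 * log 2 ^ 2 - 287 / 36) * n ^ 2))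
      =O[𝓝[≥] 0] fun n : ℝ => n ^ 3 := by
    refine IsBigO.of_bound (4 * K₂) ?_
    filter_upwards [hmem] with n hn
    have h1 := hY n hn.1 (hn.2.1.trans hn₀') (ℓ n) (h n hn.1 hn.2.1)
    rw [norm_eq_abs, norm_eq_abs, abs_of_nonneg (pow_nonneg hn.1 3)]
    have h2 := mul_le_mul_of_nonneg_left h1 (by norm_num : (0 : ℝ) ≤ 4)
    refine le_trans (le_of_eq ?_) (h2.trans_eq (mul_assoc _ _ _).symm)
    rw [← abs_of_pos (by norm_num : (0 : ℝ) < 4), ← abs_mul, abs_of_pos (by norm_num : (0 : ℝ) < 4)]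
    ring_nf
  -- Since 4 Y(0) = 1 + v, one has n log Y(0) = n log (1 + v) - 2n log 2; the factor -2 is the
  -- exponent of Y(0)^(-2n).
  have hLog := ((HasCubicExpansion.mul_log_one_add hv).add
    (HasCubicExpansion.poly 0 (-2 * log 2) 0 0)).const_mul (-2)
  rw [show (-2 : ℝ) * (0 + 0) = 0 by ring] at hLog
  have hX := hLog.exp
  have hpos : ∀ n, 0 ≤ n → n ≤ n₀ → 0 < prof n (ℓ n) 0 := fun n a b =>
    (h n a b).prof_pos a ⟨le_rfl, zero_lt_one⟩
  refine HasCubicExpansion.of_sq (by norm_num) ?_ (r := fun n => 3 / 4 * (1 - n ^ 2))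
    (by fun_prop) (by norm_num) ?_
  · filter_upwards [hmem] with n hn
    exact div_nonneg (intervalIntegral.integral_nonneg zero_le_one fun t _ =>
      mul_nonneg (sq_nonneg t) (src_pos _ _ _).le)
      (rpow_nonneg (hpos n hn.1 hn.2.1).le _)
  · have hL := ((HasCubicExpansion.poly 5 (-1) 0 0).mul hA).mul hX
    have hp := HasCubicExpansion.poly (1 / 3) (2 / 9 * (-4 + 3 * log 2))
      (1 / 54 * (-21 * π ^ 2 + 200 + 12 * log 2 + 36 * log 2 ^ 2))
      (1 / 81 * (-3464 + 75 * π ^ 2 - 210 * log 2 - 63 * π ^ 2 * log 2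
        + 180 * log 2 ^ 2 + 36 * log 2 ^ 3 + 2646 * zetaThree))
    have hR := (HasCubicExpansion.poly (3 / 4) 0 (-3 / 4) 0).mul (hp.mul hp)
    refine IsBigO.congr' (hL.sub_isBigO hR ?_ ?_ ?_ ?_) ?_ EventuallyEq.rfl
    case refine_5 =>
      filter_upwards [hmem] with n hn
      have hY0 := hpos n hn.1 hn.2.1
      have e1 : (prof n (ℓ n) 0 ^ n) ^ 2 * exp (-2 * (n * log (1 + (4 * prof n (ℓ n) 0 - 1))
          + (0 + -2 * log 2 * n + 0 * n ^ 2 + 0 * n ^ 3))) = 1 := by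
        rw [rpow_def_of_pos hY0, sq, ← exp_add, ← exp_add, exp_eq_one_iff,
          show 1 + (4 * prof n (ℓ n) 0 - 1) = 2 ^ 2 * prof n (ℓ n) 0 by ring,
          log_mul (by norm_num) hY0.ne', log_pow]
        push_cast; ring
      have h5 : (5 - n) ≠ 0 := by linarith [hn.2.1]
      have e2 := rpow_pos_of_pos hY0 n
      have e3 := eq_div_of_mul_eq (pow_pos e2 2).ne' ((mul_comm _ _).trans e1)
      simp only [e3]
      field_simp
      ring
    all_goals ring

theorem eventually_existsUnique_isSecondMoment {l : Filter ℝ} {μ : ℝ → ℝ}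
    (h : ∀ᶠ n in l, IsSecondMoment n (μ n)) : ∀ᶠ n in l, ∃! m, IsSecondMoment n m :=
  h.mono fun n hn => ⟨μ n, hn, fun _ hm => hm.unique hn⟩

theorem exists_isSecondMoment_expansion_zero : ∃ μ : ℝ → ℝ,
    (∀ᶠ n in 𝓝[≥] 0, IsSecondMoment n (μ n)) ∧
      (fun n => μ n - (π ^ 3 / 3
            + 2 * π ^ 3 / 9 * (-4 + 3 * log 2) * n
            + π ^ 3 / 54 * (-21 * π ^ 2 + 200 + 12 * log 2 + 36 * log 2 ^ 2) * n ^ 2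
            + π ^ 3 / 81 * (-3464 + 75 * π ^ 2 - 210 * log 2 - 63 * π ^ 2 * log 2
                + 180 * log 2 ^ 2 + 36 * log 2 ^ 3 + 2646 * (riemannZeta 3).re) * n ^ 3))
          =O[𝓝[≥] 0] fun n => n ^ 4 := by
  obtain ⟨C, hC, n₀, hn₀, hn₀', h⟩ := exists_isProfile
  choose! ℓ hℓ using h
  refine ⟨fun n => π ^ 3 * (massOf (src n (ℓ n)) 1 / prof n (ℓ n) 0 ^ n), ?_, ?_⟩
  · filter_upwards [self_mem_nhdsWithin, nhdsWithin_le_nhds (Iic_mem_nhds hn₀)] with n hn hn'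
    exact (hℓ n hn hn').isSecondMoment hn
      (lt_of_le_of_lt (le_trans hn' hn₀') (by norm_num))
  · refine (IsBigO.const_mul_left (hasCubicExpansion_of_isProfile hC hn₀ hn₀' hℓ)
      (π ^ 3)).congr_left fun n => ?_
    rw [zetaThree]; ring

/-! ### Estimates of the nonlinearity for n near 1 -/

/-- `v ^ (1 + ε) - v` at `v = exp x * a`. -/
noncomputable def excess (ε x a : ℝ) : ℝ := exp x * a * (exp (ε * (x + log a)) - 1)

theorem excess_eq {ε x a : ℝ} (ha : 0 < a) :
    excess ε x a = (exp x * a) ^ (1 + ε) - exp x * a := by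
  rw [excess, rpow_def_of_pos (mul_pos (exp_pos x) ha), log_mul (exp_pos x).ne' ha.ne', log_exp,
    show (x + log a) * (1 + ε) = x + log a + ε * (x + log a) by ring, exp_add (x + log a),
    exp_add x, exp_log ha]
  ring

theorem abs_log_le_one {a : ℝ} (ha : a ∈ Icc (1 / 2 : ℝ) (3 / 2)) : |log a| ≤ 1 := by
  have h0 : 0 < a := by linarith [ha.1]
  rw [abs_le]
  constructor
  · have h1 := one_sub_inv_le_log_of_pos h0
    have h2 : a⁻¹ ≤ 2 := by rw [inv_le_comm₀ h0 (by norm_num)]; linarith [ha.1]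
    linarith
  · linarith [log_le_sub_one_of_pos h0, ha.2]

/-- Here exp x stands for sin t / t, which degenerates at π. The prefactor exp x with x ≤ 0 absorbs
both |x| + 2 ≤ 2 exp (|x|/2) and the growth exp (|x|/2) allowed by |ε| ≤ 1/2, so the estimates are
uniform up to the zero. -/
theorem exp_mul_exp_le {ε x a : ℝ} (hε : |ε| ≤ 1 / 2) (hx : x ≤ 0)
    (ha : a ∈ Icc (1 / 2 : ℝ) (3 / 2)) :
    exp x * ((|x| + 2) * exp |ε * (x + log a)|) ≤ 4 := by
  have h1 : |ε * (x + log a)| ≤ (|x| + 1) / 2 := by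
    rw [abs_mul]
    have := abs_add_le x (log a)
    have := abs_log_le_one ha
    nlinarith [abs_nonneg ε, abs_nonneg (x + log a), abs_nonneg x]
  have h2 : |x| + 2 ≤ 2 * exp (|x| / 2) := by linarith [add_one_le_exp (|x| / 2)]
  have h3 : exp (1 / 2) ≤ 2 := by
    have h := exp_one_lt_d9
    have h4 : exp (1 / 2) * exp (1 / 2) = exp 1 := by rw [← exp_add]; norm_num
    nlinarith [exp_pos (1 / 2)]
  calc exp x * ((|x| + 2) * exp |ε * (x + log a)|)
      ≤ exp x * ((2 * exp (|x| / 2)) * exp ((|x| + 1) / 2)) := by gcongr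
    _ = 2 * exp (x + |x| / 2 + (|x| + 1) / 2) := by rw [exp_add, exp_add]; ring
    _ = 2 * exp (1 / 2) := by rw [abs_of_nonpos hx]; ring_nf
    _ ≤ 4 := by linarith

theorem abs_excess_le {ε x a : ℝ} (hε : |ε| ≤ 1 / 2) (hx : x ≤ 0)
    (ha : a ∈ Icc (1 / 2 : ℝ) (3 / 2)) : |excess ε x a| ≤ 6 * |ε| := by
  have h := exp_mul_exp_le hε hx ha
  have ha0 : 0 < a := by linarith [ha.1]
  have h1 := abs_exp_sub_one_le' (ε * (x + log a))
  have h2 : |ε * (x + log a)| ≤ |ε| * (|x| + 2) := by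
    rw [abs_mul]
    have := abs_add_le x (log a)
    have := abs_log_le_one ha
    nlinarith [abs_nonneg ε]
  rw [excess, abs_mul, abs_of_pos (mul_pos (exp_pos x) ha0)]
  calc exp x * a * |exp (ε * (x + log a)) - 1|
      ≤ exp x * (3 / 2) * (|ε| * (|x| + 2) * exp |ε * (x + log a)|) := by
        gcongr
        · exact ha.2
        · exact h1.trans (by gcongr)
    _ = 3 / 2 * |ε| * (exp x * ((|x| + 2) * exp |ε * (x + log a)|)) := by ring
    _ ≤ 3 / 2 * |ε| * 4 := by gcongr
    _ = _ := by ring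

theorem abs_excess_sub_le {ε x a b : ℝ} (hε : |ε| ≤ 1 / 2) (hx : x ≤ 0)
    (ha : a ∈ Icc (1 / 2 : ℝ) (3 / 2)) (hb : b ∈ Icc (1 / 2 : ℝ) (3 / 2)) :
    |excess ε x a - excess ε x b| ≤ 4 * |ε| * |a - b| := by
  refine (convex_Icc (1 / 2 : ℝ) (3 / 2)).norm_image_sub_le_of_norm_hasDerivWithin_le
    (f := fun c => excess ε x c)
    (f' := fun c => exp x * (exp (ε * (x + log c)) - 1 + ε * exp (ε * (x + log c))))
    (fun c hc => ?_) (fun c hc => ?_) hb ha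
  · have hc0 : c ≠ 0 := by linarith [hc.1]
    have h1 := (((hasDerivAt_log hc0).const_add x).const_mul ε).exp.sub_const 1
    have h2 := ((hasDerivAt_id c).const_mul (exp x)).mul h1
    refine HasDerivAt.hasDerivWithinAt (h2.congr_deriv ?_)
    simp only [id]
    field_simp
  · have h := exp_mul_exp_le hε hx hc
    have h1 := abs_exp_sub_one_le' (ε * (x + log c))
    have h2 : |ε * (x + log c)| ≤ |ε| * (|x| + 1) := by
      rw [abs_mul]
      have := abs_add_le x (log c)
      have := abs_log_le_one hc
      nlinarith [abs_nonneg ε]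
    have h3 : exp (ε * (x + log c)) ≤ exp |ε * (x + log c)| := exp_le_exp.2 (le_abs_self _)
    rw [norm_eq_abs, abs_mul, abs_exp]
    have h4 : |exp (ε * (x + log c)) - 1 + ε * exp (ε * (x + log c))|
        ≤ |ε| * (|x| + 1) * exp |ε * (x + log c)| + |ε| * exp |ε * (x + log c)| := by
      refine (abs_add_le _ _).trans (add_le_add (h1.trans (by gcongr)) ?_)
      rw [abs_mul, abs_exp]; gcongr
    calc exp x * |exp (ε * (x + log c)) - 1 + ε * exp (ε * (x + log c))|
        ≤ exp x * (|ε| * (|x| + 1) * exp |ε * (x + log c)| + |ε| * exp |ε * (x + log c)|) := by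
          gcongr
      _ = |ε| * (exp x * ((|x| + 2) * exp |ε * (x + log c)|)) := by ring
      _ ≤ |ε| * 4 := by gcongr
      _ = _ := by ring

theorem abs_excess_one_sub_le {ε x : ℝ} (hε : |ε| ≤ 1 / 2) (hx : x ≤ 0) :
    |excess ε x 1 - ε * (exp x * x)| ≤ 8 * ε ^ 2 := by
  have h1 := abs_exp_sub_linear_le (ε * x)
  rw [sq_abs] at h1
  have h2 : |ε * x| ≤ |x| / 2 := by rw [abs_mul]; nlinarith [abs_nonneg x]
  have h3 : x ^ 2 ≤ 8 * exp (|x| / 2) := by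
    have := quadratic_le_exp_of_nonneg (show 0 ≤ |x| / 2 by positivity)
    have : |x| ^ 2 = x ^ 2 := sq_abs x
    nlinarith [abs_nonneg x]
  have e : excess ε x 1 - ε * (exp x * x) = exp x * (exp (ε * x) - (1 + ε * x)) := by
    rw [excess, log_one]; ring_nf
  rw [e, abs_mul, abs_exp]
  calc exp x * |exp (ε * x) - (1 + ε * x)| ≤ exp x * ((ε * x) ^ 2 * exp |ε * x|) := by
        gcongr
    _ ≤ exp x * ((ε ^ 2 * (8 * exp (|x| / 2))) * exp (|x| / 2)) := by
        rw [mul_pow]; gcongr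
    _ = 8 * ε ^ 2 * exp (x + |x| / 2 + |x| / 2) := by rw [exp_add, exp_add]; ring
    _ = 8 * ε ^ 2 := by rw [abs_of_nonpos hx]; ring_nf; simp

/-! ### The forced linear oscillator -/

/-- Bounded continuous sources on `(0, π)`. -/
structure IsBoundedSource (p : ℝ → ℝ) (M : ℝ) : Prop where
  cont : ContinuousOn p (Ioo 0 π)
  bound : ∀ t ∈ Ioo 0 π, |p t| ≤ M

/-- The sine moment of `p` on `[0, z]`. -/
noncomputable def sineMoment (p : ℝ → ℝ) (z : ℝ) : ℝ := ∫ t in (0 : ℝ)..z, sin t * p t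

/-- The cosine moment of `p` on `[0, z]`. -/
noncomputable def cosineMoment (p : ℝ → ℝ) (z : ℝ) : ℝ := ∫ t in (0 : ℝ)..z, cos t * p t

/-- The solution `u` of `u'' + u = -p` with `u 0 = 0` and `u' 0 = 0`, divided by `sin`. -/
noncomputable def sineResponse (p : ℝ → ℝ) (z : ℝ) : ℝ :=
  cos z / sin z * sineMoment p z - cosineMoment p z

namespace IsBoundedSource

variable {p q : ℝ → ℝ} {M N : ℝ}

theorem bound_nonneg (h : IsBoundedSource p M) : 0 ≤ M :=
  (abs_nonneg _).trans (h.bound (π / 2) ⟨by linarith [pi_pos], by linarith [pi_pos]⟩)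

theorem mono (h : IsBoundedSource p M) (hMN : M ≤ N) : IsBoundedSource p N :=
  ⟨h.cont, fun t ht => (h.bound t ht).trans hMN⟩

theorem add (h : IsBoundedSource p M) (h' : IsBoundedSource q N) :
    IsBoundedSource (fun t => p t + q t) (M + N) :=
  ⟨h.cont.add h'.cont,
    fun t ht => (abs_add_le _ _).trans (add_le_add (h.bound t ht) (h'.bound t ht))⟩

theorem const_mul (c : ℝ) (h : IsBoundedSource p M) :
    IsBoundedSource (fun t => c * p t) (|c| * M) :=
  ⟨continuousOn_const.mul h.cont, fun t ht => by
    rw [abs_mul]; exact mul_le_mul_of_nonneg_left (h.bound t ht) (abs_nonneg c)⟩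

theorem bounded_mul {c : ℝ → ℝ} (hc : Continuous c) (hc1 : ∀ t, |c t| ≤ 1)
    (h : IsBoundedSource p M) : IsBoundedSource (fun t => c t * p t) M :=
  ⟨hc.continuousOn.mul h.cont, fun t ht => by
    rw [abs_mul]; exact (mul_le_of_le_one_left (abs_nonneg _) (hc1 t)).trans (h.bound t ht)⟩

theorem intervalIntegrable (h : IsBoundedSource p M) : IntervalIntegrable p volume 0 π :=
  intervalIntegrable_of_abs_le pi_pos.le h.cont (g := fun _ => M) intervalIntegrable_const h.bound

theorem intervalIntegrable_sub (h : IsBoundedSource p M) {a b : ℝ} (ha : a ∈ Icc 0 π)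
    (hb : b ∈ Icc 0 π) : IntervalIntegrable p volume a b :=
  h.intervalIntegrable.mono_set (by
    rw [uIcc_of_le pi_pos.le]; exact ordConnected_Icc.uIcc_subset ha hb)

theorem hasInt (h : IsBoundedSource p M) : HasInt p 0 π (∫ t in (0 : ℝ)..π, p t) :=
  HasInt.of_integrable h.intervalIntegrable

theorem abs_integral_le (h : IsBoundedSource p M) : |∫ t in (0 : ℝ)..π, p t| ≤ π * M := by
  have h1 : HasInt (fun _ : ℝ => M) 0 π (π * M) :=
    ⟨intervalIntegrable_const, by rw [intervalIntegral.integral_const, smul_eq_mul, sub_zero]⟩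
  exact h.hasInt.abs_val_le h1 pi_pos.le h.bound

theorem sin_mul (h : IsBoundedSource p M) : IsBoundedSource (fun t => sin t * p t) M :=
  h.bounded_mul continuous_sin abs_sin_le_one

theorem cos_mul (h : IsBoundedSource p M) : IsBoundedSource (fun t => cos t * p t) M :=
  h.bounded_mul continuous_cos abs_cos_le_one

theorem abs_cosineMoment_le (h : IsBoundedSource p M) {z : ℝ} (hz : z ∈ Icc 0 π) :
    |cosineMoment p z| ≤ M * z := by
  have h1 : HasInt (fun _ : ℝ => M) 0 z (M * z) :=
    ⟨intervalIntegrable_const, by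
      rw [intervalIntegral.integral_const, smul_eq_mul, sub_zero, mul_comm]⟩
  refine (HasInt.of_integrable (h.cos_mul.intervalIntegrable_sub ⟨le_rfl, pi_pos.le⟩ hz)).abs_val_le
    h1 hz.1 fun t ht => h.cos_mul.bound t ⟨ht.1, ht.2.trans_le hz.2⟩

theorem abs_integral_sin_mul_le (h : IsBoundedSource p M) {a b : ℝ} (ha : 0 ≤ a) (hab : a ≤ b)
    (hb : b ≤ π) : |∫ t in a..b, sin t * p t| ≤ M * (cos a - cos b) := by
  have h1 : HasInt (fun t : ℝ => M * sin t) a b (M * (cos a - cos b)) :=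
    HasInt.const_mul M ⟨continuous_sin.intervalIntegrable _ _, integral_sin⟩
  refine (HasInt.of_integrable (h.sin_mul.intervalIntegrable_sub ⟨ha, hab.trans hb⟩
    ⟨ha.trans hab, hb⟩)).abs_val_le h1 hab fun t ht => ?_
  have ht' : t ∈ Ioo 0 π := ⟨ha.trans_lt ht.1, ht.2.trans_le hb⟩
  rw [abs_mul, abs_of_pos (sin_pos_of_mem_Ioo ht'), mul_comm M]
  exact mul_le_mul_of_nonneg_left (h.bound t ht') (sin_pos_of_mem_Ioo ht').le

theorem abs_sineMoment_le (h : IsBoundedSource p M) {z : ℝ} (hz : z ∈ Icc 0 π) :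
    |sineMoment p z| ≤ M * (1 - cos z) := by
  have := h.abs_integral_sin_mul_le le_rfl hz.1 hz.2
  rwa [cos_zero] at this

theorem abs_sineMoment_le_of_eq_zero (h : IsBoundedSource p M) (h0 : sineMoment p π = 0) {z : ℝ}
    (hz : z ∈ Icc 0 π) : |sineMoment p z| ≤ M * (1 + cos z) := by
  have h1 := h.abs_integral_sin_mul_le hz.1 hz.2 le_rfl
  have h2 := integral_add_adjacent_intervals
    (h.sin_mul.intervalIntegrable_sub ⟨le_rfl, pi_pos.le⟩ hz)
    (h.sin_mul.intervalIntegrable_sub hz ⟨pi_pos.le, le_rfl⟩)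
  have h3 : sineMoment p z = -∫ t in z..π, sin t * p t := by
    rw [sineMoment] at h0 ⊢; linarith
  rw [h3, abs_neg]
  rw [cos_pi] at h1
  linarith

/-- The factor cos/sin is singular at both ends. The sine moment is at most M(1 - |cos z|), near π
by virtue of the orthogonality hypothesis, and |cos|(1 - |cos|) ≤ sin removes the singularity. The
constant is 1 + 4, with π ≤ 4 for the cosine moment. -/
theorem abs_sineResponse_le (h : IsBoundedSource p M) (h0 : sineMoment p π = 0) {z : ℝ}
    (hz : z ∈ Ioo 0 π) : |sineResponse p z| ≤ 5 * M := by
  have hz' : z ∈ Icc 0 π := ⟨hz.1.le, hz.2.le⟩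
  have hM := h.bound_nonneg
  have hs := sin_pos_of_mem_Ioo hz
  have h1 : |sineMoment p z| ≤ M * (1 - |cos z|) := by
    rcases abs_cases (cos z) with h2 | h2 <;> rw [h2.1]
    · exact h.abs_sineMoment_le hz'
    · rw [sub_neg_eq_add]; exact h.abs_sineMoment_le_of_eq_zero h0 hz'
  have h2 : |cos z / sin z * sineMoment p z| ≤ M := by
    rw [abs_mul, abs_div, abs_of_pos hs, div_mul_eq_mul_div, div_le_iff₀ hs]
    have h3 : |cos z| * (1 - |cos z|) ≤ sin z := by
      have h4 := sin_sq_add_cos_sq z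
      have h5 := abs_cos_le_one z
      have h6 := sin_le_one z
      have h7 := sq_abs (cos z)
      nlinarith [abs_nonneg (cos z)]
    calc |cos z| * |sineMoment p z| ≤ |cos z| * (M * (1 - |cos z|)) := by gcongr
      _ = M * (|cos z| * (1 - |cos z|)) := by ring
      _ ≤ M * sin z := by gcongr
  have h3 : |cosineMoment p z| ≤ 4 * M := by
    refine (h.abs_cosineMoment_le hz').trans ?_
    nlinarith [hz.2, pi_le_four]
  refine (abs_sub _ _).trans ?_
  linarith

theorem sineMoment_hasDerivAt (h : IsBoundedSource p M) {z : ℝ} (hz : z ∈ Ioo 0 π) :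
    HasDerivAt (sineMoment p) (sin z * p z) z :=
  hasDerivAt_integral_of_continuousOn_Ioo h.sin_mul.cont h.sin_mul.intervalIntegrable hz

theorem cosineMoment_hasDerivAt (h : IsBoundedSource p M) {z : ℝ} (hz : z ∈ Ioo 0 π) :
    HasDerivAt (cosineMoment p) (cos z * p z) z :=
  hasDerivAt_integral_of_continuousOn_Ioo h.cos_mul.cont h.cos_mul.intervalIntegrable hz

theorem sineMoment_continuousOn (h : IsBoundedSource p M) :
    ContinuousOn (sineMoment p) (Icc 0 π) :=
  continuousOn_integral_Icc pi_pos.le h.sin_mul.intervalIntegrable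

theorem cosineMoment_continuousOn (h : IsBoundedSource p M) :
    ContinuousOn (cosineMoment p) (Icc 0 π) :=
  continuousOn_integral_Icc pi_pos.le h.cos_mul.intervalIntegrable

theorem sineResponse_continuousOn (h : IsBoundedSource p M) :
    ContinuousOn (sineResponse p) (Ioo 0 π) :=
  ((continuous_cos.continuousOn.div continuous_sin.continuousOn
    fun _ hz => (sin_pos_of_mem_Ioo hz).ne').mul
    (h.sineMoment_continuousOn.mono Ioo_subset_Icc_self)).sub
    (h.cosineMoment_continuousOn.mono Ioo_subset_Icc_self)

theorem sineMoment_sub (h : IsBoundedSource p M) (h' : IsBoundedSource q N) {z : ℝ}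
    (hz : z ∈ Icc 0 π) :
    sineMoment (fun t => p t - q t) z = sineMoment p z - sineMoment q z := by
  simp only [sineMoment, mul_sub]
  exact intervalIntegral.integral_sub (h.sin_mul.intervalIntegrable_sub ⟨le_rfl, pi_pos.le⟩ hz)
    (h'.sin_mul.intervalIntegrable_sub ⟨le_rfl, pi_pos.le⟩ hz)

theorem sineResponse_sub (h : IsBoundedSource p M) (h' : IsBoundedSource q N) {z : ℝ}
    (hz : z ∈ Icc 0 π) :
    sineResponse (fun t => p t - q t) z = sineResponse p z - sineResponse q z := by
  have h1 : cosineMoment (fun t => p t - q t) z = cosineMoment p z - cosineMoment q z := by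
    simp only [cosineMoment, mul_sub]
    exact intervalIntegral.integral_sub (h.cos_mul.intervalIntegrable_sub ⟨le_rfl, pi_pos.le⟩ hz)
      (h'.cos_mul.intervalIntegrable_sub ⟨le_rfl, pi_pos.le⟩ hz)
  rw [sineResponse, h1, h.sineMoment_sub h' hz, sineResponse, sineResponse]
  ring

end IsBoundedSource

/-- The function `u / z` for the solution `u` of `u'' + u = -p` with `u 0 = 0` and `u' 0 = 1`. -/
noncomputable def forcedSinc (p : ℝ → ℝ) (z : ℝ) : ℝ :=
  sinc z * (1 - cosineMoment p z) + cos z * (sineMoment p z / z)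

theorem forcedSinc_zero (p : ℝ → ℝ) : forcedSinc p 0 = 1 := by
  simp [forcedSinc, cosineMoment]

theorem forcedSinc_pi {p : ℝ → ℝ} (h0 : sineMoment p π = 0) : forcedSinc p π = 0 := by
  rw [forcedSinc, h0, sinc_of_ne_zero pi_pos.ne', sin_pi]; simp

theorem mul_forcedSinc {p : ℝ → ℝ} {z : ℝ} (hz : z ≠ 0) :
    z * forcedSinc p z = sin z * (1 - cosineMoment p z) + cos z * sineMoment p z := by
  rw [forcedSinc, sinc_of_ne_zero hz]; field_simp

theorem mul_forcedSinc_eq {p : ℝ → ℝ} {z : ℝ} (hz : z ∈ Ioo 0 π) :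
    z * forcedSinc p z = sin z * (1 + sineResponse p z) := by
  have := (sin_pos_of_mem_Ioo hz).ne'
  rw [mul_forcedSinc hz.1.ne', sineResponse]; field_simp; ring

/-- The quantity `z u' - u` for the solution `u` of `u'' + u = -p` with `u 0 = 0`, `u' 0 = 1`. -/
noncomputable def forcedFlux (p : ℝ → ℝ) (z : ℝ) : ℝ :=
  z * (cos z * (1 - cosineMoment p z) - sin z * sineMoment p z)
    - (sin z * (1 - cosineMoment p z) + cos z * sineMoment p z)

namespace IsBoundedSource

variable {p : ℝ → ℝ} {M : ℝ}

theorem forcedSinc_continuousOn (h : IsBoundedSource p M) :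
    ContinuousOn (forcedSinc p) (Icc 0 π) := by
  refine (continuous_sinc.continuousOn.mul (continuousOn_const.sub h.cosineMoment_continuousOn)).add
    (continuous_cos.continuousOn.mul fun z hz => ?_)
  rcases hz.1.eq_or_lt with h0 | h0
  · rw [← h0, ContinuousWithinAt, div_zero]
    refine squeeze_zero_norm' (a := fun z => M * z) ?_ ?_
    · filter_upwards [self_mem_nhdsWithin] with t ht
      rcases ht.1.eq_or_lt with h1 | h1
      · rw [← h1]; simp
      rw [norm_eq_abs, abs_div, abs_of_pos h1, div_le_iff₀ h1]
      refine (h.abs_sineMoment_le ht).trans ?_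
      rw [mul_assoc]
      refine mul_le_mul_of_nonneg_left ?_ h.bound_nonneg
      nlinarith [one_sub_sq_div_two_le_cos (x := t), sq_nonneg t]
    · have : Continuous fun z : ℝ => M * z := by fun_prop
      have h2 := this.tendsto 0
      rw [mul_zero] at h2
      exact h2.mono_left nhdsWithin_le_nhds
  · exact (h.sineMoment_continuousOn z hz).div continuousWithinAt_id h0.ne'

/-- Since (z u' - u)' = z u'' and u'' = -(u + p), no quotient by z appears. -/
theorem forcedFlux_hasDerivAt (h : IsBoundedSource p M) {z : ℝ} (hz : z ∈ Ioo 0 π) :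
    HasDerivAt (forcedFlux p) (-(z * (z * forcedSinc p z + p z))) z := by
  have h1 := (h.cosineMoment_hasDerivAt hz).const_sub 1
  have h2 := h.sineMoment_hasDerivAt hz
  have h3 := ((hasDerivAt_id z).mul (((hasDerivAt_cos z).mul h1).sub ((hasDerivAt_sin z).mul h2))).sub
    (((hasDerivAt_sin z).mul h1).add ((hasDerivAt_cos z).mul h2))
  refine h3.congr_deriv ?_
  rw [mul_forcedSinc hz.1.ne']
  simp only [id, Pi.mul_apply, Pi.sub_apply]
  linear_combination (-z * p z) * sin_sq_add_cos_sq z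

theorem forcedFlux_continuousOn (h : IsBoundedSource p M) :
    ContinuousOn (forcedFlux p) (Icc 0 π) := by
  have h1 := h.cosineMoment_continuousOn
  have h2 := h.sineMoment_continuousOn
  unfold forcedFlux
  fun_prop

theorem forcedSinc_hasDerivAt (h : IsBoundedSource p M) {z : ℝ} (hz : z ∈ Ioo 0 π) :
    HasDerivAt (forcedSinc p) (forcedFlux p z / z ^ 2) z := by
  have h1 := (h.cosineMoment_hasDerivAt hz).const_sub 1
  have h2 := h.sineMoment_hasDerivAt hz
  have h3 := (((hasDerivAt_sin z).mul h1).add ((hasDerivAt_cos z).mul h2)).div (hasDerivAt_id z)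
    hz.1.ne'
  have h4 : HasDerivAt (fun z => (sin z * (1 - cosineMoment p z) + cos z * sineMoment p z) / z)
      (forcedFlux p z / z ^ 2) z := by
    refine h3.congr_deriv ?_
    simp only [id, Pi.mul_apply, Pi.add_apply, forcedFlux]
    ring
  refine h4.congr_of_eventuallyEq ?_
  filter_upwards [isOpen_Ioo.mem_nhds hz] with t ht
  rw [← mul_forcedSinc ht.1.ne', mul_div_cancel_left₀ _ ht.1.ne']

variable {n lam : ℝ}

/-- Under `heq` the derivative of u - z u' is λ z² Vⁿ, so the flux is the first integral of the
Lane-Emden equation. -/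
theorem hasInt_flux (h : IsBoundedSource p M) (hlam : 0 < lam)
    (hpos : ∀ t ∈ Ioo 0 π, 0 < forcedSinc p t)
    (heq : ∀ t ∈ Ioo 0 π, p t = lam * (t * forcedSinc p t ^ n) - t * forcedSinc p t) {z : ℝ}
    (hz : z ∈ Icc 0 π) :
    HasInt (fun t => lam * (t ^ 2 * forcedSinc p t ^ n)) 0 z (-forcedFlux p z) := by
  have h1 := HasInt.of_hasDerivAt_nonneg (F := fun t => -forcedFlux p t)
    (f := fun t => lam * (t ^ 2 * forcedSinc p t ^ n)) hz.1
    (h.forcedFlux_continuousOn.mono (Icc_subset_Icc_right hz.2)).neg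
    (fun t ht => ?_) (fun t ht => ?_)
  · refine h1.congr_val ?_
    simp [forcedFlux, sineMoment]
  · have ht' : t ∈ Ioo 0 π := ⟨ht.1, ht.2.trans_le hz.2⟩
    refine (h.forcedFlux_hasDerivAt ht').neg.congr_deriv ?_
    rw [heq t ht']; ring
  · have ht' : t ∈ Ioo 0 π := ⟨ht.1, ht.2.trans_le hz.2⟩
    have := rpow_pos_of_pos (hpos t ht') n
    positivity

theorem isLaneEmden (h : IsBoundedSource p M) (h0 : sineMoment p π = 0) (hlam : 0 < lam)
    (hpos : ∀ t ∈ Ioo 0 π, 0 < forcedSinc p t)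
    (heq : ∀ t ∈ Ioo 0 π, p t = lam * (t * forcedSinc p t ^ n) - t * forcedSinc p t) :
    IsLaneEmden n lam π (forcedSinc p) where
  lam_pos := hlam
  b_pos := pi_pos
  cont := h.forcedSinc_continuousOn
  map_zero := forcedSinc_zero p
  pos := fun z hz => by
    rcases hz.1.eq_or_lt with h1 | h1
    · rw [← h1, forcedSinc_zero]; exact one_pos
    · exact hpos z ⟨h1, hz.2⟩
  map_end := forcedSinc_pi h0
  hasDerivAt := fun z hz => by
    refine (h.forcedSinc_hasDerivAt hz).congr_deriv ?_
    have h1 := (h.hasInt_flux hlam hpos heq ⟨hz.1.le, hz.2.le⟩).2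
    rw [intervalIntegral.integral_const_mul] at h1
    rw [h1, neg_div, neg_neg]

/-- The moment is a boundary term: at π, u vanishes and u' = -(1 - cosine moment). -/
theorem integral_rpow_mul_sq (h : IsBoundedSource p M) (h0 : sineMoment p π = 0) (hlam : 0 < lam)
    (hpos : ∀ t ∈ Ioo 0 π, 0 < forcedSinc p t)
    (heq : ∀ t ∈ Ioo 0 π, p t = lam * (t * forcedSinc p t ^ n) - t * forcedSinc p t) :
    ∫ z in (0 : ℝ)..π, forcedSinc p z ^ n * z ^ 2 = π * (1 - cosineMoment p π) / lam := by
  have h1 := (h.hasInt_flux hlam hpos heq ⟨pi_pos.le, le_rfl⟩).2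
  rw [intervalIntegral.integral_const_mul, forcedFlux, h0, sin_pi, cos_pi] at h1
  rw [eq_div_iff hlam.ne', mul_comm _ lam]
  simp only [mul_comm _ (_ ^ 2 : ℝ)]
  rw [h1]; ring

end IsBoundedSource

/-! ### Lyapunov-Schmidt reduction and the fixed point -/

/-- Logarithm of `sin t / t`. -/
noncomputable def logSinc (t : ℝ) : ℝ := log (sin t / t)

theorem exp_logSinc {t : ℝ} (ht : t ∈ Ioo 0 π) : exp (logSinc t) = sin t / t :=
  exp_log (div_pos (sin_pos_of_mem_Ioo ht) ht.1)

theorem logSinc_nonpos {t : ℝ} (ht : t ∈ Ioo 0 π) : logSinc t ≤ 0 :=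
  log_nonpos (div_pos (sin_pos_of_mem_Ioo ht) ht.1).le
    ((div_le_one ht.1).2 (sin_le ht.1.le))

theorem logSinc_continuousOn : ContinuousOn logSinc (Ioo 0 π) :=
  (continuous_sin.continuousOn.div continuousOn_id fun _ ht => ht.1.ne').log
    fun _ ht => (div_pos (sin_pos_of_mem_Ioo ht) ht.1).ne'

/-- The amplitude `t * V` of `V = (sin t / t) * (1 + f t)`. -/
noncomputable def amplitude (f : ℝ → ℝ) (t : ℝ) : ℝ := sin t * (1 + f t)

/-- The nonlinear perturbation `t * (V ^ (1 + ε) - V)` for `V = (sin t / t) * (1 + f t)`. -/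
noncomputable def perturbation (ε : ℝ) (f : ℝ → ℝ) (t : ℝ) : ℝ :=
  t * excess ε (logSinc t) (1 + f t)

/-- The eigenvalue correction that makes `forcing` orthogonal to `sin`. -/
noncomputable def detuning (ε : ℝ) (f : ℝ → ℝ) : ℝ :=
  -sineMoment (perturbation ε f) π
    / (sineMoment (amplitude f) π + sineMoment (perturbation ε f) π)

/-- The total forcing of the linear oscillator. -/
noncomputable def forcing (ε : ℝ) (f : ℝ → ℝ) (t : ℝ) : ℝ :=
  perturbation ε f t + detuning ε f * (perturbation ε f t + amplitude f t)

theorem one_add_mem_Icc {a : ℝ} (ha : |a| ≤ 1 / 2) : 1 + a ∈ Icc (1 / 2 : ℝ) (3 / 2) := by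
  rw [abs_le] at ha; exact ⟨by linarith [ha.1], by linarith [ha.2]⟩

theorem IsBoundedSource.abs_sineMoment_pi_le {p : ℝ → ℝ} {M : ℝ} (h : IsBoundedSource p M) :
    |sineMoment p π| ≤ 4 * M :=
  h.sin_mul.abs_integral_le.trans (mul_le_mul_of_nonneg_right pi_le_four h.bound_nonneg)

theorem hasInt_sin_sq : HasInt (fun t => sin t ^ 2) 0 π (π / 2) :=
  ⟨(continuous_sin.pow 2).intervalIntegrable _ _, by rw [integral_sin_sq]; simp⟩

section Bounds

variable {ε d : ℝ} {f g : ℝ → ℝ}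

theorem amplitude_isBoundedSource (hf : IsBoundedSource f (1 / 2)) :
    IsBoundedSource (amplitude f) (3 / 2) :=
  ⟨continuous_sin.continuousOn.mul (continuousOn_const.add hf.cont), fun t ht => by
    have h1 := one_add_mem_Icc (hf.bound t ht)
    rw [amplitude, abs_mul, abs_of_pos (show 0 < 1 + f t by linarith [h1.1])]
    exact (mul_le_of_le_one_left (by linarith [h1.1]) (abs_sin_le_one t)).trans h1.2⟩

theorem perturbation_isBoundedSource (hf : IsBoundedSource f (1 / 2)) (hε : |ε| ≤ 1 / 2) :
    IsBoundedSource (perturbation ε f) (24 * |ε|) := by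
  refine ⟨continuousOn_id.mul ?_, fun t ht => ?_⟩
  · have h1 : ContinuousOn (fun t => 1 + f t) (Ioo 0 π) := continuousOn_const.add hf.cont
    have h2 : ContinuousOn (fun t => log (1 + f t)) (Ioo 0 π) :=
      h1.log fun t ht => by linarith [(one_add_mem_Icc (hf.bound t ht)).1]
    exact (logSinc_continuousOn.rexp.mul h1).mul
      (((continuousOn_const.mul (logSinc_continuousOn.add h2)).rexp).sub continuousOn_const)
  · rw [perturbation, abs_mul, abs_of_pos ht.1]
    have h1 := abs_excess_le hε (logSinc_nonpos ht) (one_add_mem_Icc (hf.bound t ht))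
    calc t * |excess ε (logSinc t) (1 + f t)| ≤ 4 * (6 * |ε|) :=
          mul_le_mul (ht.2.le.trans pi_le_four) h1 (abs_nonneg _) (by norm_num)
      _ = _ := by ring

theorem amplitude_sub_isBoundedSource (hf : IsBoundedSource f (1 / 2))
    (hg : IsBoundedSource g (1 / 2)) (hd : ∀ t ∈ Ioo 0 π, |f t - g t| ≤ d) :
    IsBoundedSource (fun t => amplitude f t - amplitude g t) d :=
  ⟨(amplitude_isBoundedSource hf).cont.sub (amplitude_isBoundedSource hg).cont, fun t ht => by
    rw [show amplitude f t - amplitude g t = sin t * (f t - g t) by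
      rw [amplitude, amplitude]; ring, abs_mul]
    exact (mul_le_of_le_one_left (abs_nonneg _) (abs_sin_le_one t)).trans (hd t ht)⟩

theorem perturbation_sub_isBoundedSource (hf : IsBoundedSource f (1 / 2))
    (hg : IsBoundedSource g (1 / 2)) (hε : |ε| ≤ 1 / 2) (hd : ∀ t ∈ Ioo 0 π, |f t - g t| ≤ d) :
    IsBoundedSource (fun t => perturbation ε f t - perturbation ε g t) (16 * |ε| * d) :=
  ⟨(perturbation_isBoundedSource hf hε).cont.sub (perturbation_isBoundedSource hg hε).cont,
    fun t ht => by
      rw [perturbation, perturbation, ← mul_sub, abs_mul, abs_of_pos ht.1]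
      have h1 := abs_excess_sub_le hε (logSinc_nonpos ht) (one_add_mem_Icc (hf.bound t ht))
        (one_add_mem_Icc (hg.bound t ht))
      rw [add_sub_add_left_eq_sub] at h1
      have h2 : 4 * |ε| * |f t - g t| ≤ 4 * |ε| * d :=
        mul_le_mul_of_nonneg_left (hd t ht) (by positivity)
      calc t * |excess ε (logSinc t) (1 + f t) - excess ε (logSinc t) (1 + g t)|
          ≤ 4 * (4 * |ε| * d) :=
            mul_le_mul (ht.2.le.trans pi_le_four) (h1.trans h2) (abs_nonneg _) (by norm_num)
        _ = _ := by ring⟩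

theorem sineMoment_amplitude_ge (hf : IsBoundedSource f (1 / 2)) :
    3 / 4 ≤ sineMoment (amplitude f) π := by
  have h1 := (hasInt_sin_sq.const_mul (1 / 2)).mono
    (amplitude_isBoundedSource hf).sin_mul.hasInt pi_pos.le fun t ht => by
      have h2 := (one_add_mem_Icc (hf.bound t ht)).1
      rw [amplitude]
      nlinarith [sq_nonneg (sin t)]
  have h3 := pi_gt_three
  rw [sineMoment]
  linarith

theorem abs_sineMoment_perturbation_le (hf : IsBoundedSource f (1 / 2)) (hε : |ε| ≤ 1 / 2) :
    |sineMoment (perturbation ε f) π| ≤ 96 * |ε| :=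
  (perturbation_isBoundedSource hf hε).abs_sineMoment_pi_le.trans_eq (by ring)

/-- Orthogonality determines the detuning only if this denominator stays away from 0; the bound is
3/4 - 96/400 ≥ 1/2. -/
theorem detuning_denom_ge (hf : IsBoundedSource f (1 / 2)) (hε : |ε| ≤ 1 / 400) :
    1 / 2 ≤ sineMoment (amplitude f) π + sineMoment (perturbation ε f) π := by
  have h1 := sineMoment_amplitude_ge hf
  have h2 := abs_le.1 (abs_sineMoment_perturbation_le hf (hε.trans (by norm_num)))
  linarith [h2.1]

theorem abs_detuning_le (hf : IsBoundedSource f (1 / 2)) (hε : |ε| ≤ 1 / 400) :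
    |detuning ε f| ≤ 192 * |ε| := by
  have h1 := abs_sineMoment_perturbation_le hf (hε.trans (by norm_num))
  have h2 := detuning_denom_ge hf hε
  rw [detuning, abs_div, abs_neg, abs_of_pos (lt_of_lt_of_le (by norm_num) h2),
    div_le_iff₀ (lt_of_lt_of_le (by norm_num) h2)]
  nlinarith [abs_nonneg ε]

theorem abs_detuning_sub_le (hf : IsBoundedSource f (1 / 2)) (hg : IsBoundedSource g (1 / 2))
    (hε : |ε| ≤ 1 / 400) (hd : ∀ t ∈ Ioo 0 π, |f t - g t| ≤ d) :
    |detuning ε f - detuning ε g| ≤ 2048 * |ε| * d := by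
  have hε' : |ε| ≤ 1 / 2 := hε.trans (by norm_num)
  have hπ : π ∈ Icc 0 π := ⟨pi_pos.le, le_rfl⟩
  have hA := amplitude_sub_isBoundedSource hf hg hd
  have hP := perturbation_sub_isBoundedSource hf hg hε' hd
  have hd0 := hA.bound_nonneg
  have a1 := hA.abs_sineMoment_pi_le
  have a2 := hP.abs_sineMoment_pi_le
  rw [(amplitude_isBoundedSource hf).sineMoment_sub (amplitude_isBoundedSource hg) hπ] at a1
  rw [(perturbation_isBoundedSource hf hε').sineMoment_sub
    (perturbation_isBoundedSource hg hε') hπ] at a2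
  have a3 := detuning_denom_ge hf hε
  have a4 := detuning_denom_ge hg hε
  have a5 := abs_detuning_le hg hε
  rw [detuning] at a5
  rw [detuning, detuning]
  set Rf := sineMoment (perturbation ε f) π
  set Rg := sineMoment (perturbation ε g) π
  set Jf := sineMoment (amplitude f) π
  set Jg := sineMoment (amplitude g) π
  have b1 : |Jf + Rf - (Jg + Rg)| ≤ 5 * d := by
    have h := abs_add_le (Jf - Jg) (Rf - Rg)
    rw [show Jf - Jg + (Rf - Rg) = Jf + Rf - (Jg + Rg) by ring] at h
    have : |ε| * d ≤ 1 / 400 * d := mul_le_mul_of_nonneg_right hε hd0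
    linarith
  -- A difference of quotients over one denominator. The numerator is at most (64 + 192 * 5)|ε|d,
  -- and dividing by 1/2 gives 2048.
  have e : -Rf / (Jf + Rf) - -Rg / (Jg + Rg)
      = (-(Rf - Rg) - -Rg / (Jg + Rg) * (Jf + Rf - (Jg + Rg))) / (Jf + Rf) := by
    have h1 : Jf + Rf ≠ 0 := by linarith
    have h2 : Jg + Rg ≠ 0 := by linarith
    field_simp
    ring
  rw [e, abs_div, abs_of_pos (show 0 < Jf + Rf by linarith), div_le_iff₀ (by linarith)]
  have c1 := abs_sub (-(Rf - Rg)) (-Rg / (Jg + Rg) * (Jf + Rf - (Jg + Rg)))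
  rw [abs_neg, abs_mul] at c1
  have c2 := mul_le_mul a5 b1 (abs_nonneg _) (by positivity)
  have c3 : 0 ≤ |ε| * d := by positivity
  nlinarith

theorem forcing_isBoundedSource (hf : IsBoundedSource f (1 / 2)) (hε : |ε| ≤ 1 / 400) :
    IsBoundedSource (forcing ε f) (336 * |ε|) := by
  have h1 := perturbation_isBoundedSource hf (hε.trans (by norm_num) : |ε| ≤ 1 / 2)
  have h2 := h1.add ((h1.add (amplitude_isBoundedSource hf)).const_mul (detuning ε f))
  refine h2.mono ?_
  have h3 := abs_detuning_le hf hε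
  nlinarith [abs_nonneg ε]

/-- The definition of `detuning` is exactly the solution of this linear equation. -/
theorem sineMoment_forcing (hf : IsBoundedSource f (1 / 2)) (hε : |ε| ≤ 1 / 400) :
    sineMoment (forcing ε f) π = 0 := by
  have h1 := (perturbation_isBoundedSource hf (hε.trans (by norm_num) : |ε| ≤ 1 / 2)).sin_mul.hasInt
  have h2 := (amplitude_isBoundedSource hf).sin_mul.hasInt
  have h3 := (h1.add ((h1.add h2).const_mul (detuning ε f))).congr
    (g := fun t => sin t * forcing ε f t) pi_pos.le fun t _ => by rw [forcing]; ring
  have h4 := detuning_denom_ge hf hε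
  rw [sineMoment, h3.2]
  change sineMoment (perturbation ε f) π + detuning ε f
    * (sineMoment (perturbation ε f) π + sineMoment (amplitude f) π) = 0
  have h5 : sineMoment (amplitude f) π + sineMoment (perturbation ε f) π ≠ 0 := by linarith
  rw [detuning]
  field_simp
  ring

theorem forcing_sub_isBoundedSource (hf : IsBoundedSource f (1 / 2))
    (hg : IsBoundedSource g (1 / 2)) (hε : |ε| ≤ 1 / 400)
    (hd : ∀ t ∈ Ioo 0 π, |f t - g t| ≤ d) :
    IsBoundedSource (fun t => forcing ε f t - forcing ε g t) (3600 * |ε| * d) := by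
  have hε' : |ε| ≤ 1 / 2 := hε.trans (by norm_num)
  have hA := amplitude_sub_isBoundedSource hf hg hd
  have hP := perturbation_sub_isBoundedSource hf hg hε' hd
  have hd0 := hA.bound_nonneg
  have h1 := (hP.add ((hP.add hA).const_mul (detuning ε f))).add
    (((perturbation_isBoundedSource hg hε').add (amplitude_isBoundedSource hg)).const_mul
      (detuning ε f - detuning ε g))
  refine ⟨(forcing_isBoundedSource hf hε).cont.sub (forcing_isBoundedSource hg hε).cont,
    fun t ht => ?_⟩
  have h2 := h1.bound t ht
  have e : forcing ε f t - forcing ε g t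
      = perturbation ε f t - perturbation ε g t
        + detuning ε f * (perturbation ε f t - perturbation ε g t
          + (amplitude f t - amplitude g t))
        + (detuning ε f - detuning ε g) * (perturbation ε g t + amplitude g t) := by
    rw [forcing, forcing]; ring
  rw [e]
  refine h2.trans ?_
  have b1 := abs_detuning_le hf hε
  have b2 := abs_detuning_sub_le hf hg hε hd
  have c3 : 0 ≤ |ε| * d := by positivity
  have c1 : 24 * |ε| + 3 / 2 ≤ 1.6 := by linarith
  have c2 : 16 * |ε| * d + d ≤ 1.04 * d := by nlinarith
  have d1 := mul_le_mul b1 c2 (by positivity) (by positivity)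
  have d2 := mul_le_mul b2 c1 (by positivity) (by positivity)
  nlinarith

end Bounds

theorem exists_fixedPoint_forcing {ε : ℝ} (hε : |ε| ≤ 1 / 40000) :
    ∃ f, IsBoundedSource f (2000 * |ε|) ∧ IsBoundedSource f (1 / 2) ∧
      ∀ t ∈ Ioo 0 π, sineResponse (forcing ε f) t = f t := by
  have hε' : |ε| ≤ 1 / 400 := hε.trans (by norm_num)
  have hhalf : ∀ f, ContinuousOn f (Ioo 0 π) → (∀ x ∈ Ioo 0 π, |f x| ≤ 2000 * |ε|) →
      IsBoundedSource f (1 / 2) := fun f hc hb =>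
    ⟨hc, fun t ht => (hb t ht).trans (by linarith)⟩
  have hmap : ∀ f, ContinuousOn f (Ioo 0 π) → (∀ x ∈ Ioo 0 π, |f x| ≤ 2000 * |ε|) →
      ContinuousOn (sineResponse (forcing ε f)) (Ioo 0 π) ∧
        ∀ x ∈ Ioo 0 π, |sineResponse (forcing ε f) x| ≤ 2000 * |ε| := fun f hc hb => by
    have h := forcing_isBoundedSource (hhalf f hc hb) hε'
    refine ⟨h.sineResponse_continuousOn, fun x hx => ?_⟩
    refine (h.abs_sineResponse_le (sineMoment_forcing (hhalf f hc hb) hε') hx).trans ?_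
    linarith [abs_nonneg ε]
  -- The response map multiplies bounds by 5: 5 * 336 ≤ 2000 preserves the ball, and 5 * 3600 /
  -- 40000 ≤ 1/2 gives the contraction.
  obtain ⟨f, hc, hb, hf⟩ := exists_fixedPoint_of_contracting (R := 2000 * |ε|) (κ := 1 / 2)
    (by positivity) (by norm_num) (by norm_num) (Ioo 0 π)
    (fun f => sineResponse (forcing ε f)) hmap (fun f g hc hb hc' hb' d hd x hx => by
      have hf := hhalf f hc hb
      have hg := hhalf g hc' hb'
      have hπ : π ∈ Icc 0 π := ⟨pi_pos.le, le_rfl⟩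
      have h := forcing_sub_isBoundedSource hf hg hε' hd
      have hd0 : 0 ≤ d := (abs_nonneg _).trans (hd x hx)
      rw [← (forcing_isBoundedSource hf hε').sineResponse_sub (forcing_isBoundedSource hg hε')
        ⟨hx.1.le, hx.2.le⟩]
      refine (h.abs_sineResponse_le ?_ hx).trans ?_
      · rw [(forcing_isBoundedSource hf hε').sineMoment_sub (forcing_isBoundedSource hg hε') hπ,
          sineMoment_forcing hf hε', sineMoment_forcing hg hε', sub_zero]
      · have := mul_le_mul_of_nonneg_right hε hd0
        linarith)
  exact ⟨f, ⟨hc, hb⟩, hhalf f hc hb, hf⟩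

theorem detuning_zero (f : ℝ → ℝ) : detuning 0 f = 0 := by
  have : sineMoment (perturbation 0 f) π = 0 := by
    simp [sineMoment, perturbation, excess]
  rw [detuning, this]; simp

theorem isSecondMoment_of_fixedPoint {ε : ℝ} {f : ℝ → ℝ} (hε : |ε| ≤ 1 / 400)
    (hf : IsBoundedSource f (1 / 2)) (hfix : ∀ t ∈ Ioo 0 π, sineResponse (forcing ε f) t = f t) :
    IsSecondMoment (1 + ε) (π * (1 - cosineMoment (forcing ε f) π) / (1 + detuning ε f)) := by
  have hp := forcing_isBoundedSource hf hε
  have h0 := sineMoment_forcing hf hε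
  have hlam : 0 < 1 + detuning ε f := by
    have := (abs_le.1 (abs_detuning_le hf hε)).1
    linarith
  have hV : ∀ t ∈ Ioo 0 π, forcedSinc (forcing ε f) t = exp (logSinc t) * (1 + f t) := by
    intro t ht
    have h1 := mul_forcedSinc_eq (p := forcing ε f) ht
    have ht0 := ht.1.ne'
    rw [hfix t ht] at h1
    rw [exp_logSinc ht, div_mul_eq_mul_div, eq_div_iff ht0, mul_comm, h1]
  have h1f : ∀ t ∈ Ioo 0 π, 0 < 1 + f t := fun t ht => by
    linarith [(one_add_mem_Icc (hf.bound t ht)).1]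
  have hpos : ∀ t ∈ Ioo 0 π, 0 < forcedSinc (forcing ε f) t := fun t ht => by
    rw [hV t ht]; exact mul_pos (exp_pos _) (h1f t ht)
  have heq : ∀ t ∈ Ioo 0 π, forcing ε f t = (1 + detuning ε f)
      * (t * forcedSinc (forcing ε f) t ^ (1 + ε)) - t * forcedSinc (forcing ε f) t := by
    intro t ht
    have h2 : amplitude f t = t * (exp (logSinc t) * (1 + f t)) := by
      have ht0 := ht.1.ne'
      rw [exp_logSinc ht, amplitude]; field_simp
    rw [hV t ht, forcing, perturbation, excess_eq (h1f t ht), h2]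
    ring
  have hL := hp.isLaneEmden h0 hlam hpos heq
  rw [← hp.integral_rpow_mul_sq h0 hlam hpos heq]
  -- At ε = 0 the factor S^(n-1) is always 1, which is consistent because the detuning vanishes
  -- there. Otherwise S = λ^(1/ε).
  rcases eq_or_ne ε 0 with h | h
  · refine isSecondMoment_of_isLaneEmden hL (S := 1) one_pos ?_
    rw [h, detuning_zero, one_rpow, add_zero]
  · refine isSecondMoment_of_isLaneEmden hL (S := (1 + detuning ε f) ^ (1 / ε))
      (rpow_pos_of_pos hlam _) ?_
    rw [add_sub_cancel_left, ← rpow_mul hlam.le, one_div_mul_cancel h, rpow_one]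

/-! ### Integrals of trigonometric functions against log (sin t / t) -/

theorem HasInt.mul_continuous {f c : ℝ → ℝ} {a b v : ℝ} (hf : HasInt f a b v) (hc : Continuous c) :
    IntervalIntegrable (fun t => c t * f t) volume a b :=
  hf.1.continuousOn_mul hc.continuousOn

theorem hasInt_log_sin : HasInt (fun t => log (sin t)) 0 π (-log 2 * π) :=
  ⟨intervalIntegrable_log_sin, integral_log_sin_zero_pi⟩

theorem hasInt_cos_sq : HasInt (fun t => cos t ^ 2) 0 π (π / 2) :=
  ⟨(continuous_cos.pow 2).intervalIntegrable _ _, by rw [integral_cos_sq]; simp⟩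

theorem hasInt_cos_mul_sin : HasInt (fun t => cos t * sin t) 0 π 0 := by
  have h := HasInt.of_hasDerivAt (F := fun t => sin t ^ 2 / 2) (f := fun t => cos t * sin t)
    pi_pos.le (by fun_prop) (fun t _ => (((hasDerivAt_sin t).pow 2).div_const 2).congr_deriv
      (by push_cast; ring)) ((continuous_cos.mul continuous_sin).intervalIntegrable _ _)
  exact h.congr_val (by simp)

/-- The boundary term of cos t sin t log (sin t) gives the integral of cos 2t log (sin t), and sin²
= (1 - cos 2t)/2 reduces the rest to the integral of log (sin t). -/
theorem hasInt_sin_sq_mul_log_sin :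
    HasInt (fun t => sin t ^ 2 * log (sin t)) 0 π (-log 2 * π / 2 + π / 4) := by
  have h1 : HasInt (fun t => (cos t ^ 2 - sin t ^ 2) * log (sin t) + cos t ^ 2) 0 π
      (cos π * (sin π * log (sin π)) - cos 0 * (sin 0 * log (sin 0))) := by
    refine HasInt.of_hasDerivAt (F := fun t => cos t * (sin t * log (sin t))) pi_pos.le
      (continuous_cos.mul (continuous_mul_log.comp continuous_sin)).continuousOn (fun t ht => ?_) ?_
    · have hs := (sin_pos_of_mem_Ioo ht).ne'
      refine ((hasDerivAt_cos t).mul ((hasDerivAt_sin t).mul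
        ((hasDerivAt_sin t).log hs))).congr_deriv ?_
      simp only [Pi.mul_apply]
      field_simp
      ring
    · exact (hasInt_log_sin.mul_continuous (by fun_prop)).add hasInt_cos_sq.1
  refine (((hasInt_log_sin.sub (h1.sub hasInt_cos_sq)).const_mul (1 / 2)).congr_val ?_).congr
    pi_pos.le fun t _ => ?_
  · simp; ring
  · linear_combination (-1 / 2 * log (sin t)) * sin_sq_add_cos_sq t

theorem sineIntegral_eq_integral_sinc (x : ℝ) : sineIntegral x = ∫ t in (0 : ℝ)..x, sinc t := by
  refine intervalIntegral.integral_congr_ae ?_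
  have : ∀ᵐ t : ℝ, t ≠ 0 := by simp [ae_iff]
  filter_upwards [this] with t ht _
  rw [sinc_of_ne_zero ht]

theorem hasInt_sin_mul_cos_div :
    HasInt (fun t => sin t * cos t / t) 0 π (sineIntegral (2 * π) / 2) := by
  have h1 : HasInt (fun t => sinc (2 * t)) 0 π (sineIntegral (2 * π) / 2) := by
    refine ⟨(continuous_sinc.comp (by fun_prop)).intervalIntegrable _ _, ?_⟩
    rw [sineIntegral_eq_integral_sinc, intervalIntegral.integral_comp_mul_left _ two_ne_zero]
    simp; ring
  refine h1.congr pi_pos.le fun t ht => ?_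
  have := ht.1.ne'
  rw [sinc_of_ne_zero (by positivity), sin_two_mul]
  field_simp

theorem hasInt_sin_sq_div :
    HasInt (fun t => sin t ^ 2 / t) 0 π (cosineIntegralCin (2 * π) / 2) := by
  have h1 : HasInt (fun t => sin t * sinc t) 0 π (cosineIntegralCin (2 * π) / 2) := by
    refine ⟨(continuous_sin.mul continuous_sinc).intervalIntegrable _ _, ?_⟩
    have h2 := intervalIntegral.integral_comp_mul_left (fun s => (1 - cos s) / s)
      (a := 0) (b := π) two_ne_zero
    rw [mul_zero, ← cosineIntegralCin, smul_eq_mul] at h2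
    have h3 : ∫ t in (0 : ℝ)..π, sin t * sinc t = ∫ t in (0 : ℝ)..π, (1 - cos (2 * t)) / (2 * t) := by
      refine intervalIntegral.integral_congr fun t _ => ?_
      rcases eq_or_ne t 0 with ht | ht
      · simp [ht]
      · rw [sinc_of_ne_zero ht, cos_two_mul, cos_sq']
        field_simp
        ring
    rw [h3, h2]; ring
  refine h1.congr pi_pos.le fun t ht => ?_
  rw [sinc_of_ne_zero ht.1.ne']; ring

theorem hasInt_sin_sq_mul_log : HasInt (fun t => sin t ^ 2 * log t) 0 π
    (π / 2 * log π - π / 2 + sineIntegral (2 * π) / 4) := by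
  have hl : HasInt log 0 π (∫ t in (0 : ℝ)..π, log t) := HasInt.of_integrable intervalIntegrable_log'
  have h1 : HasInt (fun t => sin t ^ 2 * log t - 1 / 2 * (sin t * cos t / t)) 0 π
      (1 / 2 * (π * log π) * (1 - sinc π * cos π) - π / 2
        - (1 / 2 * (0 * log 0) * (1 - sinc 0 * cos 0) - 0 / 2)) := by
    -- The antiderivative (1/2) log t (t - sin t cos t) - t/2 is rewritten with t log t and sinc to
    -- be continuous at 0.
    refine HasInt.of_hasDerivAt
      (F := fun t => 1 / 2 * (t * log t) * (1 - sinc t * cos t) - t / 2) pi_pos.le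
      (((continuous_const.mul continuous_mul_log).mul
        (continuous_const.sub (continuous_sinc.mul continuous_cos))).sub
        (continuous_id.div_const 2)).continuousOn (fun t ht => ?_) ?_
    · have ht0 := ht.1.ne'
      have h2 : HasDerivAt (fun t => 1 / 2 * log t * (t - sin t * cos t) - t / 2)
          (sin t ^ 2 * log t - 1 / 2 * (sin t * cos t / t)) t := by
        refine ((((hasDerivAt_log ht0).const_mul (1 / 2)).mul ((hasDerivAt_id t).sub
          ((hasDerivAt_sin t).mul (hasDerivAt_cos t)))).sub
          ((hasDerivAt_id t).div_const 2)).congr_deriv ?_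
        simp only [id, Pi.mul_apply, Pi.sub_apply]
        field_simp
        linear_combination (-t * log t) * sin_sq_add_cos_sq t
      refine h2.congr_of_eventuallyEq ?_
      filter_upwards [isOpen_Ioo.mem_nhds ht] with s hs
      have hs0 := hs.1.ne'
      rw [sinc_of_ne_zero hs0]
      field_simp
    · exact (hl.mul_continuous (by fun_prop)).sub (hasInt_sin_mul_cos_div.1.const_mul (1 / 2))
  refine ((h1.add (hasInt_sin_mul_cos_div.const_mul (1 / 2))).congr_val ?_).congr pi_pos.le
    fun t _ => ?_
  · rw [sinc_of_ne_zero pi_pos.ne', sin_pi]; simp; ring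
  · ring

theorem logSinc_eq {t : ℝ} (ht : t ∈ Ioo 0 π) : logSinc t = log (sin t) - log t :=
  log_div (sin_pos_of_mem_Ioo ht).ne' ht.1.ne'

theorem hasInt_sin_sq_mul_logSinc : HasInt (fun t => sin t ^ 2 * logSinc t) 0 π
    (-π / 2 * log (2 * π) + 3 * π / 4 - sineIntegral (2 * π) / 4) := by
  refine ((hasInt_sin_sq_mul_log_sin.sub hasInt_sin_sq_mul_log).congr_val ?_).congr pi_pos.le
    fun t ht => ?_
  · rw [log_mul two_ne_zero pi_pos.ne']; ring
  · rw [logSinc_eq ht]; ring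

/-- The antiderivative (1/2) sin² t log (sin t / t) vanishes at both ends; what remains is half the
integral of sin² t / t, which is Cin(2π)/2. -/
theorem hasInt_sin_mul_cos_mul_logSinc : HasInt (fun t => sin t * cos t * logSinc t) 0 π
    (cosineIntegralCin (2 * π) / 4) := by
  have hl : HasInt log 0 π (∫ t in (0 : ℝ)..π, log t) := HasInt.of_integrable intervalIntegrable_log'
  have h1 : HasInt (fun t => sin t * cos t * log (sin t) - sin t * cos t * log t
      + 1 / 2 * (cos t * sin t) - 1 / 2 * (sin t ^ 2 / t)) 0 π
      (1 / 2 * (sin π * (sin π * log (sin π)) - sin π * sinc π * (π * log π))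
        - 1 / 2 * (sin 0 * (sin 0 * log (sin 0)) - sin 0 * sinc 0 * (0 * log 0))) := by
    refine HasInt.of_hasDerivAt (F := fun t => 1 / 2 * (sin t * (sin t * log (sin t))
      - sin t * sinc t * (t * log t))) pi_pos.le
      (continuous_const.mul ((continuous_sin.mul (continuous_mul_log.comp continuous_sin)).sub
        ((continuous_sin.mul continuous_sinc).mul continuous_mul_log))).continuousOn
      (fun t ht => ?_) ?_
    · have ht0 := ht.1.ne'
      have hs := (sin_pos_of_mem_Ioo ht).ne'
      have h2 : HasDerivAt (fun t => 1 / 2 * (sin t ^ 2 * (log (sin t) - log t)))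
          (sin t * cos t * log (sin t) - sin t * cos t * log t
            + 1 / 2 * (cos t * sin t) - 1 / 2 * (sin t ^ 2 / t)) t := by
        refine ((((hasDerivAt_sin t).pow 2).mul (((hasDerivAt_sin t).log hs).sub
          (hasDerivAt_log ht0))).const_mul (1 / 2)).congr_deriv ?_
        simp only [Pi.sub_apply, Pi.pow_apply]
        push_cast
        field_simp
        ring
      refine h2.congr_of_eventuallyEq ?_
      filter_upwards [isOpen_Ioo.mem_nhds ht] with s hs
      have hs0 := hs.1.ne'
      rw [sinc_of_ne_zero hs0]
      field_simp
    · exact (((hasInt_log_sin.mul_continuous (by fun_prop)).sub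
        (hl.mul_continuous (by fun_prop))).add (hasInt_cos_mul_sin.1.const_mul (1 / 2))).sub
        (hasInt_sin_sq_div.1.const_mul (1 / 2))
  refine (((h1.sub (hasInt_cos_mul_sin.const_mul (1 / 2))).add
    (hasInt_sin_sq_div.const_mul (1 / 2))).congr_val ?_).congr pi_pos.le fun t ht => ?_
  · simp; ring
  · rw [logSinc_eq ht]; ring

/-! ### First-order expansion of the moment at n = 1 -/

section FirstOrder

variable {ε : ℝ} {f : ℝ → ℝ}

/-- Replacing 1 + f by 1 costs ε * O(ε), and linearising the power in ε costs O(ε²), so f does not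
enter at first order. -/
theorem perturbation_sub_linear_isBoundedSource (hf : IsBoundedSource f (2000 * |ε|))
    (hf' : IsBoundedSource f (1 / 2)) (hε : |ε| ≤ 1 / 2) :
    IsBoundedSource (fun t => perturbation ε f t - ε * (sin t * logSinc t)) (33000 * ε ^ 2) := by
  refine ⟨(perturbation_isBoundedSource hf' hε).cont.sub
    (continuousOn_const.mul (continuous_sin.continuousOn.mul logSinc_continuousOn)),
    fun t ht => ?_⟩
  have hx := logSinc_nonpos ht
  have h1 := abs_excess_sub_le hε hx (one_add_mem_Icc (hf'.bound t ht))
    (b := 1) ⟨by norm_num, by norm_num⟩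
  rw [add_sub_cancel_left] at h1
  have h2 := abs_excess_one_sub_le hε hx
  have h3 : perturbation ε f t - ε * (sin t * logSinc t)
      = t * ((excess ε (logSinc t) (1 + f t) - excess ε (logSinc t) 1)
        + (excess ε (logSinc t) 1 - ε * (exp (logSinc t) * logSinc t))) := by
    have := ht.1.ne'
    rw [exp_logSinc ht, perturbation]; field_simp; ring
  rw [h3, abs_mul, abs_of_pos ht.1]
  have h4 : 4 * |ε| * |f t| ≤ 4 * |ε| * (2000 * |ε|) :=
    mul_le_mul_of_nonneg_left (hf.bound t ht) (by positivity)
  have h5 := abs_add_le (excess ε (logSinc t) (1 + f t) - excess ε (logSinc t) 1)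
    (excess ε (logSinc t) 1 - ε * (exp (logSinc t) * logSinc t))
  have h6 := sq_abs ε
  refine (mul_le_mul (ht.2.le.trans pi_le_four) (h5.trans (add_le_add (h1.trans h4) h2))
    (abs_nonneg _) (by norm_num)).trans ?_
  nlinarith [sq_nonneg ε]

theorem amplitude_sub_sin_isBoundedSource (hf : IsBoundedSource f (2000 * |ε|))
    (hf' : IsBoundedSource f (1 / 2)) :
    IsBoundedSource (fun t => amplitude f t - sin t) (2000 * |ε|) :=
  ⟨(amplitude_isBoundedSource hf').cont.sub continuous_sin.continuousOn, fun t ht => by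
    rw [amplitude, show sin t * (1 + f t) - sin t = sin t * f t by ring, abs_mul]
    exact (mul_le_of_le_one_left (abs_nonneg _) (abs_sin_le_one t)).trans (hf.bound t ht)⟩

theorem IsBoundedSource.abs_cosineMoment_pi_le {p : ℝ → ℝ} {M : ℝ} (h : IsBoundedSource p M) :
    |cosineMoment p π| ≤ 4 * M :=
  h.cos_mul.abs_integral_le.trans (mul_le_mul_of_nonneg_right pi_le_four h.bound_nonneg)

theorem IsBoundedSource.hasInt_sineMoment {p : ℝ → ℝ} {M : ℝ} (h : IsBoundedSource p M) :
    HasInt (fun t => sin t * p t) 0 π (sineMoment p π) := h.sin_mul.hasInt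

theorem IsBoundedSource.hasInt_cosineMoment {p : ℝ → ℝ} {M : ℝ} (h : IsBoundedSource p M) :
    HasInt (fun t => cos t * p t) 0 π (cosineMoment p π) := h.cos_mul.hasInt

theorem abs_sineMoment_perturbation_sub_le (hf : IsBoundedSource f (2000 * |ε|))
    (hf' : IsBoundedSource f (1 / 2)) (hε : |ε| ≤ 1 / 2) :
    |sineMoment (perturbation ε f) π
      - ε * (-π / 2 * log (2 * π) + 3 * π / 4 - sineIntegral (2 * π) / 4)| ≤ 132000 * ε ^ 2 := by
  have h := perturbation_sub_linear_isBoundedSource hf hf' hε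
  have h1 := ((perturbation_isBoundedSource hf' hε).hasInt_sineMoment.sub
    (hasInt_sin_sq_mul_logSinc.const_mul ε)).congr
    (g := fun t => sin t * (perturbation ε f t - ε * (sin t * logSinc t))) pi_pos.le
    fun t _ => by ring
  rw [h1.unique h.hasInt_sineMoment]
  exact h.abs_sineMoment_pi_le.trans_eq (by ring)

theorem abs_cosineMoment_perturbation_sub_le (hf : IsBoundedSource f (2000 * |ε|))
    (hf' : IsBoundedSource f (1 / 2)) (hε : |ε| ≤ 1 / 2) :
    |cosineMoment (perturbation ε f) π - ε * (cosineIntegralCin (2 * π) / 4)|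
      ≤ 132000 * ε ^ 2 := by
  have h := perturbation_sub_linear_isBoundedSource hf hf' hε
  have h1 := ((perturbation_isBoundedSource hf' hε).hasInt_cosineMoment.sub
    (hasInt_sin_mul_cos_mul_logSinc.const_mul ε)).congr
    (g := fun t => cos t * (perturbation ε f t - ε * (sin t * logSinc t))) pi_pos.le
    fun t _ => by ring
  rw [h1.unique h.hasInt_cosineMoment]
  exact h.abs_cosineMoment_pi_le.trans_eq (by ring)

theorem abs_sineMoment_amplitude_sub_le (hf : IsBoundedSource f (2000 * |ε|))
    (hf' : IsBoundedSource f (1 / 2)) : |sineMoment (amplitude f) π - π / 2| ≤ 8000 * |ε| := by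
  have h := amplitude_sub_sin_isBoundedSource hf hf'
  have h1 := ((amplitude_isBoundedSource hf').hasInt_sineMoment.sub hasInt_sin_sq).congr
    (g := fun t => sin t * (amplitude f t - sin t)) pi_pos.le fun t _ => by ring
  rw [h1.unique h.hasInt_sineMoment]
  exact h.abs_sineMoment_pi_le.trans_eq (by ring)

theorem abs_cosineMoment_amplitude_le (hf : IsBoundedSource f (2000 * |ε|))
    (hf' : IsBoundedSource f (1 / 2)) : |cosineMoment (amplitude f) π| ≤ 8000 * |ε| := by
  have h := amplitude_sub_sin_isBoundedSource hf hf'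
  have h1 := ((amplitude_isBoundedSource hf').hasInt_cosineMoment.sub hasInt_cos_mul_sin).congr
    (g := fun t => cos t * (amplitude f t - sin t)) pi_pos.le fun t _ => by ring
  have h2 := h1.unique h.hasInt_cosineMoment
  rw [sub_zero] at h2
  rw [h2]
  exact h.abs_cosineMoment_pi_le.trans_eq (by ring)

theorem abs_detuning_sub_linear_le (hf : IsBoundedSource f (2000 * |ε|))
    (hf' : IsBoundedSource f (1 / 2)) (hε : |ε| ≤ 1 / 400) :
    |detuning ε f * (π / 2)
      + ε * (-π / 2 * log (2 * π) + 3 * π / 4 - sineIntegral (2 * π) / 4)| ≤ 1700000 * ε ^ 2 := by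
  have hε' : |ε| ≤ 1 / 2 := hε.trans (by norm_num)
  have h1 := abs_sineMoment_perturbation_sub_le hf hf' hε'
  have h2 := abs_sineMoment_amplitude_sub_le hf hf'
  have h3 := abs_sineMoment_perturbation_le hf' hε'
  have h4 := detuning_denom_ge hf' hε
  have h5 := abs_detuning_le hf' hε
  have h6 : detuning ε f * (sineMoment (amplitude f) π + sineMoment (perturbation ε f) π)
      = -sineMoment (perturbation ε f) π := by
    rw [detuning, div_mul_cancel₀ _ (by linarith)]
  set A := -π / 2 * log (2 * π) + 3 * π / 4 - sineIntegral (2 * π) / 4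
  set R := sineMoment (perturbation ε f) π
  set J := sineMoment (amplitude f) π
  -- The defining equation δ (J + R) = -R is compared with its leading form δ π/2 = -εA; both errors
  -- are products or remainders of order ε².
  have e : detuning ε f * (π / 2) + ε * A
      = detuning ε f * (-(J - π / 2) - R) - (R - ε * A) := by linear_combination h6
  have h7 : |-(J - π / 2) - R| ≤ 8096 * |ε| := by
    refine (abs_sub _ _).trans ?_
    rw [abs_neg]; linarith
  have h8 := mul_le_mul h5 h7 (abs_nonneg _) (by positivity)
  have h9 := abs_sub (detuning ε f * (-(J - π / 2) - R)) (R - ε * A)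
  rw [abs_mul] at h9
  rw [e]
  nlinarith [sq_abs ε]

theorem abs_cosineMoment_forcing_sub_le (hf : IsBoundedSource f (2000 * |ε|))
    (hf' : IsBoundedSource f (1 / 2)) (hε : |ε| ≤ 1 / 400) :
    |cosineMoment (forcing ε f) π - ε * (cosineIntegralCin (2 * π) / 4)| ≤ 1800000 * ε ^ 2 := by
  have hε' : |ε| ≤ 1 / 2 := hε.trans (by norm_num)
  have h1 := abs_cosineMoment_perturbation_sub_le hf hf' hε'
  have h2 := abs_cosineMoment_amplitude_le hf hf'
  have h3 := (perturbation_isBoundedSource hf' hε').abs_cosineMoment_pi_le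
  have h5 := abs_detuning_le hf' hε
  have hP := (perturbation_isBoundedSource hf' hε').hasInt_cosineMoment
  have hA := (amplitude_isBoundedSource hf').hasInt_cosineMoment
  have h4 := ((hP.add ((hP.add hA).const_mul (detuning ε f))).congr
    (g := fun t => cos t * forcing ε f t) pi_pos.le fun t _ => by rw [forcing]; ring).unique
    (forcing_isBoundedSource hf' hε).hasInt_cosineMoment
  rw [← h4, add_sub_right_comm]
  have h6 : |cosineMoment (perturbation ε f) π + cosineMoment (amplitude f) π| ≤ 8096 * |ε| :=
    (abs_add_le _ _).trans (by linarith)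
  have h7 := mul_le_mul h5 h6 (abs_nonneg _) (by positivity)
  refine (abs_add_le _ _).trans ?_
  rw [abs_mul]
  nlinarith [sq_abs ε]

theorem abs_secondMoment_sub_le (hf : IsBoundedSource f (2000 * |ε|))
    (hf' : IsBoundedSource f (1 / 2)) (hε : |ε| ≤ 1 / 400) :
    |π * (1 - cosineMoment (forcing ε f) π) / (1 + detuning ε f)
      - (π + (π / 4 * (-cosineIntegralCin (2 * π) + 6 - 4 * log (2 * π))
        - 1 / 2 * sineIntegral (2 * π)) * ε)|
      ≤ (30000000 + 400 * |π / 4 * (-cosineIntegralCin (2 * π) + 6 - 4 * log (2 * π))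
        - 1 / 2 * sineIntegral (2 * π)|) * ε ^ 2 := by
  have h1 := abs_detuning_sub_linear_le hf hf' hε
  have h2 := abs_cosineMoment_forcing_sub_le hf hf' hε
  have h3 := abs_detuning_le hf' hε
  have hd : 1 / 2 ≤ 1 + detuning ε f := by linarith [(abs_le.1 h3).1]
  set m := π / 4 * (-cosineIntegralCin (2 * π) + 6 - 4 * log (2 * π))
    - 1 / 2 * sineIntegral (2 * π) with hm
  set A := -π / 2 * log (2 * π) + 3 * π / 4 - sineIntegral (2 * π) / 4 with hA
  set c := cosineMoment (forcing ε f) π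
  set B := cosineIntegralCin (2 * π) / 4 with hB
  set δ := detuning ε f
  -- To first order the moment is π (1 - εB)(1 + 2εA/π), whence the coefficient 2A - πB.
  have hmAB : m = 2 * A - π * B := by rw [hm, hA, hB]; ring
  have e : π * (1 - c) / (1 + δ) - (π + m * ε)
      = (-(π * (c - ε * B)) - 2 * (δ * (π / 2) + ε * A) - δ * (m * ε)) / (1 + δ) := by
    have : 1 + δ ≠ 0 := by linarith
    rw [hmAB]
    field_simp
    ring
  rw [e, abs_div, abs_of_pos (show 0 < 1 + δ by linarith), div_le_iff₀ (by linarith)]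
  have h4 : |δ * (m * ε)| ≤ 192 * |m| * ε ^ 2 := by
    rw [abs_mul, abs_mul, ← sq_abs ε]
    calc |δ| * (|m| * |ε|) ≤ 192 * |ε| * (|m| * |ε|) := by gcongr
      _ = _ := by ring
  have h5 : |π * (c - ε * B)| ≤ 4 * (1800000 * ε ^ 2) := by
    rw [abs_mul, abs_of_pos pi_pos]
    exact mul_le_mul pi_le_four h2 (abs_nonneg _) (by norm_num)
  have h6 : |2 * (δ * (π / 2) + ε * A)| ≤ 2 * (1700000 * ε ^ 2) := by
    rw [abs_mul, abs_two]; linarith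
  have h7 := abs_sub (-(π * (c - ε * B)) - 2 * (δ * (π / 2) + ε * A)) (δ * (m * ε))
  have h8 := abs_sub (-(π * (c - ε * B))) (2 * (δ * (π / 2) + ε * A))
  rw [abs_neg] at h8
  have h9 : 0 ≤ |m| * ε ^ 2 := by positivity
  have h10 : (30000000 + 400 * |m|) * ε ^ 2 * (1 / 2)
      ≤ (30000000 + 400 * |m|) * ε ^ 2 * (1 + δ) :=
    mul_le_mul_of_nonneg_left hd (by positivity)
  nlinarith [sq_nonneg ε]

end FirstOrder

theorem exists_isSecondMoment_expansion_one : ∃ μ : ℝ → ℝ,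
    (∀ᶠ n in 𝓝 1, IsSecondMoment n (μ n)) ∧
      (fun n => μ n - (π
            + (π / 4 * (-cosineIntegralCin (2 * π) + 6 - 4 * log (2 * π))
                - 1 / 2 * sineIntegral (2 * π)) * (n - 1)))
          =O[𝓝 1] fun n => (n - 1) ^ 2 := by
  have hex : ∀ ε : ℝ, |ε| ≤ 1 / 40000 → ∃ f, IsBoundedSource f (2000 * |ε|) ∧
      IsBoundedSource f (1 / 2) ∧ ∀ t ∈ Ioo 0 π, sineResponse (forcing ε f) t = f t :=
    fun ε hε => exists_fixedPoint_forcing hε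
  choose! f hf hf' hfix using hex
  have hmem : ∀ᶠ n : ℝ in 𝓝 1, |n - 1| ≤ 1 / 40000 := by
    filter_upwards [Metric.closedBall_mem_nhds (1 : ℝ) (by norm_num : (0 : ℝ) < 1 / 40000)]
      with n hn
    rwa [Metric.mem_closedBall, dist_eq] at hn
  refine ⟨fun n => π * (1 - cosineMoment (forcing (n - 1) (f (n - 1))) π)
    / (1 + detuning (n - 1) (f (n - 1))), ?_, IsBigO.of_bound
    (30000000 + 400 * |π / 4 * (-cosineIntegralCin (2 * π) + 6 - 4 * log (2 * π))
      - 1 / 2 * sineIntegral (2 * π)|) ?_⟩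
  · filter_upwards [hmem] with n hn
    have h := isSecondMoment_of_fixedPoint (hn.trans (by norm_num)) (hf' _ hn) (hfix _ hn)
    rwa [add_sub_cancel] at h
  · filter_upwards [hmem] with n hn
    have h := abs_secondMoment_sub_le (hf _ hn) (hf' _ hn) (hn.trans (by norm_num))
    rw [norm_eq_abs, norm_eq_abs, abs_of_nonneg (sq_nonneg (n - 1))]
    exact h

theorem mainTheorem6 :
    ((∀ᶠ n : ℝ in 𝓝[≥] 0, ∃! m : ℝ, IsSecondMoment n m) ∧
      ∀ μ : ℝ → ℝ, (∀ᶠ n in 𝓝[≥] 0, IsSecondMoment n (μ n)) →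
        (fun n => μ n -
          (π ^ 3 / 3
            + 2 * π ^ 3 / 9 * (-4 + 3 * log 2) * n
            + π ^ 3 / 54 * (-21 * π ^ 2 + 200 + 12 * log 2 + 36 * log 2 ^ 2) * n ^ 2
            + π ^ 3 / 81 * (-3464 + 75 * π ^ 2 - 210 * log 2 - 63 * π ^ 2 * log 2
                + 180 * log 2 ^ 2 + 36 * log 2 ^ 3 + 2646 * (riemannZeta 3).re) * n ^ 3))
          =O[𝓝[≥] 0] fun n => n ^ 4) ∧
    ((∀ᶠ n : ℝ in 𝓝 1, ∃! m : ℝ, IsSecondMoment n m) ∧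
      ∀ μ : ℝ → ℝ, (∀ᶠ n in 𝓝 1, IsSecondMoment n (μ n)) →
        (fun n => μ n -
          (π
            + (π / 4 * (-cosineIntegralCin (2 * π) + 6 - 4 * log (2 * π))
                - 1 / 2 * sineIntegral (2 * π)) * (n - 1)))
          =O[𝓝 1] fun n => (n - 1) ^ 2) := by
  obtain ⟨μ₀, hμ₀, hO₀⟩ := exists_isSecondMoment_expansion_zero
  obtain ⟨μ₁, hμ₁, hO₁⟩ := exists_isSecondMoment_expansion_one
  refine ⟨⟨eventually_existsUnique_isSecondMoment hμ₀, fun μ hμ => ?_⟩,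
    ⟨eventually_existsUnique_isSecondMoment hμ₁, fun μ hμ => ?_⟩⟩
  -- By uniqueness of the moment, any choice of μ agrees eventually with the constructed one.
  · refine hO₀.congr' ?_ EventuallyEq.rfl
    filter_upwards [hμ, hμ₀] with n h₁ h₂
    rw [h₁.unique h₂]
  · refine hO₁.congr' ?_ EventuallyEq.rfl
    filter_upwards [hμ, hμ₁] with n h₁ h₂
    rw [h₁.unique h₂]
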